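/- **Theorem 3 (on stability of the class of $\mathcal S$-functions).** Let $\mathbb S^2=\mathbb C\cup\{\infty\}$ be the Riemann sphere. A regular germ at $a\in\mathbb S^2$ is a germ at $a$ of a $\mathbb C$-valued holomorphic function. Two regular germs are equivalent if one is obtained from the other by analytic continuation along a path in $\mathbb S^2$; a multivalued analytic function is the set of all regular germs equivalent to a given regular germ (the function generated by that germ), and its elements are called its germs. A point $b\in\mathbb S^2$ is a singular point of a regular germ $f_a$ if there is a path $\gamma:[0,1]\to\mathbb S^2$ with $\gamma(0)=a$, $\gamma(1)=b$ such that $f_a$ has no analytic continuation along $\gamma$ but has one along $\gamma|_{[0,\tau]}$ for every $0\le\tau<1$. A multivalued analytic function is an $\mathcal S$-function if each of its germs has at most countably many singular points. Derivatives are taken with respect to the coordinate $x$ of $\mathbb C$. The class $\mathcal S$ of all $\mathcal S$-functions is stable under the following operations, where an operation on multivalued functions means: choose any point $a\in\mathbb S^2$ and any germs at $a$ of the given functions (in the case of composition $g\circ f$: a germ $f_a$ of $f$ at $a$ and a germ of $g$ at the point $f_a(a)$), apply the operation to these germs, and take the multivalued function generated by any resulting regular germ at $a$. 1. Differentiation: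 if $f\in\mathcal S$, then $f'\in\mathcal S$. 2. Integration: if $f\in\mathcal S$ and $g'=f$, then $g\in\mathcal S$. 3. Composition: if $g,f\in\mathcal S$, then $g\circ f\in\mathcal S$. 4. Meromorphic operations: if $f_1,\dots,f_n\in\mathcal S$, $F$ is a meromorphic function on $\mathbb C^n$ (locally a quotient of holomorphic functions, with denominator not identically zero), and $f=F(f_1,\dots,f_n)$, then $f\in\mathcal S$. Here $f=F(f_1,\dots,f_n)$ for germs at $a$ means that for all $z\ne a$ close to $a$ the function $F$ is holomorphic at $(f_1(z),\dots,f_n(z))$ and has the value $f(z)$ there. 5. Solving algebraic equations: if $f_1,\dots,f_n\in\mathcal S$ and $f^n+f_1f^{n-1}+\dots+f_n=0$, then $f\in\mathcal S$. 6. Solving linear differential equations: if $f_1,\dots,f_n\in\mathcal S$ and $f^{(n)}+f_1f^{(n-1)}+\dots+f_nf=0$, then $f\in\mathcal S$. -/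

import Mathlib

noncomputable section

open Filter Topology OnePoint

namespace SFun

/-- The Riemann sphere, as the one-point compactification of the complex line. -/
abbrev Sphere : Type := OnePoint ℂ

/-- The inverse `w ↦ 1 / w` of the local coordinate at infinity. -/
def inftyChart (w : ℂ) : Sphere :=
  if w = 0 then ∞ else ((w⁻¹ : ℂ) : Sphere)

/-- A `ℂ`-valued function is holomorphic at a point of the sphere: the coordinate is `z` at finite
points and `1 / z` at infinity. -/
def HolomorphicAt (F : Sphere → ℂ) : Sphere → Prop
  | ∞ => AnalyticAt ℂ (fun w : ℂ => F (inftyChart w)) 0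
  | (z : ℂ) => AnalyticAt ℂ (fun w : ℂ => F (w : Sphere)) z

theorem HolomorphicAt.continuousAt {F : Sphere → ℂ} {a : Sphere} (h : HolomorphicAt F a) :
    ContinuousAt F a := by
  induction a using OnePoint.rec with
  | infty =>
    have h0 : ContinuousAt (fun w : ℂ => F (inftyChart w)) 0 := AnalyticAt.continuousAt h
    rw [OnePoint.continuousAt_infty']
    have h1 : Tendsto (fun w : ℂ => w⁻¹) (coclosedCompact ℂ) (𝓝 0) := by
      rw [coclosedCompact_eq_cocompact, ← Metric.cobounded_eq_cocompact]
      exact Filter.tendsto_inv₀_cobounded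
    have h2 : Tendsto (fun z : ℂ => F (inftyChart z⁻¹)) (coclosedCompact ℂ) (𝓝 (F ∞)) := by
      have := h0.tendsto.comp h1
      simp only [inftyChart, if_pos] at this ⊢
      exact this
    refine h2.congr' ?_
    have h3 : ∀ᶠ z : ℂ in coclosedCompact ℂ, z ≠ 0 := by
      rw [coclosedCompact_eq_cocompact]
      exact (isCompact_singleton (x := (0 : ℂ))).compl_mem_cocompact
    filter_upwards [h3] with z hz
    simp [inftyChart, hz]
  | coe z =>
    rw [OnePoint.continuousAt_coe]
    exact AnalyticAt.continuousAt h

/-- The ring of regular germs at the point `a` of the sphere. -/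
def RegularGermAt (a : Sphere) : Subring ((𝓝 a).Germ ℂ) where
  carrier := {φ | ∃ F : Sphere → ℂ, HolomorphicAt F a ∧ φ = (F : (𝓝 a).Germ ℂ)}
  zero_mem' := ⟨fun _ => 0, by
    induction a using OnePoint.rec <;> exact analyticAt_const, rfl⟩
  one_mem' := ⟨fun _ => 1, by
    induction a using OnePoint.rec <;> exact analyticAt_const, rfl⟩
  add_mem' := by
    rintro _ _ ⟨F, hF, rfl⟩ ⟨G, hG, rfl⟩
    refine ⟨fun p => F p + G p, ?_, rfl⟩
    induction a using OnePoint.rec <;> exact AnalyticAt.fun_add hF hG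
  mul_mem' := by
    rintro _ _ ⟨F, hF, rfl⟩ ⟨G, hG, rfl⟩
    refine ⟨fun p => F p * G p, ?_, rfl⟩
    induction a using OnePoint.rec <;> exact AnalyticAt.fun_mul hF hG
  neg_mem' := by
    rintro _ ⟨F, hF, rfl⟩
    refine ⟨fun p => - F p, ?_, rfl⟩
    induction a using OnePoint.rec <;> exact AnalyticAt.fun_neg hF

/-- A regular germ at some point of the sphere. -/
abbrev RegularGerm : Type := Σ a : Sphere, RegularGermAt a

/-- `Φ` is an analytic continuation of the germ `φ` along the path `γ` restricted to `[0, τ]`: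
`Φ t` is a regular germ at `γ t`, and near each time all `Φ s` are germs of one function. -/
structure IsContinuation (φ : RegularGerm) (γ : unitInterval → Sphere) (τ : unitInterval)
    (Φ : unitInterval → RegularGerm) : Prop where
  start : Φ 0 = φ
  base : ∀ t ≤ τ, (Φ t).1 = γ t
  coherent : ∀ t ≤ τ, ∃ F : Sphere → ℂ, ∀ᶠ s in 𝓝[Set.Iic τ] t,
    ((Φ s).2 : (𝓝 (Φ s).1).Germ ℂ) = (F : (𝓝 (Φ s).1).Germ ℂ)

/-- `ψ` is obtained from `φ` by analytic continuation along some path. -/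
def Equivalent (φ ψ : RegularGerm) : Prop :=
  ∃ (γ : Path φ.1 ψ.1) (Φ : unitInterval → RegularGerm), IsContinuation φ γ 1 Φ ∧ Φ 1 = ψ

/-- The set of singular points of a regular germ. -/
def singularSet (φ : RegularGerm) : Set Sphere :=
  {b | ∃ γ : Path φ.1 b, (¬ ∃ Φ, IsContinuation φ γ 1 Φ) ∧
    ∀ τ : unitInterval, τ < 1 → ∃ Φ, IsContinuation φ γ τ Φ}

def IsSGerm (φ : RegularGerm) : Prop := (singularSet φ).Countable

/-- The set of all regular germs of the multivalued function generated by a germ. -/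
def germsGeneratedBy (φ : RegularGerm) : Set RegularGerm := {ψ | Equivalent φ ψ}

/-- A multivalued analytic function on the sphere: the set of all regular germs equivalent to one
regular germ. -/
structure MultivaluedFunction where
  germs : Set RegularGerm
  exists_generator : ∃ φ, germs = germsGeneratedBy φ

/-- The multivalued function generated by a germ. -/
def generatedBy {a : Sphere} (φ : RegularGermAt a) : MultivaluedFunction :=
  ⟨germsGeneratedBy ⟨a, φ⟩, ⟨a, φ⟩, rfl⟩

/-- `φ` is a regular germ of the multivalued function `f` at the point `a`. -/
def MultivaluedFunction.HasGerm (f : MultivaluedFunction) {a : Sphere} (φ : RegularGermAt a) :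
    Prop :=
  (⟨a, φ⟩ : RegularGerm) ∈ f.germs

def IsSFunction (f : MultivaluedFunction) : Prop := ∀ φ ∈ f.germs, IsSGerm φ

/-- The derivative with respect to the coordinate `z` of `ℂ`. At infinity, in the coordinate
`w = 1 / z`, it is `- w ^ 2 * (d / dw)`, so the derivative of a holomorphic function vanishes. -/
def sphereDeriv (F : Sphere → ℂ) : Sphere → ℂ
  | ∞ => 0
  | (z : ℂ) => deriv (fun w : ℂ => F (w : Sphere)) z

theorem sphereDeriv_congr {a : Sphere} {F G : Sphere → ℂ} (h : F =ᶠ[𝓝 a] G) :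
    sphereDeriv F =ᶠ[𝓝 a] sphereDeriv G := by
  filter_upwards [eventually_eventually_nhds.2 h] with p hp
  induction p using OnePoint.rec with
  | infty => rfl
  | coe z =>
    have h1 : ∀ᶠ w : ℂ in 𝓝 z, F (w : Sphere) = G (w : Sphere) :=
      (OnePoint.continuous_coe.tendsto z).eventually hp
    exact Filter.EventuallyEq.deriv_eq h1

theorem HolomorphicAt.sphereDeriv {F : Sphere → ℂ} {a : Sphere} (h : HolomorphicAt F a) :
    HolomorphicAt (sphereDeriv F) a := by
  induction a using OnePoint.rec with
  | coe z => exact AnalyticAt.deriv h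
  | infty =>
    have h0 : AnalyticAt ℂ (fun w : ℂ => F (inftyChart w)) 0 := h
    have h1 : AnalyticAt ℂ
        (fun w : ℂ => - w ^ 2 * deriv (fun u : ℂ => F (inftyChart u)) w) 0 :=
      ((analyticAt_id.pow 2).neg).mul h0.deriv
    refine AnalyticAt.congr h1 ?_
    filter_upwards [h0.eventually_analyticAt] with w hw
    by_cases hw0 : w = 0
    · subst hw0
      simp [inftyChart, SFun.sphereDeriv]
    · have hc : inftyChart w = ((w⁻¹ : ℂ) : Sphere) := if_neg hw0
      have hd : HasDerivAt (fun u : ℂ => F (inftyChart u))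
          (deriv (fun u : ℂ => F (inftyChart u)) w) (w⁻¹)⁻¹ := by
        rw [inv_inv]; exact hw.differentiableAt.hasDerivAt
      have hi := hasDerivAt_inv (inv_ne_zero hw0)
      have hcomp := hd.comp w⁻¹ hi
      have he : (fun u : ℂ => F (u : Sphere)) =ᶠ[𝓝 w⁻¹]
          ((fun u : ℂ => F (inftyChart u)) ∘ fun u => u⁻¹) := by
        filter_upwards [eventually_ne_nhds (inv_ne_zero hw0)] with u hu
        simp [inftyChart, hu]
      have hfin := (hcomp.congr_of_eventuallyEq he).deriv
      rw [hc]
      change _ = deriv (fun u : ℂ => F (u : Sphere)) w⁻¹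
      rw [hfin]
      field_simp

/-- The derivative of a germ. -/
def germDeriv {a : Sphere} (φ : (𝓝 a).Germ ℂ) : (𝓝 a).Germ ℂ :=
  Filter.Germ.map' sphereDeriv (fun _ _ h => sphereDeriv_congr h) φ

/-- The derivative of a regular germ, with respect to the coordinate of `ℂ`. -/
def derivGerm {a : Sphere} (φ : RegularGermAt a) : RegularGermAt a :=
  ⟨germDeriv φ.1, by
    obtain ⟨_, F, hF, rfl⟩ := φ
    exact ⟨_, hF.sphereDeriv, rfl⟩⟩

/-- The value of a regular germ at its base point. -/
def germValue {a : Sphere} (φ : RegularGermAt a) : ℂ :=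
  Filter.Germ.value φ.1

theorem tendsto_coe_germ {a : Sphere} (φ : RegularGermAt a) :
    (φ.1.map ((↑) : ℂ → Sphere)).Tendsto (𝓝 ((germValue φ : ℂ) : Sphere)) := by
  obtain ⟨_, F, hF, rfl⟩ := φ
  exact (OnePoint.continuous_coe.tendsto (F a)).comp hF.continuousAt

/-- The composition `ψ ∘ φ` of a regular germ `φ` at `a` with a regular germ `ψ` at the value of
`φ` at `a`. -/
def compGerm {a : Sphere} (φ : RegularGermAt a)
    (ψ : RegularGermAt ((germValue φ : ℂ) : Sphere)) : RegularGermAt a :=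
  ⟨ψ.1.compTendsto' (φ.1.map ((↑) : ℂ → Sphere)) (tendsto_coe_germ φ), by
    obtain ⟨_, F, hF, rfl⟩ := φ
    obtain ⟨_, G, hG, rfl⟩ := ψ
    refine ⟨fun p => G (F p : Sphere), ?_, rfl⟩
    have hG' : AnalyticAt ℂ (fun w : ℂ => G (w : Sphere)) (F a) := hG
    induction a using OnePoint.rec with
    | coe z => exact AnalyticAt.fun_comp (f := fun w : ℂ => F (w : Sphere)) hG' hF
    | infty =>
      have hF' : AnalyticAt ℂ (fun w : ℂ => F (inftyChart w)) 0 := hF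
      have hv : F (inftyChart 0) = F ∞ := by simp [inftyChart]
      rw [← hv] at hG'
      exact AnalyticAt.fun_comp (f := fun w : ℂ => F (inftyChart w)) hG' hF'⟩

/-- `F` represents a meromorphic function on `ℂⁿ`: near every point it is a quotient of two
holomorphic functions, the denominator not vanishing identically. Values of `F` on thin sets
where denominators vanish are irrelevant. -/
def IsMeromorphic {n : ℕ} (F : (Fin n → ℂ) → ℂ) : Prop :=
  ∀ p, ∃ G H : (Fin n → ℂ) → ℂ, AnalyticAt ℂ G p ∧ AnalyticAt ℂ H p ∧
    (¬ ∀ᶠ x in 𝓝 p, H x = 0) ∧ ∀ᶠ x in 𝓝 p, H x ≠ 0 → F x = G x / H x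

/-- The meromorphic function represented by `F` is holomorphic at `p` and has the value `c`
there: off the zero set of a nontrivial holomorphic function, `F` coincides near `p` with a
function `G` that is holomorphic at `p` with `G p = c`. -/
def HasMeromorphicValue {n : ℕ} (F : (Fin n → ℂ) → ℂ) (p : Fin n → ℂ) (c : ℂ) : Prop :=
  ∃ G H : (Fin n → ℂ) → ℂ, AnalyticAt ℂ G p ∧ AnalyticAt ℂ H p ∧
    (¬ ∀ᶠ x in 𝓝 p, H x = 0) ∧ (∀ᶠ x in 𝓝 p, H x ≠ 0 → F x = G x) ∧ G p = c

/-- The regular germ `χ` at `a` is `F(φ₁, …, φₙ)`: at every point `z ≠ a` close to `a`, the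
meromorphic function `F` is holomorphic at `(φ₁(z), …, φₙ(z))` and has the value `χ(z)` there. -/
def IsMeromorphicImage {n : ℕ} (F : (Fin n → ℂ) → ℂ) {a : Sphere}
    (φ : Fin n → RegularGermAt a) (χ : RegularGermAt a) : Prop :=
  ∃ (f : Fin n → Sphere → ℂ) (k : Sphere → ℂ),
    (∀ i, (φ i : (𝓝 a).Germ ℂ) = (f i : (𝓝 a).Germ ℂ)) ∧
    (χ : (𝓝 a).Germ ℂ) = (k : (𝓝 a).Germ ℂ) ∧
    ∀ᶠ z in 𝓝[≠] a, HasMeromorphicValue F (fun i => f i z) (k z)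

/-! Operations on multivalued functions. The result of an operation is a set of multivalued
functions: choose a point, choose germs of the given functions there, apply the operation to the
germs, and take the multivalued function generated by the resulting germ. -/

/-- `h` is a derivative of `f`. -/
def IsDerivativeOf (h f : MultivaluedFunction) : Prop :=
  ∃ (a : Sphere) (φ : RegularGermAt a), f.HasGerm φ ∧ h = generatedBy (derivGerm φ)

/-- `h` is an integral of `f`. -/
def IsIntegralOf (h f : MultivaluedFunction) : Prop :=
  ∃ (a : Sphere) (φ χ : RegularGermAt a), f.HasGerm φ ∧ derivGerm χ = φ ∧ h = generatedBy χ

/-- `h` is representable as the composition `g ∘ f`. -/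
def IsCompositionOf (h g f : MultivaluedFunction) : Prop :=
  ∃ (a : Sphere) (φ : RegularGermAt a) (ψ : RegularGermAt ((germValue φ : ℂ) : Sphere)),
    f.HasGerm φ ∧ g.HasGerm ψ ∧ h = generatedBy (compGerm φ ψ)

/-- `h` is representable as `F(f₁, …, fₙ)`. -/
def IsMeromorphicOperationOf {n : ℕ} (h : MultivaluedFunction) (F : (Fin n → ℂ) → ℂ)
    (f : Fin n → MultivaluedFunction) : Prop :=
  ∃ (a : Sphere) (φ : Fin n → RegularGermAt a) (χ : RegularGermAt a),
    (∀ i, (f i).HasGerm (φ i)) ∧ IsMeromorphicImage F φ χ ∧ h = generatedBy χ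

/-- `h` solves the equation `hⁿ + f₁ hⁿ⁻¹ + ⋯ + fₙ = 0`; here `fᵢ₊₁` is `f i`. -/
def IsAlgebraicSolutionOf {n : ℕ} (h : MultivaluedFunction)
    (f : Fin n → MultivaluedFunction) : Prop :=
  ∃ (a : Sphere) (φ : Fin n → RegularGermAt a) (χ : RegularGermAt a),
    (∀ i, (f i).HasGerm (φ i)) ∧
    χ ^ n + ∑ i : Fin n, φ i * χ ^ (n - (i + 1 : ℕ)) = 0 ∧ h = generatedBy χ

/-- `h` solves the equation `h⁽ⁿ⁾ + f₁ h⁽ⁿ⁻¹⁾ + ⋯ + fₙ h = 0`; here `fᵢ₊₁` is `f i`. -/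
def IsLinearODESolutionOf {n : ℕ} (h : MultivaluedFunction)
    (f : Fin n → MultivaluedFunction) : Prop :=
  ∃ (a : Sphere) (φ : Fin n → RegularGermAt a) (χ : RegularGermAt a),
    (∀ i, (f i).HasGerm (φ i)) ∧
    derivGerm^[n] χ +
      ∑ i : Fin n, φ i * derivGerm^[n - (i + 1 : ℕ)] χ = 0 ∧ h = generatedBy χ

end SFun

end

open SFun

/-! Let `A` be a countable set containing the singular points of the given germs. Every path can be
perturbed off `A` except at its endpoints, so a germ which is continuable along all paths avoiding
`A` has its singular points in `A`. Along such a path the given germs are continued jointly, and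
the result of the operation follows them as long as the operation can be performed on the continued
germs. The points where this fails on a joint branch are isolated on that branch, and there are
countably many of them because a germ has only countably many continuations to each small disc
(Poincaré–Volterra); they are added to `A`. -/

noncomputable section

open Filter Topology OnePoint

namespace SFun

/-! ### Topological preliminaries -/

theorem countable_of_isolated {X : Type*} [TopologicalSpace X] [SecondCountableTopology X]
    {S : Set X} (h : ∀ p ∈ S, ∀ᶠ z in 𝓝[≠] p, z ∉ S) : S.Countable := by
  have : DiscreteTopology S := by
    rw [discreteTopology_subtype_iff]
    intro p hp
    rw [← disjoint_iff, disjoint_principal_right]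
    exact h p hp
  exact Set.countable_coe_iff.1 (TopologicalSpace.separableSpace_iff_countable.1 inferInstance)

theorem isPathConnected_ball_diff_countable {A : Set ℂ} (hA : A.Countable) (c : ℂ) {r : ℝ}
    (hr : 0 < r) : IsPathConnected (Metric.ball c r \ A) := by
  let e := OpenPartialHomeomorph.univBall c r
  have hsrc : e.source = Set.univ := OpenPartialHomeomorph.univBall_source c r
  have htgt : e.target = Metric.ball c r := OpenPartialHomeomorph.univBall_target c hr
  have hinj : Function.Injective e := by
    have := e.injOn
    rw [hsrc] at this
    exact Set.injOn_univ.1 this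
  have hcont : Continuous e := by
    have := e.continuousOn
    rw [hsrc] at this
    exact continuousOn_univ.1 this
  have hpath : IsPathConnected (e ⁻¹' A)ᶜ :=
    (hA.preimage hinj).isPathConnected_compl_of_one_lt_rank (by simp)
  convert hpath.image hcont using 1
  rw [← htgt, ← e.image_source_eq_target, hsrc]
  ext z
  constructor
  · rintro ⟨⟨w, -, rfl⟩, h⟩
    exact ⟨w, h, rfl⟩
  · rintro ⟨w, h, rfl⟩
    exact ⟨⟨w, trivial, rfl⟩, h⟩

theorem exists_antitone_isOpen_nhds_basis {X : Type*} [TopologicalSpace X]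
    [FirstCountableTopology X] (b : X) :
    ∃ V : ℕ → Set X, Antitone V ∧ V 0 = Set.univ ∧ (∀ m, IsOpen (V m) ∧ b ∈ V m) ∧
      ∀ U ∈ 𝓝 b, ∃ m, V m ⊆ U := by
  obtain ⟨W, hW⟩ := (𝓝 b).exists_antitone_basis
  refine ⟨fun m => ⋂ i < m, interior (W i), fun m n hmn => ?_, by simp, fun m => ⟨?_, ?_⟩,
    fun U hU => ?_⟩
  · exact Set.biInter_subset_biInter_left fun i hi => lt_of_lt_of_le hi hmn
  · exact (Set.finite_lt_nat m).isOpen_biInter fun i _ => isOpen_interior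
  · simpa only [Set.mem_iInter, mem_interior_iff_mem_nhds] using fun i _ => hW.mem i
  · obtain ⟨i, -, hi⟩ := hW.1.mem_iff.1 hU
    exact ⟨i + 1, fun z hz => hi (interior_subset (Set.mem_iInter₂.1 hz i i.lt_succ_self))⟩

/-- The concatenation of the paths `p 0, p 1, …`, the path `p m` being run through between the
times `m` and `m + 1`. -/
def infiniteConcat {X : Type*} [TopologicalSpace X] {y : ℕ → X}
    (p : ∀ m, Path (y m) (y (m + 1))) (t : ℝ) : X :=
  (p ⌊t⌋₊).extend (t - ⌊t⌋₊)

theorem infiniteConcat_of_floor_eq {X : Type*} [TopologicalSpace X] {y : ℕ → X}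
    (p : ∀ m, Path (y m) (y (m + 1))) {t : ℝ} {n : ℕ} (h : ⌊t⌋₊ = n) :
    infiniteConcat p t = (p n).extend (t - n) := by
  subst h; rfl

theorem continuous_infiniteConcat {X : Type*} [TopologicalSpace X] {y : ℕ → X}
    (p : ∀ m, Path (y m) (y (m + 1))) : Continuous (infiniteConcat p) := by
  have eqOn_Icc (n : ℕ) :
      Set.EqOn (infiniteConcat p) (fun t => (p n).extend (t - n)) (Set.Icc n (n + 1)) := by
    rintro t ⟨hnt, htn⟩
    rcases htn.lt_or_eq with h | rfl
    · exact infiniteConcat_of_floor_eq p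
        ((Nat.floor_eq_iff ((Nat.cast_nonneg n).trans hnt)).2 ⟨hnt, h⟩)
    · have hfloor : ⌊(n + 1 : ℝ)⌋₊ = n + 1 := by exact_mod_cast Nat.floor_natCast (R := ℝ) (n + 1)
      simp [infiniteConcat_of_floor_eq p hfloor]
  have continuousOn_Iic (n : ℕ) : ContinuousOn (infiniteConcat p) (Set.Iic n) := by
    induction n with
    | zero =>
      refine continuousOn_const (c := y 0) |>.congr fun t ht => ?_
      have ht0 : t ≤ 0 := by simpa using ht
      simp [infiniteConcat_of_floor_eq p (Nat.floor_of_nonpos ht0), Path.extend_of_le_zero _ ht0]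
    | succ n ih =>
      rw [Nat.cast_succ, ← Set.Iic_union_Icc_eq_Iic (by linarith : (n : ℝ) ≤ n + 1)]
      refine ih.union_of_isClosed ?_ isClosed_Iic isClosed_Icc
      exact ((p n).continuous_extend.comp (by fun_prop)).continuousOn.congr (eqOn_Icc n)
  rw [continuous_iff_continuousAt]
  intro t
  obtain ⟨n, hn⟩ := exists_nat_gt t
  exact (continuousOn_Iic n).continuousAt (Iic_mem_nhds hn)

theorem tendsto_div_one_sub_atTop :
    Tendsto (fun s : unitInterval => (s : ℝ) / (1 - s)) (𝓝[<] 1) atTop := by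
  have hden : Tendsto (fun s : unitInterval => (1 : ℝ) - s) (𝓝[<] 1) (𝓝[>] 0) := by
    refine tendsto_nhdsWithin_iff.2 ⟨?_, ?_⟩
    · have : Continuous fun s : unitInterval => (1 : ℝ) - s := by fun_prop
      simpa using (this.tendsto 1).mono_left nhdsWithin_le_nhds
    · filter_upwards [self_mem_nhdsWithin] with s hs
      exact sub_pos.2 (show (s : ℝ) < 1 from hs)
  have hnum : Tendsto (fun s : unitInterval => (s : ℝ)) (𝓝[<] 1) (𝓝 1) :=
    (continuous_subtype_val.tendsto (1 : unitInterval)).mono_left nhdsWithin_le_nhds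
  exact hnum.pos_mul_atTop one_pos (tendsto_inv_nhdsGT_zero.comp hden)

theorem exists_continuousOn_Iio_one_eventually_mem {X : Type*} [TopologicalSpace X]
    {C : ℕ → Set X} (hC : Antitone C) (hpath : ∀ m, IsPathConnected (C m)) {x : X}
    (hx : x ∈ C 0) : ∃ f : unitInterval → X, f 0 = x ∧ ContinuousOn f (Set.Iio 1) ∧
      (∀ s, f s ∈ C 0) ∧ ∀ m, ∀ᶠ s in 𝓝[<] 1, f s ∈ C m := by
  choose y₀ hy₀ using fun m => (hpath m).nonempty
  let y : ℕ → X := fun m => if m = 0 then x else y₀ m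
  have hy (m : ℕ) : y m ∈ C m := by
    by_cases hm : m = 0
    · simpa only [y, hm, if_true] using hx
    · simpa only [y, hm, if_false] using hy₀ m
  choose p hp using fun m => (hpath m).joinedIn (y m) (hy m) (y (m + 1)) (hC m.le_succ (hy _))
  have mem_C (m : ℕ) (t : ℝ) (hmt : (m : ℝ) ≤ t) : infiniteConcat p t ∈ C m :=
    hC (Nat.le_floor hmt) (hp _ _)
  have nonneg (s : unitInterval) : (0 : ℝ) ≤ s / (1 - s) :=
    div_nonneg s.2.1 (sub_nonneg.2 s.2.2)
  refine ⟨fun s => infiniteConcat p (s / (1 - s)), ?_, ?_, fun s => mem_C 0 _ ?_, fun m => ?_⟩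
  · simp [infiniteConcat_of_floor_eq p (Nat.floor_zero (R := ℝ)), y]
  · refine (continuous_infiniteConcat p).comp_continuousOn (ContinuousOn.div ?_ ?_ fun s hs => ?_)
    · fun_prop
    · fun_prop
    · exact (sub_pos.2 (show (s : ℝ) < 1 from hs)).ne'
  · simpa using nonneg s
  · filter_upwards [tendsto_div_one_sub_atTop.eventually_ge_atTop (m : ℝ)] with s hs
    exact mem_C m _ hs

theorem exists_antitone_isConnected_eventually_mem {X Y : Type*} [TopologicalSpace X]
    [LocallyConnectedSpace X] [TopologicalSpace Y] [FirstCountableTopology Y] {q : X → Y}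
    (hq : Continuous q) {b : Y} {Γ : unitInterval → X} (hΓ : ContinuousOn Γ (Set.Iio 1))
    (hlim : Tendsto (q ∘ Γ) (𝓝[<] 1) (𝓝 b)) :
    ∃ C : ℕ → Set X, Antitone C ∧ (∀ m, IsOpen (C m) ∧ IsConnected (C m)) ∧ Γ 0 ∈ C 0 ∧
      (∀ U ∈ 𝓝 b, ∃ m, C m ⊆ q ⁻¹' U) ∧ ∀ m, ∀ᶠ t in 𝓝[<] 1, Γ t ∈ C m := by
  obtain ⟨V, hVanti, hV0, hV, hVb⟩ := exists_antitone_isOpen_nhds_basis b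
  have exists_tail (m : ℕ) : ∃ s ∈ Set.Iio (1 : unitInterval),
      Set.Ico s 1 ⊆ {t | q (Γ t) ∈ V m} := by
    obtain ⟨s', hs', hsub⟩ := (mem_nhdsLT_iff_exists_Ioo_subset' zero_lt_one).1
      (hlim ((hV m).1.mem_nhds (hV m).2))
    obtain ⟨s, hs's, hs⟩ := exists_between (Set.mem_Iio.1 hs')
    exact ⟨s, hs, fun t ht => hsub ⟨hs's.trans_le ht.1, ht.2⟩⟩
  choose s hs1 hsV using exists_tail
  let C : ℕ → Set X := fun m => connectedComponentIn (q ⁻¹' V m) (Γ (s m))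
  have mem_C {m : ℕ} {I : Set unitInterval} (hI : I.OrdConnected) (hI1 : I ⊆ Set.Iio 1)
      (hIV : ∀ t ∈ I, q (Γ t) ∈ V m) (hsI : s m ∈ I) {t : unitInterval} (ht : t ∈ I) :
      Γ t ∈ C m :=
    (hI.isPreconnected.image Γ (hΓ.mono hI1)).subset_connectedComponentIn
      (Set.mem_image_of_mem _ hsI) (by rintro _ ⟨u, hu, rfl⟩; exact hIV u hu)
      (Set.mem_image_of_mem _ ht)
  have mem_C_of_le (m : ℕ) {t : unitInterval} (ht : s m ≤ t) (ht1 : t < 1) : Γ t ∈ C m :=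
    mem_C Set.ordConnected_Ico (fun _ hu => hu.2) (hsV m) ⟨le_rfl, hs1 m⟩ ⟨ht, ht1⟩
  refine ⟨C, antitone_nat_of_succ_le fun m => ?_, fun m => ⟨?_, ?_⟩, ?_, fun U hU => ?_,
    fun m => ?_⟩
  · have hmax : max (s m) (s (m + 1)) < 1 := max_lt (hs1 _) (hs1 _)
    refine (isPreconnected_connectedComponentIn.subset_connectedComponentIn
      (mem_C_of_le (m + 1) (le_max_right _ _) hmax) ((connectedComponentIn_subset _ _).trans
        (Set.preimage_mono (hVanti m.le_succ)))).trans_eq ?_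
    exact (connectedComponentIn_eq (mem_C_of_le m (le_max_left _ _) hmax)).symm
  · exact ((hV m).1.preimage hq).connectedComponentIn
  · exact ⟨⟨_, mem_C_of_le m le_rfl (hs1 m)⟩, isPreconnected_connectedComponentIn⟩
  · exact mem_C Set.ordConnected_Iio subset_rfl (fun _ _ => by simp [hV0]) (hs1 0)
      (Set.mem_Iio.2 zero_lt_one)
  · obtain ⟨m, hm⟩ := hVb U hU
    exact ⟨m, (connectedComponentIn_subset _ _).trans (Set.preimage_mono hm)⟩
  · filter_upwards [Ico_mem_nhdsLT (hs1 m)] with t ht using mem_C_of_le m ht.1 ht.2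

/-! ### The Riemann sphere -/

@[simp] theorem inftyChart_zero : inftyChart 0 = ∞ := by simp [inftyChart]

theorem inftyChart_of_ne {w : ℂ} (h : w ≠ 0) : inftyChart w = ((w⁻¹ : ℂ) : Sphere) := by
  simp [inftyChart, h]

/-- The inversion `z ↦ 1 / z` of the sphere. -/
def sphereInv : Sphere → Sphere
  | ∞ => ((0 : ℂ) : Sphere)
  | (z : ℂ) => inftyChart z

@[simp] theorem sphereInv_infty : sphereInv ∞ = ((0 : ℂ) : Sphere) := rfl

@[simp] theorem sphereInv_coe (z : ℂ) : sphereInv (z : Sphere) = inftyChart z := rfl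

theorem sphereInv_involutive : Function.Involutive sphereInv := by
  intro p
  induction p using OnePoint.rec with
  | infty => simp
  | coe z =>
    by_cases hz : z = 0
    · simp [hz]
    · simp [inftyChart_of_ne hz, inftyChart_of_ne (inv_ne_zero hz)]

theorem tendsto_inv_coclosedCompact : Tendsto (fun w : ℂ => w⁻¹) (coclosedCompact ℂ) (𝓝 0) := by
  rw [coclosedCompact_eq_cocompact, ← Metric.cobounded_eq_cocompact]
  exact Filter.tendsto_inv₀_cobounded

theorem continuous_sphereInv : Continuous sphereInv := by
  rw [continuous_iff_continuousAt]
  intro p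
  induction p using OnePoint.rec with
  | infty =>
    rw [OnePoint.continuousAt_infty']
    refine ((OnePoint.continuous_coe.tendsto (0 : ℂ)).comp
      tendsto_inv_coclosedCompact).congr' ?_
    have eventually_ne : ∀ᶠ z : ℂ in coclosedCompact ℂ, z ≠ 0 := by
      rw [coclosedCompact_eq_cocompact]
      exact (isCompact_singleton (x := (0 : ℂ))).compl_mem_cocompact
    filter_upwards [eventually_ne] with z hz
    simp [inftyChart_of_ne hz]
  | coe z =>
    rw [OnePoint.continuousAt_coe]
    by_cases hz : z = 0
    · subst hz
      rw [continuousAt_iff_punctured_nhds]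
      have tendsto_inv : Tendsto (fun w : ℂ => w⁻¹) (𝓝[≠] 0) (coclosedCompact ℂ) := by
        rw [coclosedCompact_eq_cocompact, ← Metric.cobounded_eq_cocompact]
        exact Filter.tendsto_inv₀_nhdsNE_zero
      simp only [Function.comp_apply, sphereInv_coe, inftyChart_zero]
      refine (OnePoint.tendsto_coe_infty.comp tendsto_inv).congr' ?_
      filter_upwards [self_mem_nhdsWithin] with w hw
      simp [inftyChart_of_ne hw]
    · have h : ContinuousAt (fun w : ℂ => ((w⁻¹ : ℂ) : Sphere)) z :=
        OnePoint.continuous_coe.continuousAt.comp (continuousAt_inv₀ hz)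
      refine h.congr ?_
      filter_upwards [eventually_ne_nhds hz] with w hw
      simp [inftyChart_of_ne hw]

/-- The inversion of the sphere, as a homeomorphism. -/
def sphereInvHomeo : Sphere ≃ₜ Sphere where
  toEquiv := sphereInv_involutive.toPerm
  continuous_toFun := continuous_sphereInv
  continuous_invFun := continuous_sphereInv

theorem isOpenEmbedding_inftyChart : IsOpenEmbedding inftyChart :=
  sphereInvHomeo.isOpenEmbedding.comp OnePoint.isOpenEmbedding_coe

/-- A chart of the sphere centred at a given point, which has the coordinate `0`; at a finite point
it is a translate of the coordinate of `ℂ`. -/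
def chart : Sphere → ℂ → Sphere
  | ∞ => inftyChart
  | (z : ℂ) => fun w => ((z + w : ℂ) : Sphere)

theorem chart_infty : chart ∞ = inftyChart := rfl

theorem chart_coe (z w : ℂ) : chart (z : Sphere) w = ((z + w : ℂ) : Sphere) := rfl

@[simp] theorem chart_zero (a : Sphere) : chart a 0 = a := by
  induction a using OnePoint.rec <;> simp [chart_infty, chart_coe]

theorem isOpenEmbedding_chart (a : Sphere) : IsOpenEmbedding (chart a) := by
  induction a using OnePoint.rec with
  | infty => exact isOpenEmbedding_inftyChart
  | coe z => exact OnePoint.isOpenEmbedding_coe.comp (Homeomorph.addLeft z).isOpenEmbedding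

theorem map_chart_nhds (a : Sphere) (w : ℂ) : map (chart a) (𝓝 w) = 𝓝 (chart a w) :=
  (isOpenEmbedding_chart a).map_nhds_eq w

theorem eventually_chart_iff {a : Sphere} {w : ℂ} {p : Sphere → Prop} :
    (∀ᶠ z in 𝓝 (chart a w), p z) ↔ ∀ᶠ u in 𝓝 w, p (chart a u) := by
  rw [← map_chart_nhds, eventually_map]

theorem eventually_nhds_iff_chart {a : Sphere} {p : Sphere → Prop} :
    (∀ᶠ z in 𝓝 a, p z) ↔ ∀ᶠ u in 𝓝 0, p (chart a u) := by
  rw [← eventually_chart_iff, chart_zero]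

theorem eventually_nhdsNE_iff_chart {a : Sphere} {p : Sphere → Prop} :
    (∀ᶠ z in 𝓝[≠] a, p z) ↔ ∀ᶠ u in 𝓝[≠] 0, p (chart a u) := by
  rw [eventually_nhdsWithin_iff, eventually_nhdsWithin_iff, eventually_nhds_iff_chart]
  refine eventually_congr (Eventually.of_forall fun u => ?_)
  have : chart a u = a ↔ u = 0 :=
    ⟨fun h => (isOpenEmbedding_chart a).injective (h.trans (chart_zero a).symm),
      fun h => by simp [h]⟩
  simp [this]

theorem holomorphicAt_coe_iff {F : Sphere → ℂ} {z : ℂ} :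
    HolomorphicAt F (z : Sphere) ↔ AnalyticAt ℂ (fun w : ℂ => F (w : Sphere)) z := Iff.rfl

theorem holomorphicAt_chart_iff {F : Sphere → ℂ} {a : Sphere} {w : ℂ} :
    HolomorphicAt F (chart a w) ↔ AnalyticAt ℂ (fun u => F (chart a u)) w := by
  induction a using OnePoint.rec with
  | infty =>
    by_cases hw : w = 0
    · subst hw
      rw [chart_infty, inftyChart_zero]
      rfl
    · rw [chart_infty, inftyChart_of_ne hw, holomorphicAt_coe_iff]
      constructor
      · intro h
        have := AnalyticAt.fun_comp (f := fun u : ℂ => u⁻¹) h (analyticAt_inv hw)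
        refine this.congr ?_
        filter_upwards [eventually_ne_nhds hw] with u hu
        simp [inftyChart_of_ne hu]
      · intro h
        rw [← inv_inv w] at h
        have hw' := inv_ne_zero hw
        have := AnalyticAt.fun_comp (f := fun u : ℂ => u⁻¹) h (analyticAt_inv hw')
        refine this.congr ?_
        filter_upwards [eventually_ne_nhds hw'] with u hu
        simp [inftyChart_of_ne (inv_ne_zero hu)]
  | coe z =>
    rw [chart_coe, holomorphicAt_coe_iff]
    constructor
    · intro h
      exact AnalyticAt.fun_comp (f := fun u : ℂ => z + u) h (by fun_prop)
    · intro h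
      have h' : AnalyticAt ℂ (fun u => F (chart (z : Sphere) u)) ((z + w) - z) := by
        simpa using h
      have := AnalyticAt.fun_comp (f := fun u : ℂ => u - z) h' (by fun_prop)
      refine this.congr (Eventually.of_forall fun u => ?_)
      simp [chart_coe]

theorem holomorphicAt_iff_chart {F : Sphere → ℂ} {a : Sphere} :
    HolomorphicAt F a ↔ AnalyticAt ℂ (fun u => F (chart a u)) 0 := by
  rw [← holomorphicAt_chart_iff, chart_zero]

namespace HolomorphicAt

variable {F G : Sphere → ℂ} {a : Sphere}

theorem congr (h : HolomorphicAt F a) (hFG : F =ᶠ[𝓝 a] G) : HolomorphicAt G a := by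
  rw [holomorphicAt_iff_chart] at *
  exact AnalyticAt.congr h (eventually_nhds_iff_chart.1 hFG)

theorem eventually (h : HolomorphicAt F a) : ∀ᶠ z in 𝓝 a, HolomorphicAt F z := by
  rw [holomorphicAt_iff_chart] at h
  rw [eventually_nhds_iff_chart]
  filter_upwards [h.eventually_analyticAt] with w hw
  rwa [holomorphicAt_chart_iff]

theorem const (c : ℂ) : HolomorphicAt (fun _ => c) a := by
  rw [holomorphicAt_iff_chart]; exact analyticAt_const

theorem add (hF : HolomorphicAt F a) (hG : HolomorphicAt G a) :
    HolomorphicAt (fun z => F z + G z) a := by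
  rw [holomorphicAt_iff_chart] at *; exact hF.fun_add hG

theorem sub (hF : HolomorphicAt F a) (hG : HolomorphicAt G a) :
    HolomorphicAt (fun z => F z - G z) a := by
  rw [holomorphicAt_iff_chart] at *; exact hF.fun_sub hG

theorem mul (hF : HolomorphicAt F a) (hG : HolomorphicAt G a) :
    HolomorphicAt (fun z => F z * G z) a := by
  rw [holomorphicAt_iff_chart] at *; exact hF.fun_mul hG

theorem pow (hF : HolomorphicAt F a) (n : ℕ) : HolomorphicAt (fun z => F z ^ n) a := by
  rw [holomorphicAt_iff_chart] at *; exact hF.fun_pow n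

theorem sum {ι : Type*} {s : Finset ι} {F : ι → Sphere → ℂ}
    (h : ∀ i ∈ s, HolomorphicAt (F i) a) : HolomorphicAt (fun z => ∑ i ∈ s, F i z) a := by
  rw [holomorphicAt_iff_chart]
  exact Finset.analyticAt_fun_sum s fun i hi => holomorphicAt_iff_chart.1 (h i hi)

theorem comp_analyticAt {ι : Type*} [Fintype ι] {g : (ι → ℂ) → ℂ} {F : ι → Sphere → ℂ}
    (hg : AnalyticAt ℂ g (fun i => F i a)) (hF : ∀ i, HolomorphicAt (F i) a) :
    HolomorphicAt (fun z => g (fun i => F i z)) a := by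
  rw [holomorphicAt_iff_chart]
  have h : AnalyticAt ℂ (fun u i => F i (chart a u)) 0 :=
    AnalyticAt.pi fun i => holomorphicAt_iff_chart.1 (hF i)
  exact AnalyticAt.fun_comp (f := fun u i => F i (chart a u)) (by simpa using hg) h

theorem comp_coe (hG : HolomorphicAt G ((F a : ℂ) : Sphere)) (hF : HolomorphicAt F a) :
    HolomorphicAt (fun z => G ((F z : ℂ) : Sphere)) a := by
  rw [holomorphicAt_iff_chart] at *
  rw [← holomorphicAt_iff_chart, holomorphicAt_coe_iff] at hG
  exact AnalyticAt.fun_comp (f := fun u => F (chart a u)) (by simpa using hG) hF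

theorem eventually_eq_zero_or (h : HolomorphicAt F a) :
    (∀ᶠ z in 𝓝 a, F z = 0) ∨ ∀ᶠ z in 𝓝[≠] a, F z ≠ 0 := by
  rw [holomorphicAt_iff_chart] at h
  rw [eventually_nhds_iff_chart, eventually_nhdsNE_iff_chart]
  exact h.eventually_eq_zero_or_eventually_ne_zero

end HolomorphicAt

instance nhdsNE_sphere_neBot (a : Sphere) : (𝓝[≠] a).NeBot := by
  rw [neBot_iff]
  intro h
  have eventually_false : ∀ᶠ _ in 𝓝[≠] a, False := by rw [h]; exact eventually_bot
  rw [eventually_nhdsNE_iff_chart] at eventually_false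
  exact eventually_false.exists.elim fun _ h => h

theorem exists_comp_chart (a : Sphere) (f : ℂ → ℂ) : ∃ F : Sphere → ℂ, ∀ w, F (chart a w) = f w :=
  ⟨Function.extend (chart a) f 0, fun w => (isOpenEmbedding_chart a).injective.extend_apply f 0 w⟩

/-- The disc with centre `a` and radius `r` in the coordinate of `chart a`. -/
def disc (a : Sphere) (r : ℝ) : Set Sphere := chart a '' Metric.ball 0 r

theorem isOpen_disc (a : Sphere) (r : ℝ) : IsOpen (disc a r) :=
  (isOpenEmbedding_chart a).isOpenMap _ Metric.isOpen_ball

theorem isPreconnected_disc (a : Sphere) (r : ℝ) : IsPreconnected (disc a r) :=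
  (convex_ball (0 : ℂ) r).isPreconnected.image _ (isOpenEmbedding_chart a).continuous.continuousOn

theorem mem_disc_self (a : Sphere) {r : ℝ} (hr : 0 < r) : a ∈ disc a r :=
  ⟨0, by simpa using hr, chart_zero a⟩

theorem disc_mem_nhds (a : Sphere) {r : ℝ} (hr : 0 < r) : disc a r ∈ 𝓝 a :=
  (isOpen_disc a r).mem_nhds (mem_disc_self a hr)

theorem exists_disc_subset {a : Sphere} {U : Set Sphere} (hU : U ∈ 𝓝 a) :
    ∃ r > 0, disc a r ⊆ U := by
  have h : ∀ᶠ u in 𝓝 0, chart a u ∈ U := eventually_nhds_iff_chart.1 hU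
  obtain ⟨r, hr, h⟩ := Metric.eventually_nhds_iff_ball.1 h
  exact ⟨r, hr, by rintro _ ⟨w, hw, rfl⟩; exact h w hw⟩

theorem isPathConnected_disc_diff_countable {A : Set Sphere} (hA : A.Countable) (a : Sphere)
    {r : ℝ} (hr : 0 < r) : IsPathConnected (disc a r \ A) := by
  have hinj := (isOpenEmbedding_chart a).injective
  have h := (isPathConnected_ball_diff_countable (hA.preimage hinj) 0 hr).image
    (isOpenEmbedding_chart a).continuous
  convert h using 1
  ext z
  constructor
  · rintro ⟨⟨w, hw, rfl⟩, h⟩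
    exact ⟨w, ⟨hw, h⟩, rfl⟩
  · rintro ⟨w, ⟨hw, h⟩, rfl⟩
    exact ⟨⟨w, hw, rfl⟩, h⟩

theorem exists_mem_not_mem_countable {A U : Set Sphere} (hA : A.Countable) {a : Sphere}
    (hU : U ∈ 𝓝 a) : ∃ z ∈ U, z ∉ A := by
  obtain ⟨r, hr, h⟩ := exists_disc_subset hU
  obtain ⟨z, hz⟩ := (isPathConnected_disc_diff_countable hA a hr).nonempty
  exact ⟨z, h hz.1, hz.2⟩

instance : SecondCountableTopology Sphere := by
  let U : Bool → Set Sphere := fun b => bif b then Set.range ((↑) : ℂ → Sphere)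
    else Set.range inftyChart
  have secondCountable_coe : SecondCountableTopology (Set.range ((↑) : ℂ → Sphere)) :=
    OnePoint.isOpenEmbedding_coe.toIsEmbedding.toHomeomorph.symm.secondCountableTopology
  have secondCountable_inftyChart : SecondCountableTopology (Set.range inftyChart) :=
    isOpenEmbedding_inftyChart.toIsEmbedding.toHomeomorph.symm.secondCountableTopology
  have : ∀ b, SecondCountableTopology (U b) := by rintro (_ | _) <;> assumption
  refine TopologicalSpace.secondCountableTopology_of_countable_cover (U := U) ?_ ?_
  · rintro (_ | _)
    · exact isOpenEmbedding_inftyChart.isOpen_range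
    · exact OnePoint.isOpenEmbedding_coe.isOpen_range
  · rw [Set.eq_univ_iff_forall]
    intro p
    rw [Set.mem_iUnion]
    induction p using OnePoint.rec with
    | infty => exact ⟨false, 0, by simp⟩
    | coe z => exact ⟨true, z, rfl⟩

theorem exists_countable_preconnected_basis : ∃ 𝔅 : Set (Set Sphere), 𝔅.Countable ∧
    (∀ V ∈ 𝔅, IsOpen V ∧ IsPreconnected V) ∧
    ∀ (a : Sphere) (U : Set Sphere), U ∈ 𝓝 a → ∃ V ∈ 𝔅, a ∈ V ∧ V ⊆ U := by
  have hb : TopologicalSpace.IsTopologicalBasis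
      {V : Set Sphere | IsOpen V ∧ IsPreconnected V} := by
    refine TopologicalSpace.isTopologicalBasis_of_isOpen_of_nhds (fun V hV => hV.1) ?_
    intro a U haU hU
    obtain ⟨r, hr, h⟩ := exists_disc_subset (hU.mem_nhds haU)
    exact ⟨disc a r, ⟨isOpen_disc a r, isPreconnected_disc a r⟩, mem_disc_self a hr, h⟩
  obtain ⟨𝔅, hsub, hcount, hbasis⟩ := hb.exists_countable
  exact ⟨𝔅, hcount, fun V hV => hsub hV, fun a U hU => hbasis.mem_nhds_iff.1 hU⟩

/-! ### The étalé space of germs -/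

/-- The function `F` represents the germ `ψ`; it is then holomorphic at the base point of `ψ`. -/
def Rep (ψ : RegularGerm) (F : Sphere → ℂ) : Prop :=
  (ψ.2 : (𝓝 ψ.1).Germ ℂ) = (F : (𝓝 ψ.1).Germ ℂ)

/-- The germ at `a` of a function holomorphic at `a`. -/
def germAt (F : Sphere → ℂ) (a : Sphere) (h : HolomorphicAt F a) : RegularGerm :=
  ⟨a, ⟨(F : (𝓝 a).Germ ℂ), F, h, rfl⟩⟩

@[simp] theorem germAt_fst (F : Sphere → ℂ) (a : Sphere) (h : HolomorphicAt F a) :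
    (germAt F a h).1 = a := rfl

theorem rep_germAt (F : Sphere → ℂ) (a : Sphere) (h : HolomorphicAt F a) :
    Rep (germAt F a h) F := rfl

theorem exists_rep (ψ : RegularGerm) : ∃ F, Rep ψ F := by
  obtain ⟨F, -, h⟩ := ψ.2.2
  exact ⟨F, h⟩

/-- A choice of a function representing a regular germ. -/
def rep (ψ : RegularGerm) : Sphere → ℂ := (exists_rep ψ).choose

theorem rep_spec (ψ : RegularGerm) : Rep ψ (rep ψ) := (exists_rep ψ).choose_spec

namespace Rep

variable {ψ χ : RegularGerm} {F G : Sphere → ℂ}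

theorem eventuallyEq (hF : Rep ψ F) (hG : Rep ψ G) : F =ᶠ[𝓝 ψ.1] G :=
  Filter.Germ.coe_eq.1 (hF.symm.trans hG)

theorem congr (hF : Rep ψ F) (h : F =ᶠ[𝓝 ψ.1] G) : Rep ψ G :=
  hF.trans (Filter.Germ.coe_eq.2 h)

theorem holomorphicAt (hF : Rep ψ F) : HolomorphicAt F ψ.1 := by
  obtain ⟨G, hG, h⟩ := ψ.2.2
  exact hG.congr (eventuallyEq h hF)

theorem ext (hbase : ψ.1 = χ.1) (hψ : Rep ψ F) (hχ : Rep χ F) : ψ = χ := by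
  obtain ⟨a, ψ⟩ := ψ
  obtain ⟨b, χ⟩ := χ
  obtain rfl : a = b := hbase
  have : ψ = χ := Subtype.ext (Eq.trans (show (ψ : (𝓝 a).Germ ℂ) = F from hψ) hχ.symm)
  rw [this]

theorem germAt_eq (h : Rep ψ F) : germAt F ψ.1 h.holomorphicAt = ψ :=
  ext rfl (rep_germAt _ _ _) h

end Rep

theorem holomorphicAt_rep (ψ : RegularGerm) : HolomorphicAt (rep ψ) ψ.1 :=
  (rep_spec ψ).holomorphicAt

theorem rep_germAt_eventuallyEq {F : Sphere → ℂ} {a : Sphere} (h : HolomorphicAt F a) :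
    rep (germAt F a h) =ᶠ[𝓝 a] F :=
  (rep_spec (germAt F a h)).eventuallyEq (rep_germAt F a h)

/-- The neighbourhood filter of a germ in the étalé space of the sheaf of holomorphic functions: a
neighbourhood of `ψ` contains the germs at all nearby points of a function representing `ψ`. -/
def germNhds (ψ : RegularGerm) : Filter RegularGerm :=
  comap Sigma.fst (𝓝 ψ.1) ⊓ 𝓟 {χ | Rep χ (rep ψ)}

instance : TopologicalSpace RegularGerm := TopologicalSpace.mkOfNhds germNhds

theorem mem_germNhds {ψ : RegularGerm} {F : Sphere → ℂ} (hF : Rep ψ F) {s : Set RegularGerm} :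
    s ∈ germNhds ψ ↔ ∀ᶠ z in 𝓝 ψ.1, ∀ χ : RegularGerm, χ.1 = z → Rep χ F → χ ∈ s := by
  have hr := eventually_eventually_nhds.2 ((rep_spec ψ).eventuallyEq hF)
  rw [germNhds, mem_inf_principal, mem_comap]
  constructor
  · rintro ⟨U, hU, h⟩
    filter_upwards [hU, hr] with z hz hz' χ hχ hχF
    subst hχ
    exact h hz (Rep.congr hχF (EventuallyEq.symm hz'))
  · intro h
    refine ⟨_, h.and hr, ?_⟩
    rintro χ ⟨hev, hψG⟩ hχG
    exact hev χ rfl (Rep.congr hχG hψG)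

theorem nhds_germ (ψ : RegularGerm) : 𝓝 ψ = germNhds ψ := by
  refine TopologicalSpace.nhds_mkOfNhds germNhds ψ ?_ ?_
  · intro ψ
    refine le_inf ?_ ?_
    · rw [← map_le_iff_le_comap, map_pure]
      exact pure_le_nhds _
    · simpa using rep_spec ψ
  · intro ψ s hs
    rw [mem_germNhds (rep_spec ψ)] at hs
    rw [Filter.Eventually, mem_germNhds (rep_spec ψ)]
    filter_upwards [eventually_eventually_nhds.2 hs] with z hz χ hχ hχψ
    subst hχ
    exact (mem_germNhds hχψ).2 hz

theorem mem_nhds_germ {ψ : RegularGerm} {F : Sphere → ℂ} (hF : Rep ψ F) {s : Set RegularGerm} :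
    s ∈ 𝓝 ψ ↔ ∀ᶠ z in 𝓝 ψ.1, ∀ χ : RegularGerm, χ.1 = z → Rep χ F → χ ∈ s := by
  rw [nhds_germ, mem_germNhds hF]

theorem continuous_base : Continuous (fun ψ : RegularGerm => ψ.1) := by
  rw [continuous_iff_continuousAt]
  intro ψ
  rw [ContinuousAt, nhds_germ]
  exact tendsto_comap.mono_left inf_le_left

theorem Rep.eventually {ψ : RegularGerm} {F : Sphere → ℂ} (hF : Rep ψ F) :
    ∀ᶠ χ in 𝓝 ψ, Rep χ F := by
  rw [Filter.Eventually, mem_nhds_germ hF]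
  exact Eventually.of_forall fun _ _ _ h => h

theorem isOpen_rep (F : Sphere → ℂ) : IsOpen {ψ : RegularGerm | Rep ψ F} :=
  isOpen_iff_mem_nhds.2 fun _ h => Rep.eventually h

theorem tendsto_germ {T : Type*} {l : Filter T} {Φ : T → RegularGerm} {ψ : RegularGerm}
    {F : Sphere → ℂ} (hF : Rep ψ F) (hbase : Tendsto (fun t => (Φ t).1) l (𝓝 ψ.1))
    (hrep : ∀ᶠ t in l, Rep (Φ t) F) : Tendsto Φ l (𝓝 ψ) := by
  intro s hs
  rw [mem_nhds_germ hF] at hs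
  rw [mem_map]
  filter_upwards [hbase.eventually hs, hrep] with t hbase hrep
  exact hbase _ rfl hrep

theorem continuousOn_germ {T : Type*} [TopologicalSpace T] {s : Set T} {Φ : T → RegularGerm}
    {F : Sphere → ℂ} (hbase : ContinuousOn (fun t => (Φ t).1) s) (hrep : ∀ t ∈ s, Rep (Φ t) F) :
    ContinuousOn Φ s := fun t ht =>
  tendsto_germ (hrep t ht) (hbase t ht) (eventually_mem_nhdsWithin.mono hrep)

theorem isOpen_not_rep (F : Sphere → ℂ) :
    IsOpen {ψ : RegularGerm | HolomorphicAt F ψ.1 ∧ ¬ Rep ψ F} := by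
  rw [isOpen_iff_mem_nhds]
  rintro ψ ⟨hF, not_rep⟩
  have hG := rep_spec ψ
  rw [mem_nhds_germ hG]
  rcases (hF.sub hG.holomorphicAt).eventually_eq_zero_or with h | h
  · exact absurd (hG.congr (h.mono fun z hz => (sub_eq_zero.1 hz).symm)) not_rep
  · rw [eventually_nhdsWithin_iff] at h
    filter_upwards [h, hF.eventually] with z hz hz' χ hχ hχG
    subst hχ
    refine ⟨hz', fun hχF => ?_⟩
    by_cases hχψ : χ.1 = ψ.1
    · obtain rfl := Rep.ext hχψ hχG hG
      exact not_rep hχF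
    · exact hz hχψ (sub_eq_zero.2 (hχF.eventuallyEq hχG).self_of_nhds)

theorem Rep.of_isPreconnected {C : Set RegularGerm} (hC : IsPreconnected C) {F : Sphere → ℂ}
    (hF : ∀ ψ ∈ C, HolomorphicAt F ψ.1) {ψ χ : RegularGerm} (hψ : ψ ∈ C) (hχ : χ ∈ C)
    (h : Rep ψ F) : Rep χ F := by
  by_contra hn
  obtain ⟨ξ, -, hξF, hξn⟩ := hC _ _ (isOpen_rep F) (isOpen_not_rep F)
    (fun ξ hξ => or_iff_not_imp_left.2 fun h => ⟨hF ξ hξ, h⟩) ⟨ψ, hψ, h⟩ ⟨χ, hχ, hF χ hχ, hn⟩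
  exact hξn.2 hξF

theorem continuous_section {F : Sphere → ℂ} {V : Set Sphere} (hF : ∀ z ∈ V, HolomorphicAt F z) :
    Continuous (fun z : V => germAt F z (hF z z.2)) := by
  rw [continuous_iff_continuousAt]
  intro z
  exact tendsto_germ (rep_germAt _ _ _) continuous_subtype_val.continuousAt
    (Eventually.of_forall fun _ => rep_germAt _ _ _)

/-- The set of germs of the function `F` at the points of `V` where it is holomorphic. -/
def sheet (F : Sphere → ℂ) (V : Set Sphere) : Set RegularGerm := {ψ | ψ.1 ∈ V ∧ Rep ψ F}

theorem isOpen_sheet (F : Sphere → ℂ) {V : Set Sphere} (hV : IsOpen V) : IsOpen (sheet F V) :=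
  (hV.preimage continuous_base).inter (isOpen_rep F)

theorem sheet_eq_range {F : Sphere → ℂ} {V : Set Sphere} (hF : ∀ z ∈ V, HolomorphicAt F z) :
    sheet F V = Set.range (fun z : V => germAt F z (hF z z.2)) := by
  ext ψ
  constructor
  · rintro ⟨hψV, hψF⟩
    exact ⟨⟨ψ.1, hψV⟩, hψF.germAt_eq⟩
  · rintro ⟨z, rfl⟩
    exact ⟨z.2, rep_germAt _ _ _⟩

theorem isPreconnected_sheet {F : Sphere → ℂ} {V : Set Sphere} (hF : ∀ z ∈ V, HolomorphicAt F z)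
    (hV : IsPreconnected V) : IsPreconnected (sheet F V) := by
  rw [sheet_eq_range hF]
  have := isPreconnected_iff_preconnectedSpace.1 hV
  exact isPreconnected_range (continuous_section hF)

theorem eventuallyEq_of_isPreconnected {F G : Sphere → ℂ} {V : Set Sphere}
    (hV : IsPreconnected V) (hF : ∀ z ∈ V, HolomorphicAt F z) (hG : ∀ z ∈ V, HolomorphicAt G z)
    {z w : Sphere} (hz : z ∈ V) (hw : w ∈ V) (h : F =ᶠ[𝓝 z] G) : F =ᶠ[𝓝 w] G := by
  have hrep : Rep (germAt F w (hF w hw)) G :=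
    Rep.of_isPreconnected (isPreconnected_sheet hF hV) (fun ψ hψ => hG _ hψ.1)
      (ψ := germAt F z (hF z hz)) ⟨hz, rep_germAt _ _ _⟩ ⟨hw, rep_germAt _ _ _⟩
      ((rep_germAt _ _ _).congr h)
  exact (rep_germAt F w (hF w hw)).eventuallyEq hrep

theorem exists_sheet_subset {ψ : RegularGerm} {F : Sphere → ℂ} (hF : Rep ψ F)
    {s : Set RegularGerm} (hs : s ∈ 𝓝 ψ) : ∃ r > 0, (∀ z ∈ disc ψ.1 r, HolomorphicAt F z) ∧
      sheet F (disc ψ.1 r) ⊆ s := by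
  rw [mem_nhds_germ hF] at hs
  obtain ⟨r, hr, h⟩ := exists_disc_subset (hs.and hF.holomorphicAt.eventually)
  exact ⟨r, hr, fun z hz => (h hz).2, fun χ hχ => (h hχ.1).1 χ rfl hχ.2⟩

theorem sheet_mem_nhds {ψ : RegularGerm} {F : Sphere → ℂ} (hF : Rep ψ F) {r : ℝ} (hr : 0 < r) :
    sheet F (disc ψ.1 r) ∈ 𝓝 ψ :=
  (isOpen_sheet F (isOpen_disc _ _)).mem_nhds ⟨mem_disc_self _ hr, hF⟩

instance : LocallyConnectedSpace RegularGerm := by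
  refine locallyConnectedSpace_of_connected_bases
    (fun ψ (r : ℝ) => sheet (rep ψ) (disc ψ.1 r))
    (fun ψ r => 0 < r ∧ ∀ z ∈ disc ψ.1 r, HolomorphicAt (rep ψ) z) ?_ ?_
  · intro ψ
    refine ⟨fun s => ⟨fun hs => ?_, ?_⟩⟩
    · obtain ⟨r, hr, hol, hsub⟩ := exists_sheet_subset (rep_spec ψ) hs
      exact ⟨r, ⟨hr, hol⟩, hsub⟩
    · rintro ⟨r, hr, h⟩
      exact mem_of_superset (sheet_mem_nhds (rep_spec ψ) hr.1) h
  · intro ψ r hr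
    exact isPreconnected_sheet hr.2 (isPreconnected_disc _ _)

theorem isSeparatedMap_base : IsSeparatedMap (fun ψ : RegularGerm => ψ.1) := by
  intro ψ χ hbase hne
  have hhol : HolomorphicAt (rep ψ) χ.1 := by
    rw [← show ψ.1 = χ.1 from hbase]
    exact holomorphicAt_rep ψ
  refine ⟨_, _, isOpen_rep (rep ψ), isOpen_not_rep (rep ψ), rep_spec ψ,
    ⟨hhol, fun h => hne (Rep.ext hbase (rep_spec ψ) h)⟩, ?_⟩
  exact Set.disjoint_left.2 fun ξ hξ hn => hn.2 hξ

theorem isLocallyInjective_base : IsLocallyInjective (fun ψ : RegularGerm => ψ.1) := fun ψ =>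
  ⟨_, isOpen_rep (rep ψ), rep_spec ψ, fun _ hξ _ hζ h => Rep.ext h hξ hζ⟩

theorem lift_unique {T : Type*} [TopologicalSpace T] {s : Set T} (hs : IsPreconnected s)
    {Φ Ψ : T → RegularGerm} (hΦ : ContinuousOn Φ s) (hΨ : ContinuousOn Ψ s)
    (hbase : ∀ t ∈ s, (Φ t).1 = (Ψ t).1) {t₀ : T} (h₀ : t₀ ∈ s) (h : Φ t₀ = Ψ t₀) :
    Set.EqOn Φ Ψ s :=
  isSeparatedMap_base.eqOn_of_comp_eqOn isLocallyInjective_base hs hΦ hΨ hbase h₀ h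

/-- The value of a regular germ at its base point, as a function on the étalé space. -/
def val (ψ : RegularGerm) : ℂ := germValue ψ.2

theorem Rep.val_eq {ψ : RegularGerm} {F : Sphere → ℂ} (h : Rep ψ F) : val ψ = F ψ.1 := by
  rw [val, germValue, show (ψ.2 : (𝓝 ψ.1).Germ ℂ) = F from h]
  rfl

theorem continuous_val : Continuous val := by
  rw [continuous_iff_continuousAt]
  intro ψ
  have hF := rep_spec ψ
  have h : Tendsto (fun χ : RegularGerm => rep ψ χ.1) (𝓝 ψ) (𝓝 (rep ψ ψ.1)) :=
    hF.holomorphicAt.continuousAt.tendsto.comp continuous_base.continuousAt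
  rw [ContinuousAt, hF.val_eq]
  refine h.congr' ?_
  filter_upwards [hF.eventually] with χ hχ
  exact hχ.val_eq.symm

/-! ### Analytic continuation as path lifting -/

section Continuation

variable {φ : RegularGerm} {γ : unitInterval → Sphere} {τ T : unitInterval}
  {Φ : unitInterval → RegularGerm}

theorem isContinuation_iff (hγ : Continuous γ) : IsContinuation φ γ τ Φ ↔
    Φ 0 = φ ∧ (∀ t ≤ τ, (Φ t).1 = γ t) ∧ ContinuousOn Φ (Set.Iic τ) := by
  constructor
  · intro h
    refine ⟨h.start, h.base, fun t ht => ?_⟩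
    obtain ⟨F, hF⟩ := h.coherent t ht
    have hFt : Rep (Φ t) F := hF.self_of_nhdsWithin ht
    refine tendsto_germ hFt ?_ hF
    rw [h.base t ht]
    refine (hγ.continuousAt.continuousWithinAt (s := Set.Iic τ)).tendsto.congr' ?_
    filter_upwards [self_mem_nhdsWithin] with s hs
    exact (h.base s hs).symm
  · rintro ⟨start, base, cont⟩
    refine ⟨start, base, fun t ht => ⟨rep (Φ t), ?_⟩⟩
    exact (cont t ht).eventually (Rep.eventually (rep_spec (Φ t)))

theorem IsContinuation.continuousOn (h : IsContinuation φ γ τ Φ) (hγ : Continuous γ) :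
    ContinuousOn Φ (Set.Iic τ) := ((isContinuation_iff hγ).1 h).2.2

theorem IsContinuation.continuous (h : IsContinuation φ γ 1 Φ) (hγ : Continuous γ) :
    Continuous Φ := by
  have := h.continuousOn hγ
  rwa [show Set.Iic (1 : unitInterval) = Set.univ from Set.Iic_top, continuousOn_univ] at this

theorem isContinuation_one_iff (hγ : Continuous γ) : IsContinuation φ γ 1 Φ ↔
    Φ 0 = φ ∧ (∀ t, (Φ t).1 = γ t) ∧ Continuous Φ := by
  rw [isContinuation_iff hγ, show Set.Iic (1 : unitInterval) = Set.univ from Set.Iic_top,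
    continuousOn_univ]
  simp [unitInterval.le_one']

theorem IsContinuation.mono (h : IsContinuation φ γ T Φ) (hτ : τ ≤ T) (hγ : Continuous γ) :
    IsContinuation φ γ τ Φ := by
  rw [isContinuation_iff hγ] at *
  exact ⟨h.1, fun t ht => h.2.1 t (ht.trans hτ), h.2.2.mono (Set.Iic_subset_Iic.2 hτ)⟩

theorem IsContinuation.eq_of_le {Ψ : unitInterval → RegularGerm} (h : IsContinuation φ γ τ Φ)
    (h' : IsContinuation φ γ T Ψ) (hγ : Continuous γ) {t : unitInterval} (ht : t ≤ τ)
    (ht' : t ≤ T) : Φ t = Ψ t := by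
  refine lift_unique (s := Set.Iic t) (Set.ordConnected_Iic.isPreconnected)
    ((h.mono ht hγ).continuousOn hγ) ((h'.mono ht' hγ).continuousOn hγ) (fun u hu => ?_)
    (t₀ := 0) unitInterval.nonneg' (h.start.trans h'.start.symm) Set.self_mem_Iic
  rw [h.base u (le_trans hu ht), h'.base u (le_trans hu ht')]

theorem IsContinuation.prolong {F : Sphere → ℂ} (h : IsContinuation φ γ τ Φ) (hγ : Continuous γ)
    (hrep : Rep (Φ τ) F) (hF : ∀ t ∈ Set.Icc τ T, HolomorphicAt F (γ t)) :
    ∃ Ψ, IsContinuation φ γ T Ψ := by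
  classical
  rcases le_or_gt T τ with hT | hT
  · exact ⟨Φ, h.mono hT hγ⟩
  let Ψ : unitInterval → RegularGerm := fun t => if t ≤ τ then Φ t else
    if ht : HolomorphicAt F (γ t) then germAt F (γ t) ht else φ
  have eqOn_Iic : Set.EqOn Ψ Φ (Set.Iic τ) := fun t ht => if_pos ht
  have on_Icc : ∀ t ∈ Set.Icc τ T, (Ψ t).1 = γ t ∧ Rep (Ψ t) F := by
    intro t ht
    rcases ht.1.eq_or_lt with rfl | hlt
    · rw [eqOn_Iic Set.self_mem_Iic]
      exact ⟨h.base _ le_rfl, hrep⟩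
    · simp only [Ψ, not_le.2 hlt, if_false, dif_pos (hF t ht)]
      exact ⟨rfl, rep_germAt _ _ _⟩
  refine ⟨Ψ, (isContinuation_iff hγ).2 ⟨?_, fun t ht => ?_, ?_⟩⟩
  · exact (eqOn_Iic unitInterval.nonneg').trans h.start
  · rcases le_total t τ with htτ | htτ
    · rw [eqOn_Iic htτ, h.base t htτ]
    · exact (on_Icc t ⟨htτ, ht⟩).1
  · rw [← Set.Iic_union_Icc_eq_Iic hT.le]
    refine ContinuousOn.union_of_isClosed ?_ ?_ isClosed_Iic isClosed_Icc
    · exact (h.continuousOn hγ).congr eqOn_Iic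
    · exact continuousOn_germ (hγ.continuousOn.congr fun t ht => (on_Icc t ht).1)
        fun t ht => (on_Icc t ht).2

theorem isContinuation_zero (h0 : γ 0 = φ.1) : IsContinuation φ γ 0 (fun _ => φ) := by
  refine ⟨rfl, fun t ht => ?_, fun _ _ => ⟨rep φ, ?_⟩⟩
  · rw [le_antisymm ht unitInterval.nonneg', h0]
  · exact Eventually.of_forall fun _ => rep_spec φ

theorem exists_continuation_of_forall (hγ : Continuous γ) (h0 : γ 0 = φ.1)
    (h : ∀ T > 0, (∀ τ < T, ∃ Φ, IsContinuation φ γ τ Φ) → ∃ Φ, IsContinuation φ γ T Φ) :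
    ∃ Φ, IsContinuation φ γ 1 Φ := by
  have hclopen : IsClopen {τ | ∃ Φ, IsContinuation φ γ τ Φ} := by
    constructor
    · refine isClosed_of_closure_subset fun T hT => ?_
      rcases (unitInterval.nonneg' (t := T)).eq_or_lt with hT0 | hT0
      · rw [← hT0]
        exact ⟨_, isContinuation_zero h0⟩
      · refine h T hT0 fun τ hτ => ?_
        obtain ⟨σ, hσ, Φ, hΦ⟩ := mem_closure_iff.1 hT _ isOpen_Ioi hτ
        exact ⟨Φ, hΦ.mono (le_of_lt hσ) hγ⟩
    · rw [isOpen_iff_mem_nhds]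
      rintro T ⟨Φ, hΦ⟩
      have eventually_holomorphicAt : ∀ᶠ t in 𝓝 T, HolomorphicAt (rep (Φ T)) (γ t) := by
        refine hγ.continuousAt.eventually ?_
        rw [← hΦ.base T le_rfl]
        exact (holomorphicAt_rep (Φ T)).eventually
      have tendsto_uIcc : Tendsto (fun t => Set.uIcc T t) (𝓝 T) (𝓝 T).smallSets :=
        tendsto_const_nhds.uIcc tendsto_id
      filter_upwards [tendsto_uIcc.eventually eventually_holomorphicAt.smallSets] with t ht
      rcases le_total T t with hTt | htT
      · exact hΦ.prolong hγ (rep_spec (Φ T)) fun s hs => ht s (by rwa [Set.uIcc_of_le hTt])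
      · exact ⟨Φ, hΦ.mono htT hγ⟩
  have := hclopen.eq_univ ⟨0, _, isContinuation_zero h0⟩
  exact (Set.ext_iff.1 this 1).2 trivial

theorem exists_continuation_of_local (hγ : Continuous γ) (h0 : γ 0 = φ.1)
    (h : ∀ T, ∃ V ∈ 𝓝 (γ T), ∀ᶠ τ in 𝓝 T, ∀ Φ, IsContinuation φ γ τ Φ →
      ∃ F, Rep (Φ τ) F ∧ ∀ z ∈ V, HolomorphicAt F z) :
    ∃ Φ, IsContinuation φ γ 1 Φ := by
  refine exists_continuation_of_forall hγ h0 fun T hT hτ => ?_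
  obtain ⟨V, hV, h⟩ := h T
  obtain ⟨l, hl, hlT⟩ := exists_Ioc_subset_of_mem_nhds
    (inter_mem (hγ.continuousAt.preimage_mem_nhds hV) h) ⟨0, hT⟩
  obtain ⟨τ, hlτ, hτT⟩ := exists_between hl
  obtain ⟨Φ, hΦ⟩ := hτ τ hτT
  obtain ⟨F, hF, hFV⟩ := (hlT ⟨hlτ, hτT.le⟩).2 Φ hΦ
  exact hΦ.prolong hγ hF fun t ht => hFV _ (hlT ⟨hlτ.trans_le ht.1, ht.2⟩).1

end Continuation

/-! ### Continuation along all paths avoiding a set -/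

/-- The germ `φ` can be continued along all paths which avoid `A`. For a countable set `A` not
containing the base point this says exactly that the singular points of `φ` lie in `A`, but it is
the form in which the results of operations on germs can be studied. -/
def Avoiding (A : Set Sphere) (φ : RegularGerm) : Prop :=
  ∀ γ : unitInterval → Sphere, Continuous γ → γ 0 = φ.1 → (∀ t, γ t ∉ A) →
    ∃ Φ, IsContinuation φ γ 1 Φ

theorem Avoiding.mono {A B : Set Sphere} {φ : RegularGerm} (h : Avoiding A φ) (hAB : A ⊆ B) :
    Avoiding B φ := fun γ hγ h0 hB => h γ hγ h0 fun t ht => hB t (hAB ht)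

theorem IsContinuation.comp {φ : RegularGerm} {γ : unitInterval → Sphere} {σ T : unitInterval}
    {Φ : unitInterval → RegularGerm} (h : IsContinuation φ γ T Φ) (hγ : Continuous γ)
    {θ : unitInterval → unitInterval} (hθ : Continuous θ)
    (hmaps : Set.MapsTo θ (Set.Iic σ) (Set.Iic T)) :
    IsContinuation (Φ (θ 0)) (γ ∘ θ) σ (Φ ∘ θ) :=
  (isContinuation_iff (hγ.comp hθ)).2
    ⟨rfl, fun _ ht => h.base _ (hmaps ht), (h.continuousOn hγ).comp hθ.continuousOn hmaps⟩

theorem IsContinuation.comp_mul {φ : RegularGerm} {γ : unitInterval → Sphere}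
    {σ T : unitInterval} {Φ : unitInterval → RegularGerm} (h : IsContinuation φ γ (T * σ) Φ)
    (hγ : Continuous γ) : IsContinuation φ (fun s => γ (T * s)) σ (fun s => Φ (T * s)) := by
  have hcomp := h.comp hγ (θ := fun s => T * s) (σ := σ) (by fun_prop)
    fun s hs => mul_le_mul_right hs T
  rwa [mul_zero, h.start] at hcomp

theorem exists_continuation_comp_mul_iff {φ : RegularGerm} {γ : unitInterval → Sphere}
    (hγ : Continuous γ) {T : unitInterval} (hT : 0 < T) :
    (∃ Φ, IsContinuation φ (fun s => γ (T * s)) 1 Φ) ↔ ∃ Φ, IsContinuation φ γ T Φ := by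
  constructor
  · rintro ⟨Φ, hΦ⟩
    have hT' : (0 : ℝ) < T := hT
    let θ : unitInterval → unitInterval := fun t => Set.projIcc 0 1 zero_le_one ((t : ℝ) / T)
    have mul_θ : ∀ t ≤ T, T * θ t = t := fun t ht => Subtype.ext <| by
      have hmem : (t : ℝ) / T ∈ Set.Icc (0 : ℝ) 1 :=
        ⟨div_nonneg t.2.1 hT'.le, (div_le_one hT').2 ht⟩
      simp only [θ, Set.projIcc_of_mem _ hmem, Set.Icc.coe_mul]
      field_simp
    have hcomp := hΦ.comp (by fun_prop) (θ := θ) (σ := T)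
      (continuous_projIcc.comp (by fun_prop)) fun t _ => unitInterval.le_one'
    refine ⟨Φ ∘ θ, (isContinuation_iff hγ).2 ⟨?_, fun t ht => ?_, hcomp.continuousOn ?_⟩⟩
    · simpa [θ] using hΦ.start
    · exact (hcomp.base t ht).trans (congrArg γ (mul_θ t ht))
    · exact (by fun_prop : Continuous fun s => γ (T * s)).comp
        (continuous_projIcc.comp (by fun_prop))
  · rintro ⟨Φ, hΦ⟩
    exact ⟨_, IsContinuation.comp_mul (by rwa [mul_one]) hγ⟩

theorem avoiding_singularSet (φ : RegularGerm) : Avoiding (singularSet φ) φ := by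
  intro γ hγ h0 hA
  refine exists_continuation_of_forall hγ h0 fun T hT hτ => ?_
  by_contra hcon
  refine hA T ⟨⟨⟨fun s => γ (T * s), by fun_prop⟩, by simpa using h0, by simp⟩, ?_, ?_⟩
  · exact fun h => hcon ((exists_continuation_comp_mul_iff hγ hT).1 h)
  · intro σ hσ
    obtain ⟨Φ, hΦ⟩ := hτ (T * σ) (mul_lt_of_lt_one_right hT hσ)
    exact ⟨_, hΦ.comp_mul hγ⟩

/-- The affine map of the unit interval onto its left half, which recovers the first of two
concatenated paths. -/
def leftHalf (t : unitInterval) : unitInterval :=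
  ⟨(t : ℝ) / 2, by linarith [t.2.1], by linarith [t.2.2]⟩

/-- The affine map of the unit interval onto its right half, which recovers the second of two
concatenated paths. -/
def rightHalf (t : unitInterval) : unitInterval :=
  ⟨(1 + (t : ℝ)) / 2, by linarith [t.2.1], by linarith [t.2.2]⟩

theorem continuous_leftHalf : Continuous leftHalf := by unfold leftHalf; fun_prop

theorem continuous_rightHalf : Continuous rightHalf := by unfold rightHalf; fun_prop

theorem leftHalf_zero : leftHalf 0 = 0 := Subtype.ext (by simp [leftHalf])

theorem rightHalf_zero : rightHalf 0 = leftHalf 1 :=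
  Subtype.ext (by simp [leftHalf, rightHalf])

theorem trans_leftHalf {X : Type*} [TopologicalSpace X] {x y z : X} (p : Path x y) (q : Path y z)
    (t : unitInterval) : p.trans q (leftHalf t) = p t := by
  rw [Path.trans_apply, dif_pos (by simp only [leftHalf]; linarith [t.2.2])]
  exact congrArg p (Subtype.ext (by simp only [leftHalf]; ring))

theorem trans_rightHalf {X : Type*} [TopologicalSpace X] {x y z : X} (p : Path x y) (q : Path y z)
    (t : unitInterval) : p.trans q (rightHalf t) = q t := by
  rcases (unitInterval.nonneg' (t := t)).eq_or_lt with rfl | ht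
  · rw [rightHalf_zero, trans_leftHalf, p.target, q.source]
  · have ht' : (0 : ℝ) < t := ht
    rw [Path.trans_apply, dif_neg (by simp only [rightHalf]; linarith)]
    exact congrArg q (Subtype.ext (by simp only [rightHalf]; ring))

theorem exists_continuation_of_trans {φ ψ : RegularGerm} (Γ : Path φ ψ) {b : Sphere}
    (δ : Path ψ.1 b) (h : ∃ Φ, IsContinuation φ ((Γ.map continuous_base).trans δ) 1 Φ) :
    ∃ Ψ, IsContinuation ψ δ 1 Ψ := by
  obtain ⟨Φ, hΦ⟩ := h
  have hcont := hΦ.continuous (Path.continuous _)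
  have eq_left : ∀ t, Φ (leftHalf t) = Γ t := fun t => by
    refine lift_unique (s := Set.univ) (Φ := Φ ∘ leftHalf) (Ψ := Γ) isPreconnected_univ
      (hcont.comp continuous_leftHalf).continuousOn Γ.continuous.continuousOn (fun u _ => ?_)
      (t₀ := 0) trivial ?_ trivial
    · exact (hΦ.base _ unitInterval.le_one').trans (trans_leftHalf _ _ u)
    · simp [leftHalf_zero, hΦ.start]
  refine ⟨Φ ∘ rightHalf, (isContinuation_one_iff δ.continuous).2
    ⟨?_, fun t => ?_, hcont.comp continuous_rightHalf⟩⟩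
  · simp [rightHalf_zero, eq_left]
  · exact (hΦ.base _ unitInterval.le_one').trans (trans_rightHalf _ _ t)

theorem exists_continuation_trans {φ ψ : RegularGerm} (Γ : Path φ ψ) {b : Sphere}
    {δ : Path ψ.1 b} {σ τ : unitInterval} {Ψ : unitInterval → RegularGerm}
    (h : IsContinuation ψ δ σ Ψ) (hτ : 2 * (τ : ℝ) - 1 ≤ σ) :
    ∃ Φ, IsContinuation φ ((Γ.map continuous_base).trans δ) τ Φ := by
  let Ψσ : Path ψ (Ψ σ) :=
    { toFun := fun t => Ψ (min t σ)
      continuous_toFun := continuousOn_univ.1 <| (h.continuousOn δ.continuous).comp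
        (by fun_prop) fun t _ => Set.mem_Iic.2 (min_le_right _ _)
      source' := by rw [min_eq_left unitInterval.nonneg', h.start]
      target' := by rw [min_eq_right unitInterval.le_one'] }
  refine ⟨Γ.trans Ψσ, (isContinuation_iff (Path.continuous _)).2
    ⟨by simp, fun t ht => ?_, (Path.continuous _).continuousOn⟩⟩
  rw [Path.trans_apply, Path.trans_apply]
  split_ifs with ht2
  · rfl
  · have hle : (⟨2 * (t : ℝ) - 1, unitInterval.two_mul_sub_one_mem_iff.2
        ⟨(not_le.1 ht2).le, t.2.2⟩⟩ : unitInterval) ≤ σ := by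
      have ht' : (t : ℝ) ≤ τ := ht
      exact Subtype.coe_le_coe.1 (by simpa using by linarith)
    change (Ψ (min _ σ)).1 = _
    rw [min_eq_left hle, h.base _ hle]

theorem singularSet_subset_of_joined {φ ψ : RegularGerm} (h : Joined φ ψ) :
    singularSet ψ ⊆ singularSet φ := by
  obtain ⟨Γ⟩ := h
  rintro b ⟨δ, hδ, hδτ⟩
  refine ⟨(Γ.map continuous_base).trans δ,
    fun h => hδ (exists_continuation_of_trans Γ δ h), fun τ hτ => ?_⟩
  have hτ' : (τ : ℝ) < 1 := hτ
  let σ : unitInterval :=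
    ⟨max 0 (2 * τ - 1), le_max_left _ _, max_le zero_le_one (by linarith)⟩
  obtain ⟨Ψ, hΨ⟩ := hδτ σ (show max 0 (2 * (τ : ℝ) - 1) < 1 from
    max_lt zero_lt_one (by linarith))
  exact exists_continuation_trans Γ hΨ (le_max_right _ _)

theorem singularSet_eq_of_joined {φ ψ : RegularGerm} (h : Joined φ ψ) :
    singularSet φ = singularSet ψ :=
  (singularSet_subset_of_joined h.symm).antisymm (singularSet_subset_of_joined h)

theorem Equivalent.joined {φ ψ : RegularGerm} (h : Equivalent φ ψ) : Joined φ ψ := by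
  obtain ⟨γ, Φ, hΦ, hend⟩ := h
  exact ⟨⟨⟨Φ, hΦ.continuous γ.continuous⟩, hΦ.start, hend⟩⟩

theorem isSFunction_generatedBy {a : Sphere} {φ : RegularGermAt a} (h : IsSGerm ⟨a, φ⟩) :
    IsSFunction (generatedBy φ) :=
  fun _ hψ => h.mono (singularSet_subset_of_joined (Equivalent.joined hψ))

theorem joinedIn_sheet_diff_countable {A : Set Sphere} (hA : A.Countable) {F : Sphere → ℂ}
    {a : Sphere} {r : ℝ} (hr : 0 < r) (hF : ∀ z ∈ disc a r, HolomorphicAt F z)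
    {ξ η : RegularGerm} (hξ : ξ ∈ sheet F (disc a r)) (hη : η ∈ sheet F (disc a r))
    (hξA : ξ.1 ∉ A) (hηA : η.1 ∉ A) : JoinedIn {ψ ∈ sheet F (disc a r) | ψ.1 ∉ A} ξ η := by
  obtain ⟨p, hp⟩ := (isPathConnected_disc_diff_countable hA a hr).joinedIn
    ξ.1 ⟨hξ.1, hξA⟩ η.1 ⟨hη.1, hηA⟩
  let Φ : unitInterval → RegularGerm := fun t => germAt F (p t) (hF _ (hp t).1)
  have hΦ : ∀ t, Rep (Φ t) F := fun t => rep_germAt _ _ _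
  refine ⟨⟨⟨Φ, ?_⟩, ?_, ?_⟩, fun t => ⟨⟨(hp t).1, hΦ t⟩, (hp t).2⟩⟩
  · exact continuousOn_univ.1
      (continuousOn_germ p.continuous.continuousOn fun t _ => hΦ t)
  · exact Rep.ext p.source (hΦ 0) hξ.2
  · exact Rep.ext p.target (hΦ 1) hη.2

theorem eventually_joined {F : Sphere → ℂ} {a : Sphere} (h : HolomorphicAt F a) :
    ∀ᶠ z in 𝓝 a, ∀ hz : HolomorphicAt F z, Joined (germAt F a h) (germAt F z hz) := by
  obtain ⟨r, hr, hd⟩ := exists_disc_subset h.eventually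
  filter_upwards [disc_mem_nhds a hr] with z hz hz'
  exact (joinedIn_sheet_diff_countable Set.countable_empty hr hd
    ⟨mem_disc_self a hr, rep_germAt _ _ h⟩ ⟨hz, rep_germAt _ _ hz'⟩ (Set.notMem_empty _)
    (Set.notMem_empty _)).joined

/-! ### Local operators and permanence of relations -/

section Permanence

variable {ι : Type*}

/-- `P F z` depends only on the germs at `z` of the functions `F i`. -/
def IsLocalProperty (P : (ι → Sphere → ℂ) → Sphere → Prop) : Prop :=
  ∀ F G z, (∀ i, F i =ᶠ[𝓝 z] G i) → P F z → P G z

/-- The germ of `Op F` at any point depends only on the germs of the functions `F i` there. Local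
operators act on tuples of germs, and commute with analytic continuation. -/
def IsLocalOperator (Op : (ι → Sphere → ℂ) → Sphere → ℂ) : Prop :=
  ∀ F G z, (∀ i, F i =ᶠ[𝓝 z] G i) → Op F =ᶠ[𝓝 z] Op G

variable [Finite ι] {T : Type*} [TopologicalSpace T] {s : Set T} {γ : T → Sphere}
  {Φ : ι → T → RegularGerm}

theorem eventually_rep_eventuallyEq (hb : ∀ i, ∀ t ∈ s, (Φ i t).1 = γ t)
    (hΦ : ∀ i, ContinuousOn (Φ i) s) {t : T} (ht : t ∈ s) :
    ∀ᶠ u in 𝓝[s] t, ∀ i, rep (Φ i u) =ᶠ[𝓝 (γ u)] rep (Φ i t) := by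
  rw [eventually_all]
  intro i
  filter_upwards [(hΦ i t ht).eventually (Rep.eventually (rep_spec (Φ i t))),
    self_mem_nhdsWithin] with u hu hus
  rw [← hb i u hus]
  exact (rep_spec _).eventuallyEq hu

theorem continuousOn_of_rep_op (hγ : ContinuousOn γ s) (hb : ∀ i, ∀ t ∈ s, (Φ i t).1 = γ t)
    (hΦ : ∀ i, ContinuousOn (Φ i) s) {Op : (ι → Sphere → ℂ) → Sphere → ℂ}
    (hop : IsLocalOperator Op) {Θ : T → RegularGerm} (hΘb : ∀ t ∈ s, (Θ t).1 = γ t)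
    (hΘ : ∀ t ∈ s, Rep (Θ t) (Op fun i => rep (Φ i t))) : ContinuousOn Θ s := by
  intro t ht
  refine tendsto_germ (hΘ t ht) (hγ.congr hΘb t ht) ?_
  filter_upwards [eventually_rep_eventuallyEq hb hΦ ht, self_mem_nhdsWithin] with u hu hus
  refine (hΘ u hus).congr ?_
  rw [hΘb u hus]
  exact hop _ _ _ hu

theorem permanence (hs : IsPreconnected s) (hγ : ContinuousOn γ s)
    (hb : ∀ i, ∀ t ∈ s, (Φ i t).1 = γ t) (hΦ : ∀ i, ContinuousOn (Φ i) s)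
    {P : (ι → Sphere → ℂ) → Sphere → Prop} (hP : IsLocalProperty P)
    (hloc : ∀ F z, (∀ i, HolomorphicAt (F i) z) →
      (∀ᶠ w in 𝓝 z, P F w) ∨ ∀ᶠ w in 𝓝 z, ¬ P F w)
    {t₀ t₁ : T} (h₀ : t₀ ∈ s) (h₁ : t₁ ∈ s) (h : P (fun i => rep (Φ i t₀)) (γ t₀)) :
    P (fun i => rep (Φ i t₁)) (γ t₁) := by
  let Q : T → Prop := fun t => P (fun i => rep (Φ i t)) (γ t)
  have locally_constant : ∀ t ∈ s, (∀ᶠ u in 𝓝[s] t, Q u) ∨ ∀ᶠ u in 𝓝[s] t, ¬ Q u := by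
    intro t ht
    have hrep := eventually_rep_eventuallyEq hb hΦ ht
    rcases hloc (fun i => rep (Φ i t)) (γ t)
      (fun i => by rw [← hb i t ht]; exact holomorphicAt_rep _) with hPt | hPt
    · left
      filter_upwards [hrep, (hγ t ht).eventually hPt] with u hu hPu
      exact hP _ _ _ (fun i => (hu i).symm) hPu
    · right
      filter_upwards [hrep, (hγ t ht).eventually hPt] with u hu hPu hQu
      exact hPu (hP _ _ _ hu hQu)
  refine (hs.induction₂ (fun t u => Q t ↔ Q u) (fun t ht => ?_)
    (fun _ _ _ _ _ _ => Iff.trans) (fun _ _ _ _ => Iff.symm) h₀ h₁).1 h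
  rcases locally_constant t ht with hQ | hQ
  · exact hQ.mono fun u hu => iff_of_true (hQ.self_of_nhdsWithin ht) hu
  · exact hQ.mono fun u hu => iff_of_false (hQ.self_of_nhdsWithin ht) hu

theorem eventually_eventuallyEq_zero_or {F : Sphere → ℂ} {z : Sphere} (h : HolomorphicAt F z) :
    (∀ᶠ w in 𝓝 z, ∀ᶠ u in 𝓝 w, F u = 0) ∨ ∀ᶠ w in 𝓝 z, ¬ ∀ᶠ u in 𝓝 w, F u = 0 := by
  rcases h.eventually_eq_zero_or with h | h
  · exact Or.inl (eventually_eventually_nhds.2 h)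
  · right
    filter_upwards [eventually_nhdsWithin_iff.1 h] with w hw h0
    by_cases hwz : w = z
    · subst hwz
      obtain ⟨u, hne, heq⟩ := (h.and (h0.filter_mono nhdsWithin_le_nhds)).exists
      exact hne heq
    · exact hw hwz h0.self_of_nhds

theorem permanence_eq (hs : IsPreconnected s) (hγ : ContinuousOn γ s)
    (hb : ∀ i, ∀ t ∈ s, (Φ i t).1 = γ t) (hΦ : ∀ i, ContinuousOn (Φ i) s)
    {Op : (ι → Sphere → ℂ) → Sphere → ℂ} (hop : IsLocalOperator Op)
    (hhol : ∀ F z, (∀ i, HolomorphicAt (F i) z) → HolomorphicAt (Op F) z)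
    {t₀ t₁ : T} (h₀ : t₀ ∈ s) (h₁ : t₁ ∈ s)
    (h : ∀ᶠ z in 𝓝 (γ t₀), Op (fun i => rep (Φ i t₀)) z = 0) :
    ∀ᶠ z in 𝓝 (γ t₁), Op (fun i => rep (Φ i t₁)) z = 0 :=
  permanence hs hγ hb hΦ (P := fun F z => ∀ᶠ w in 𝓝 z, Op F w = 0)
    (fun F G z hFG h => by
      filter_upwards [hop F G z hFG, h] with w hw h0
      rw [← hw, h0])
    (fun F z hF => eventually_eventuallyEq_zero_or (hhol F z hF)) h₀ h₁ h

end Permanence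

/-! ### Avoiding a countable set -/

theorem exists_mem_nhds_base_not_mem {A : Set Sphere} (hA : A.Countable) {ψ : RegularGerm}
    {s : Set RegularGerm} (hs : s ∈ 𝓝 ψ) : ∃ χ ∈ s, χ.1 ∉ A := by
  obtain ⟨r, hr, hol, hsub⟩ := exists_sheet_subset (rep_spec ψ) hs
  obtain ⟨z, hz, hzA⟩ := exists_mem_not_mem_countable hA (disc_mem_nhds ψ.1 hr)
  exact ⟨germAt (rep ψ) z (hol z hz), hsub ⟨hz, rep_germAt _ _ _⟩, hzA⟩

theorem isPathConnected_diff_countable {A : Set Sphere} (hA : A.Countable) {O : Set RegularGerm}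
    (hO : IsOpen O) (hO' : IsConnected O) : IsPathConnected {ψ ∈ O | ψ.1 ∉ A} := by
  let M : Set RegularGerm := {ψ ∈ O | ψ.1 ∉ A}
  have locally_joinedIn (x : RegularGerm) (hx : x ∈ O) : ∃ N ∈ 𝓝 x, ∀ y ∈ N, ∀ z ∈ N,
      y.1 ∉ A → z.1 ∉ A → JoinedIn M y z := by
    obtain ⟨r, hr, hol, hsub⟩ := exists_sheet_subset (rep_spec x) (hO.mem_nhds hx)
    exact ⟨_, sheet_mem_nhds (rep_spec x) hr, fun y hy z hz hyA hzA =>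
      (joinedIn_sheet_diff_countable hA hr hol hy hz hyA hzA).mono fun u hu => ⟨hsub hu.1, hu.2⟩⟩
  have eventually_joinedIn {x y : RegularGerm} (hx : x ∈ O) (hy : y ∈ O) :
      ∀ᶠ p in 𝓝 x ×ˢ 𝓝 y, p.1.1 ∉ A → p.2.1 ∉ A → JoinedIn M p.1 p.2 := by
    refine hO'.isPreconnected.induction₂
      (fun x y => ∀ᶠ p in 𝓝 x ×ˢ 𝓝 y, p.1.1 ∉ A → p.2.1 ∉ A → JoinedIn M p.1 p.2)
      (fun x hx => ?_) (fun x y z _ _ _ hxy hyz => ?_) (fun x y _ _ hxy => ?_) hx hy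
    · obtain ⟨N, hN, hjoin⟩ := locally_joinedIn x hx
      filter_upwards [mem_nhdsWithin_of_mem_nhds (eventually_mem_nhds_iff.2 hN)] with y hy
      filter_upwards [prod_mem_prod hN hy] with p hp
      exact hjoin _ hp.1 _ hp.2
    · obtain ⟨p, hp, q, hq, hpq⟩ := eventually_prod_iff.1 hxy
      obtain ⟨q', hq', s, hs, hqs⟩ := eventually_prod_iff.1 hyz
      obtain ⟨η, ⟨hqη, hqη'⟩, hηA⟩ := exists_mem_nhds_base_not_mem hA (hq.and hq')
      filter_upwards [hp.prod_mk hs] with w hw hwA hwA'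
      exact (hpq hw.1 hqη hwA hηA).trans (hqs hqη' hw.2 hηA hwA')
    · exact (eventually_swap_iff.1 hxy).mono fun p hp hwA hwA' => (hp hwA' hwA).symm
  obtain ⟨x, hx⟩ := hO'.nonempty
  obtain ⟨χ, hχ⟩ := exists_mem_nhds_base_not_mem hA (hO.mem_nhds hx)
  refine ⟨χ, hχ, fun {y} hy => ?_⟩
  have hχy := eventually_joinedIn hχ.1 hy.1
  rw [← nhds_prod_eq] at hχy
  exact hχy.self_of_nhds hχ.2 hy.2

theorem exists_forall_isContinuation_of_lt_one {φ : RegularGerm} {γ : unitInterval → Sphere}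
    (hγ : Continuous γ) (h : ∀ τ < 1, ∃ Φ, IsContinuation φ γ τ Φ) :
    ∃ Γ, ∀ τ < 1, IsContinuation φ γ τ Γ := by
  classical
  choose Ψ hΨ using h
  refine ⟨fun t => if ht : t < 1 then Ψ t ht t else φ, fun τ hτ => ?_⟩
  have eq_Ψ : Set.EqOn (fun t => if ht : t < 1 then Ψ t ht t else φ) (Ψ τ hτ) (Set.Iic τ) := by
    intro t ht
    dsimp only
    rw [dif_pos (lt_of_le_of_lt ht hτ)]
    exact (hΨ _ _).eq_of_le (hΨ _ _) hγ le_rfl ht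
  exact (isContinuation_iff hγ).2 ⟨(eq_Ψ unitInterval.nonneg').trans (hΨ τ hτ).start,
    fun t ht => (congrArg Sigma.fst (eq_Ψ ht)).trans ((hΨ τ hτ).base t ht),
    ((hΨ τ hτ).continuousOn hγ).congr eq_Ψ⟩

theorem continuous_update_of_tendsto {X : Type*} [TopologicalSpace X] {f : unitInterval → X}
    {b : X} (hf : ContinuousOn f (Set.Iio 1)) (hlim : Tendsto f (𝓝[<] 1) (𝓝 b)) :
    Continuous (Function.update f 1 b) := by
  rw [continuous_iff_continuousAt]
  intro t
  by_cases ht : t = 1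
  · subst ht
    rw [continuousAt_update_same, ← show Set.Iio (1 : unitInterval) = {1}ᶜ from Set.Iio_top]
    exact hlim
  · rw [continuousAt_update_of_ne ht]
    exact hf.continuousAt (Iio_mem_nhds (unitInterval.lt_one_iff_ne_one.2 ht))

theorem exists_lift_avoiding_eventually_mem {A : Set Sphere} (hA : A.Countable)
    {C : ℕ → Set RegularGerm} (hC : Antitone C) (hC' : ∀ m, IsOpen (C m) ∧ IsConnected (C m))
    {b : Sphere} (hb : ∀ U ∈ 𝓝 b, ∃ m, C m ⊆ (fun ψ => ψ.1) ⁻¹' U) {φ : RegularGerm}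
    (hφ : φ ∈ C 0) (hφA : φ.1 ∉ A) :
    ∃ f : unitInterval → RegularGerm, f 0 = φ ∧ ContinuousOn f (Set.Iio 1) ∧
      (∀ s, (f s).1 ∉ A) ∧ Tendsto (fun s => (f s).1) (𝓝[<] 1) (𝓝 b) ∧
      ∀ m, ∀ᶠ s in 𝓝[<] 1, f s ∈ C m := by
  obtain ⟨f, hf0, hfc, hfA, hf⟩ := exists_continuousOn_Iio_one_eventually_mem
    (C := fun m => {ψ ∈ C m | ψ.1 ∉ A}) (fun m n hmn ψ hψ => ⟨hC hmn hψ.1, hψ.2⟩)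
    (fun m => isPathConnected_diff_countable hA (hC' m).1 (hC' m).2) ⟨hφ, hφA⟩
  refine ⟨f, hf0, hfc, fun s => (hfA s).2, fun U hU => ?_, fun m => (hf m).mono fun s hs => hs.1⟩
  obtain ⟨m, hm⟩ := hb U hU
  exact (hf m).mono fun s hs => hm hs.1

theorem Avoiding.exists_eventually_rep {A : Set Sphere} {φ : RegularGerm} (hφ : Avoiding A φ)
    {f : unitInterval → RegularGerm} (hf0 : f 0 = φ) (hfc : ContinuousOn f (Set.Iio 1))
    (hfA : ∀ s, (f s).1 ∉ A) {b : Sphere} (hb : b ∉ A)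
    (hlim : Tendsto (fun s => (f s).1) (𝓝[<] 1) (𝓝 b)) :
    ∃ F, HolomorphicAt F b ∧ ∀ᶠ s in 𝓝[<] 1, Rep (f s) F := by
  let δ : unitInterval → Sphere := Function.update (fun s => (f s).1) 1 b
  have hδ : ∀ s < 1, δ s = (f s).1 := fun s hs => Function.update_of_ne hs.ne _ _
  have hδ1 : δ 1 = b := Function.update_self _ _ _
  have hδc : Continuous δ :=
    continuous_update_of_tendsto (continuous_base.comp_continuousOn hfc) hlim
  have hδA : ∀ s, δ s ∉ A := fun s => by
    rcases (unitInterval.le_one' (t := s)).eq_or_lt with rfl | hs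
    · rwa [hδ1]
    · rw [hδ s hs]
      exact hfA s
  obtain ⟨Θ, hΘ⟩ := hφ δ hδc (by rw [hδ 0 zero_lt_one, hf0]) hδA
  rw [isContinuation_one_iff hδc] at hΘ
  obtain ⟨hΘ0, hΘb, hΘc⟩ := hΘ
  have eq_f : Set.EqOn Θ f (Set.Iio 1) :=
    lift_unique Set.ordConnected_Iio.isPreconnected hΘc.continuousOn hfc
      (fun s hs => (hΘb s).trans (hδ s hs)) (Set.mem_Iio.2 zero_lt_one) (hΘ0.trans hf0.symm)
  refine ⟨rep (Θ 1), ?_, ?_⟩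
  · rw [← hδ1, ← hΘb 1]
    exact holomorphicAt_rep _
  · filter_upwards [(hΘc.tendsto 1).eventually_mem ((rep_spec (Θ 1)).eventually)
      |>.filter_mono nhdsWithin_le_nhds, self_mem_nhdsWithin] with s hs hs1
    exact eq_f hs1 ▸ hs

/-- A continuation `Γ` along a path which may run through `A` is replaced by a lift off `A` which
tends to the same end point inside the same shrinking connected sets of germs; the germ to which
the lift extends is also a continuation of `Γ`. -/
theorem singularSet_subset_of_avoiding {A : Set Sphere} (hA : A.Countable) {φ : RegularGerm}
    (hφ : Avoiding A φ) (ha : φ.1 ∉ A) : singularSet φ ⊆ A := by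
  rintro b ⟨γ, hγ, hγτ⟩
  by_contra hb
  refine hγ ?_
  obtain ⟨Γ, hΓ⟩ := exists_forall_isContinuation_of_lt_one γ.continuous hγτ
  have hΓb : Set.EqOn (fun t => (Γ t).1) γ (Set.Iio 1) := fun t ht => (hΓ t ht).base t le_rfl
  have hΓc : ContinuousOn Γ (Set.Iio 1) := fun t ht => by
    obtain ⟨τ, htτ, hτ⟩ := exists_between (Set.mem_Iio.1 ht)
    exact (((hΓ τ hτ).continuousOn γ.continuous).continuousAt
      (Iic_mem_nhds htτ)).continuousWithinAt
  have hγb : Tendsto γ (𝓝[<] 1) (𝓝 b) := by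
    simpa using (γ.continuous.tendsto 1).mono_left (nhdsWithin_le_nhds (s := Set.Iio 1))
  obtain ⟨C, hC, hCo, hC0, hCb, hΓC⟩ := exists_antitone_isConnected_eventually_mem
    continuous_base hΓc (hγb.congr' (hΓb.symm.eventuallyEq_of_mem self_mem_nhdsWithin))
  rw [(hΓ 0 zero_lt_one).start] at hC0
  obtain ⟨f, hf0, hfc, hfA, hfb, hfC⟩ :=
    exists_lift_avoiding_eventually_mem hA hC hCo hCb hC0 ha
  obtain ⟨F, hF, hfF⟩ := hφ.exists_eventually_rep hf0 hfc hfA hb hfb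
  obtain ⟨m, hm⟩ := hCb _ hF.eventually
  have : (𝓝[<] (1 : unitInterval)).NeBot := nhdsLT_neBot_of_exists_lt ⟨0, zero_lt_one⟩
  obtain ⟨s, hs, hsC⟩ := (hfF.and (hfC m)).exists
  have holomorphicAt_tail : ∀ᶠ t in 𝓝[≤] (1 : unitInterval), HolomorphicAt F (γ t) :=
    (γ.continuous.tendsto' 1 b γ.target).eventually hF.eventually
      |>.filter_mono nhdsWithin_le_nhds
  obtain ⟨l, hl, hlF⟩ := mem_nhdsLE_iff_exists_Ioc_subset' zero_lt_one |>.1 holomorphicAt_tail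
  obtain ⟨t, ⟨htC, hlt⟩, ht⟩ :=
    (((hΓC m).and (Ioo_mem_nhdsLT hl)).and self_mem_nhdsWithin).exists
  exact (hΓ t ht).prolong γ.continuous
    (Rep.of_isPreconnected (hCo m).2.isPreconnected (fun ψ hψ => hm hψ) hsC htC hs)
    fun u hu => hlF ⟨hlt.1.trans_le hu.1, hu.2⟩

/-! ### Countability of the set of branches -/

theorem exists_countable_reps (φ : RegularGerm) : ∃ E : Set (Sphere → ℂ), E.Countable ∧
    ∀ ψ ∈ connectedComponent φ, ∃ F ∈ E, Rep ψ F := by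
  classical
  obtain ⟨𝔅, h𝔅c, h𝔅, h𝔅n⟩ := exists_countable_preconnected_basis
  have := h𝔅c.to_subtype
  let Extends (V W : Set Sphere) (F G : Sphere → ℂ) : Prop :=
    (∀ z ∈ V, HolomorphicAt G z) ∧ ∀ z ∈ W, G z = F z
  let extend (p : 𝔅 × 𝔅) (F : Sphere → ℂ) : Sphere → ℂ :=
    if h : ∃ G, Extends p.1 p.2 F G then h.choose else F
  let E : Set (Sphere → ℂ) := Set.range fun l : List (𝔅 × 𝔅) => l.foldr extend (rep φ)
  have extend_mem : ∀ p, ∀ F ∈ E, extend p F ∈ E := by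
    rintro p _ ⟨l, rfl⟩
    exact ⟨p :: l, rfl⟩
  have isOpen_reps : IsOpen {ψ : RegularGerm | ∃ F ∈ E, Rep ψ F} := by
    refine isOpen_iff_mem_nhds.2 ?_
    rintro ψ ⟨F, hF, h⟩
    exact h.eventually.mono fun χ hχ => ⟨F, hF, hχ⟩
  have isClosed_reps : IsClosed {ψ : RegularGerm | ∃ F ∈ E, Rep ψ F} := by
    refine isClosed_of_closure_subset fun ψ hψ => ?_
    have hG := rep_spec ψ
    obtain ⟨V, hV, hψV, hVG⟩ := h𝔅n ψ.1 _ hG.holomorphicAt.eventually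
    obtain ⟨χ, ⟨hχV, hχG⟩, F, hFE, hF⟩ := mem_closure_iff.1 hψ _
      (isOpen_sheet (rep ψ) (h𝔅 V hV).1) ⟨hψV, hG⟩
    obtain ⟨W, hW, hχW, hWF⟩ := h𝔅n χ.1 _
      (((h𝔅 V hV).1.eventually_mem hχV).and (hχG.eventuallyEq hF))
    have hex : ∃ G, Extends V W F G := ⟨rep ψ, hVG, fun z hz => (hWF hz).2⟩
    refine ⟨extend (⟨V, hV⟩, ⟨W, hW⟩) F, extend_mem _ _ hFE, ?_⟩
    have hext : Extends V W F (extend (⟨V, hV⟩, ⟨W, hW⟩) F) := by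
      simp only [extend, dif_pos hex]
      exact hex.choose_spec
    refine hG.congr (eventuallyEq_of_isPreconnected (h𝔅 V hV).2 hVG hext.1 hχV hψV ?_)
    filter_upwards [(h𝔅 W hW).1.mem_nhds hχW] with z hz
    rw [hext.2 z hz, (hWF hz).2]
  exact ⟨E, Set.countable_range _, fun ψ hψ => IsClopen.connectedComponent_subset
    ⟨isClosed_reps, isOpen_reps⟩ ⟨rep φ, ⟨[], rfl⟩, rep_spec φ⟩ hψ⟩

theorem countable_of_isolated_on_branches {ι : Type*} [Finite ι] {φ : ι → RegularGerm}
    {P : (ι → Sphere → ℂ) → Sphere → Prop} (hP : IsLocalProperty P)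
    (hreach : ∀ F z, P F z → ∀ i, ∃ ψ ∈ connectedComponent (φ i), ψ.1 = z ∧ Rep ψ (F i))
    (hiso : ∀ F z, P F z → ∀ᶠ w in 𝓝[≠] z, ¬ P F w) :
    {z | ∃ F, P F z}.Countable := by
  choose E hEc hE using fun i => exists_countable_reps (φ i)
  have : ∀ i, Countable (E i) := fun i => (hEc i).to_subtype
  have hsub : {z | ∃ F, P F z} ⊆ ⋃ F : ∀ i, E i, {z | P (fun i => F i) z} := by
    rintro z ⟨F, hF⟩
    choose ψ hψ hψz hψF using hreach F z hF
    choose G hGE hG using fun i => hE i (ψ i) (hψ i)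
    refine Set.mem_iUnion.2 ⟨fun i => ⟨G i, hGE i⟩, hP _ _ _ (fun i => ?_) hF⟩
    rw [← hψz i]
    exact (hψF i).eventuallyEq (hG i)
  exact (Set.countable_iUnion fun F => countable_of_isolated fun z hz => hiso _ z hz).mono hsub

/-! ### Change of the base point -/

theorem eventually_avoiding {F : Sphere → ℂ} {a : Sphere} (hF : HolomorphicAt F a)
    {A : Set Sphere} (hA : singularSet (germAt F a hF) ⊆ A) :
    ∀ᶠ z in 𝓝 a, ∀ hz : HolomorphicAt F z, Avoiding A (germAt F z hz) := by
  filter_upwards [eventually_joined hF] with z hz hFz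
  exact (avoiding_singularSet _).mono ((singularSet_subset_of_joined (hz hFz)).trans hA)

theorem singularSet_subset_of_eventually {K : Sphere → ℂ} {a : Sphere} (hK : HolomorphicAt K a)
    {A : Set Sphere} (hA : A.Countable)
    (h : ∀ᶠ z in 𝓝 a, z ∉ A → ∀ hz : HolomorphicAt K z, Avoiding A (germAt K z hz)) :
    singularSet (germAt K a hK) ⊆ A := by
  obtain ⟨z, ⟨⟨hav, hKz⟩, hjoin⟩, hzA⟩ := exists_mem_not_mem_countable hA
    ((h.and hK.eventually).and (eventually_joined hK))
  rw [singularSet_eq_of_joined (hjoin hKz)]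
  exact singularSet_subset_of_avoiding hA (hav hzA hKz) hzA

/-! ### Joint continuation of several germs -/

section JointBranch

variable {ι : Type*} {F : ι → Sphere → ℂ} {a : Sphere} {hF : ∀ i, HolomorphicAt (F i) a}

/-- The tuples of germs which arise from the germs of the functions `F i` at `a` by simultaneous
continuation: a connected component of the fibre product of copies of the étalé space. -/
def jointComponent (hF : ∀ i, HolomorphicAt (F i) a) : Set (Sphere × (ι → RegularGerm)) :=
  connectedComponentIn {x | ∀ i, (x.2 i).1 = x.1} (a, fun i => germAt (F i) a (hF i))

/-- The functions `G i` represent at `b` germs which arise from the germs of the functions `F i`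
at `a` by simultaneous continuation. -/
def IsJointBranch (hF : ∀ i, HolomorphicAt (F i) a) (G : ι → Sphere → ℂ) (b : Sphere) : Prop :=
  ∃ x ∈ jointComponent hF, x.1 = b ∧ ∀ i, Rep (x.2 i) (G i)

theorem isPreconnected_jointComponent : IsPreconnected (jointComponent hF) :=
  isPreconnected_connectedComponentIn

theorem self_mem_jointComponent : (a, fun i => germAt (F i) a (hF i)) ∈ jointComponent hF :=
  mem_connectedComponentIn fun _ => rfl

theorem base_eq_of_mem_jointComponent {x : Sphere × (ι → RegularGerm)}
    (hx : x ∈ jointComponent hF) (i : ι) : (x.2 i).1 = x.1 :=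
  connectedComponentIn_subset _ _ hx i

theorem IsJointBranch.holomorphicAt {G : ι → Sphere → ℂ} {b : Sphere} (h : IsJointBranch hF G b)
    (i : ι) : HolomorphicAt (G i) b := by
  obtain ⟨x, hx, rfl, hG⟩ := h
  rw [← base_eq_of_mem_jointComponent hx i]
  exact (hG i).holomorphicAt

theorem isLocalProperty_isJointBranch : IsLocalProperty (IsJointBranch hF) := by
  rintro G G' _ hGG' ⟨x, hx, rfl, hG⟩
  refine ⟨x, hx, rfl, fun i => (hG i).congr ?_⟩
  rw [base_eq_of_mem_jointComponent hx i]
  exact hGG' i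

theorem IsJointBranch.permanence [Finite ι] {G : ι → Sphere → ℂ} {b : Sphere}
    (h : IsJointBranch hF G b) {P : (ι → Sphere → ℂ) → Sphere → Prop} (hP : IsLocalProperty P)
    (hloc : ∀ F z, (∀ i, HolomorphicAt (F i) z) →
      (∀ᶠ w in 𝓝 z, P F w) ∨ ∀ᶠ w in 𝓝 z, ¬ P F w) (hPF : P F a) : P G b := by
  obtain ⟨x, hx, rfl, hG⟩ := h
  refine hP _ _ _ (fun i => ?_) <| SFun.permanence (γ := Prod.fst)
    (Φ := fun i (x : Sphere × (ι → RegularGerm)) => x.2 i) isPreconnected_jointComponent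
    continuous_fst.continuousOn (fun i x hx => base_eq_of_mem_jointComponent hx i)
    (fun i => by fun_prop) hP hloc self_mem_jointComponent hx
    (hP _ _ _ (fun i => (rep_germAt_eventuallyEq (hF i)).symm) hPF)
  rw [← base_eq_of_mem_jointComponent hx i]
  exact (rep_spec _).eventuallyEq (hG i)

theorem countable_setOf_isJointBranch [Finite ι] {P : (ι → Sphere → ℂ) → Sphere → Prop}
    (hP : IsLocalProperty P)
    (hiso : ∀ G z, IsJointBranch hF G z → ∀ᶠ w in 𝓝[≠] z, ¬ P G w) :
    {z | ∃ G, IsJointBranch hF G z ∧ P G z}.Countable := by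
  refine countable_of_isolated_on_branches (φ := fun i => germAt (F i) a (hF i))
    (P := fun G z => IsJointBranch hF G z ∧ P G z)
    (fun G G' z hG h => ⟨isLocalProperty_isJointBranch G G' z hG h.1, hP G G' z hG h.2⟩) ?_
    fun G z h => (hiso G z h.1).mono fun w hw hPw => hw hPw.2
  rintro G z ⟨⟨x, hx, rfl, hG⟩, -⟩ i
  have hproj : Continuous fun x : Sphere × (ι → RegularGerm) => x.2 i := by fun_prop
  refine ⟨x.2 i, ?_, base_eq_of_mem_jointComponent hx i, hG i⟩
  exact (isPreconnected_jointComponent.image _ hproj.continuousOn).subset_connectedComponent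
    ⟨_, self_mem_jointComponent, rfl⟩ ⟨x, hx, rfl⟩

theorem countable_setOf_isJointBranch_op_eq_zero [Finite ι]
    {Op : (ι → Sphere → ℂ) → Sphere → ℂ} (hop : IsLocalOperator Op)
    (hhol : ∀ F z, (∀ i, HolomorphicAt (F i) z) → HolomorphicAt (Op F) z)
    (hne : ¬ ∀ᶠ z in 𝓝 a, Op F z = 0) :
    {z | ∃ G, IsJointBranch hF G z ∧ Op G z = 0}.Countable := by
  refine countable_setOf_isJointBranch
    (fun G G' z hG h => (hop G G' z hG).self_of_nhds ▸ h) fun G z hG => ?_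
  refine ((hhol G z hG.holomorphicAt).eventually_eq_zero_or).resolve_left
    (hG.permanence (P := fun F z => ¬ ∀ᶠ w in 𝓝 z, Op F w = 0) (fun F F' z hFF' h h' => h ?_)
      (fun F z hF => ?_) hne)
  · filter_upwards [hop F F' z hFF', h'] with w hw h0
    rw [hw, h0]
  · simpa only [not_not] using (eventually_eventuallyEq_zero_or (hhol F z hF)).symm

theorem isJointBranch_of_continuousOn {T : Type*} [TopologicalSpace T] {s : Set T}
    (hs : IsPreconnected s) {γ : T → Sphere} (hγ : ContinuousOn γ s) {Φ : ι → T → RegularGerm}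
    (hb : ∀ i, ∀ t ∈ s, (Φ i t).1 = γ t) (hΦ : ∀ i, ContinuousOn (Φ i) s) {t₀ t₁ : T}
    (h₀ : t₀ ∈ s) (h₁ : t₁ ∈ s) {G : ι → Sphere → ℂ} (hG : IsJointBranch hF G (γ t₀))
    (hGΦ : ∀ i, Rep (Φ i t₀) (G i)) : IsJointBranch hF (fun i => rep (Φ i t₁)) (γ t₁) := by
  obtain ⟨x, hx, hxγ, hxG⟩ := hG
  have eq_x : (γ t₀, fun i => Φ i t₀) = x := Prod.ext hxγ.symm <| funext fun i =>
    Rep.ext ((hb i _ h₀).trans <| hxγ.symm.trans (base_eq_of_mem_jointComponent hx i).symm)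
      (hGΦ i) (hxG i)
  refine ⟨(γ t₁, fun i => Φ i t₁), ?_, rfl, fun i => rep_spec _⟩
  rw [jointComponent, connectedComponentIn_eq hx, ← eq_x]
  refine (hs.image _ (hγ.prodMk (continuousOn_pi.2 hΦ))).subset_connectedComponentIn
    ⟨t₀, h₀, rfl⟩ ?_ ⟨t₁, h₁, rfl⟩
  rintro _ ⟨t, ht, rfl⟩ i
  exact hb i t ht

variable [Finite ι]

theorem eventually_isJointBranch : ∀ᶠ z in 𝓝 a, IsJointBranch hF F z := by
  obtain ⟨r, hr, hdisc⟩ := exists_disc_subset (eventually_all.2 fun i => (hF i).eventually)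
  have := isPreconnected_iff_preconnectedSpace.1 (isPreconnected_disc a r)
  filter_upwards [disc_mem_nhds a hr] with z hz
  have hself : IsJointBranch hF F a :=
    ⟨_, self_mem_jointComponent, rfl, fun i => rep_germAt _ _ (hF i)⟩
  have hz' := isJointBranch_of_continuousOn
    (isPreconnected_univ (α := disc a r))
    continuous_subtype_val.continuousOn
    (Φ := fun i (w : disc a r) => germAt (F i) w (hdisc w.2 i)) (fun _ _ _ => rfl)
    (fun i => continuousOn_germ continuous_subtype_val.continuousOn
      fun w _ => rep_germAt _ _ _)
    (Set.mem_univ ⟨a, mem_disc_self a hr⟩) (Set.mem_univ ⟨z, hz⟩) hself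
    fun i => rep_germAt _ _ _
  exact isLocalProperty_isJointBranch _ _ _
    (fun i => rep_germAt_eventuallyEq (hdisc hz i)) hz'

theorem eventually_exists_joint_continuation {A : Set Sphere}
    (hA : ∀ i, singularSet (germAt (F i) a (hF i)) ⊆ A) :
    ∀ᶠ z in 𝓝 a, ∀ γ : unitInterval → Sphere, Continuous γ → γ 0 = z → (∀ t, γ t ∉ A) →
      ∃ (hz : ∀ i, HolomorphicAt (F i) z) (Φ : ι → unitInterval → RegularGerm),
        (∀ i, IsContinuation (germAt (F i) z (hz i)) γ 1 (Φ i)) ∧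
        ∀ t, IsJointBranch hF (fun i => rep (Φ i t)) (γ t) := by
  filter_upwards [eventually_all.2 fun i => eventually_avoiding (hF i) (hA i),
    eventually_isJointBranch (hF := hF)] with z hav hz γ hγ h0 hγA
  choose Φ hΦ using fun i => hav i (hz.holomorphicAt i) γ hγ h0 hγA
  refine ⟨hz.holomorphicAt, Φ, hΦ, fun t => ?_⟩
  refine isJointBranch_of_continuousOn isPreconnected_univ hγ.continuousOn
    (fun i t _ => (hΦ i).base t unitInterval.le_one')
    (fun i => ((hΦ i).continuous hγ).continuousOn) (Set.mem_univ 0) (Set.mem_univ t)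
    (h0.symm ▸ hz) fun i => ?_
  rw [(hΦ i).start]
  exact rep_germAt _ _ _

/-! ### Results of local operators, and solutions of functional equations -/

theorem exists_continuation_op {z : Sphere} {γ : unitInterval → Sphere} (hγ : Continuous γ)
    {Φ : ι → unitInterval → RegularGerm} (hF : ∀ i, HolomorphicAt (F i) z)
    (hΦ : ∀ i, IsContinuation (germAt (F i) z (hF i)) γ 1 (Φ i)) (h0 : γ 0 = z)
    {Op : (ι → Sphere → ℂ) → Sphere → ℂ} (hop : IsLocalOperator Op)
    (hhol : ∀ t, HolomorphicAt (Op fun i => rep (Φ i t)) (γ t)) {K : Sphere → ℂ}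
    (hK : HolomorphicAt K z) (hKF : K =ᶠ[𝓝 z] Op F) :
    ∃ Θ, IsContinuation (germAt K z hK) γ 1 Θ := by
  refine ⟨fun t => germAt _ (γ t) (hhol t), ?_⟩
  rw [isContinuation_one_iff hγ]
  refine ⟨?_, fun t => rfl, ?_⟩
  · refine Rep.ext (F := K) h0 ((rep_germAt _ _ _).congr ?_) (rep_germAt _ _ _)
    simp only [germAt_fst, h0]
    refine (hop _ _ _ fun i => ?_).trans hKF.symm
    rw [(hΦ i).start]
    exact rep_germAt_eventuallyEq (hF i)
  · exact continuousOn_univ.1 <| continuousOn_of_rep_op hγ.continuousOn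
      (fun i t _ => (hΦ i).base t unitInterval.le_one')
      (fun i => ((hΦ i).continuous hγ).continuousOn) hop (fun t _ => rfl)
      (fun t _ => rep_germAt _ _ _)

theorem singularSet_subset_of_eventuallyEq_op {A : Set Sphere} (hAc : A.Countable)
    (hA : ∀ i, singularSet (germAt (F i) a (hF i)) ⊆ A)
    {Op : (ι → Sphere → ℂ) → Sphere → ℂ} (hop : IsLocalOperator Op)
    (hhol : ∀ G b, IsJointBranch hF G b → b ∉ A → HolomorphicAt (Op G) b) {K : Sphere → ℂ}
    (hK : HolomorphicAt K a) (hKF : ∀ᶠ z in 𝓝 a, z ∉ A → K =ᶠ[𝓝 z] Op F) :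
    singularSet (germAt K a hK) ⊆ A := by
  refine singularSet_subset_of_eventually hK hAc ?_
  filter_upwards [eventually_exists_joint_continuation hA, hKF] with
    z hz hKz hzA hK' γ hγ h0 hγA
  obtain ⟨hFz, Φ, hΦ, hΦF⟩ := hz γ hγ h0 hγA
  exact exists_continuation_op hγ hFz hΦ h0 hop (fun t => hhol _ _ (hΦF t) (hγA t)) hK' (hKz hzA)

/-- Off `A`, solutions of `Op (L, G) = 0` extend locally to discs which do not depend on them, so
that they can be continued along the paths along which the data `G` can. -/
theorem isSGerm_of_locally_solvable {A : Set Sphere} (hAc : A.Countable)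
    (hA : ∀ i, singularSet (germAt (F i) a (hF i)) ⊆ A)
    {Op : (Option ι → Sphere → ℂ) → Sphere → ℂ} (hop : IsLocalOperator Op)
    (hhol : ∀ F z, (∀ i, HolomorphicAt (F i) z) → HolomorphicAt (Op F) z)
    (hsolv : ∀ G, ∀ b ∉ A, IsJointBranch hF G b → ∃ V ∈ 𝓝 b, ∀ᶠ w in 𝓝 b, ∀ L,
      HolomorphicAt L w → (∀ᶠ u in 𝓝 w, Op (fun o => o.elim L G) u = 0) →
        ∃ H, L =ᶠ[𝓝 w] H ∧ ∀ u ∈ V, HolomorphicAt H u)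
    {K : Sphere → ℂ} (hK : HolomorphicAt K a)
    (hKF : ∀ᶠ z in 𝓝 a, Op (fun o => o.elim K F) z = 0) : IsSGerm (germAt K a hK) := by
  refine hAc.mono (singularSet_subset_of_eventually hK hAc ?_)
  filter_upwards [eventually_exists_joint_continuation hA, eventually_eventually_nhds.2 hKF] with
    z hz hKFz _ hKz γ hγ h0 hγA
  obtain ⟨hFz, Φ, hΦ, hΦF⟩ := hz γ hγ h0 hγA
  have hΦb : ∀ i t, (Φ i t).1 = γ t := fun i t => (hΦ i).base t unitInterval.le_one'
  have hΦc : ∀ i, Continuous (Φ i) := fun i => (hΦ i).continuous hγ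
  refine exists_continuation_of_local hγ h0 fun T => ?_
  obtain ⟨V, hV, hsol⟩ := hsolv _ _ (hγA T) (hΦF T)
  have rep_eq := eventually_rep_eventuallyEq (s := Set.univ) (fun i t _ => hΦb i t)
    (fun i => (hΦc i).continuousOn) (Set.mem_univ T)
  rw [nhdsWithin_univ] at rep_eq
  refine ⟨V, hV, ?_⟩
  filter_upwards [rep_eq, hγ.continuousAt.eventually hsol] with τ hτ hsolτ Ψ hΨ
  have relation := permanence_eq (s := Set.Iic τ) (Φ := fun o : Option ι => o.elim Ψ Φ)
    Set.ordConnected_Iic.isPreconnected hγ.continuousOn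
    (Option.rec (fun t ht => hΨ.base t ht) fun i t _ => hΦb i t)
    (Option.rec (hΨ.continuousOn hγ) fun i => (hΦc i).continuousOn) hop hhol
    (Set.mem_Iic.2 unitInterval.nonneg') Set.self_mem_Iic <| by
      rw [h0]
      refine (hop _ _ z (Option.rec ?_ fun i => ?_)).trans hKFz
      · simp only [Option.elim_none, hΨ.start]
        exact rep_germAt_eventuallyEq hKz
      · simp only [Option.elim_some, (hΦ i).start]
        exact rep_germAt_eventuallyEq (hFz i)
  have hol_rep := holomorphicAt_rep (Ψ τ)
  rw [hΨ.base τ le_rfl] at hol_rep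
  obtain ⟨H, hLH, hH⟩ := hsolτ _ hol_rep <|
    (hop _ _ (γ τ) (Option.rec EventuallyEq.rfl fun i => (hτ i).symm)).trans relation
  exact ⟨H, (rep_spec _).congr (by rw [hΨ.base τ le_rfl]; exact hLH), hH⟩

theorem isSGerm_of_locally_solvable_coe {A : Set Sphere} (hAc : A.Countable)
    (hA : ∀ i, singularSet (germAt (F i) a (hF i)) ⊆ A)
    {Op : (Option ι → Sphere → ℂ) → Sphere → ℂ} (hop : IsLocalOperator Op)
    (hhol : ∀ F z, (∀ i, HolomorphicAt (F i) z) → HolomorphicAt (Op F) z)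
    (hsolv : ∀ G (b : ℂ), (b : Sphere) ∉ A → IsJointBranch hF G b →
      ∃ V ∈ 𝓝 b, ∀ᶠ w : ℂ in 𝓝 b, ∀ L, HolomorphicAt L (w : Sphere) →
        (∀ᶠ u : ℂ in 𝓝 w, Op (fun o => o.elim L G) (u : Sphere) = 0) →
          ∃ h : ℂ → ℂ, (fun u : ℂ => L u) =ᶠ[𝓝 w] h ∧ ∀ u ∈ V, AnalyticAt ℂ h u)
    {K : Sphere → ℂ} (hK : HolomorphicAt K a)
    (hKF : ∀ᶠ z in 𝓝 a, Op (fun o => o.elim K F) z = 0) : IsSGerm (germAt K a hK) := by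
  refine isSGerm_of_locally_solvable (hAc.insert ∞) (fun i => (hA i).trans (Set.subset_insert _ _))
    hop hhol (fun G b hb hG => ?_) hK hKF
  simp only [Set.mem_insert_iff, not_or] at hb
  obtain ⟨b, rfl⟩ := OnePoint.ne_infty_iff_exists.1 hb.1
  obtain ⟨V, hV, hsol⟩ := hsolv G b hb.2 hG
  rw [OnePoint.nhds_coe_eq]
  refine ⟨(↑) '' V, image_mem_map hV, eventually_map.2 ?_⟩
  filter_upwards [hsol] with w hw L hL hLG
  rw [OnePoint.nhds_coe_eq, eventually_map] at hLG
  obtain ⟨h, hLh, hh⟩ := hw L hL hLG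
  refine ⟨fun z => z.elim 0 h, ?_, ?_⟩
  · rw [OnePoint.nhds_coe_eq]
    exact eventually_map.2 hLh
  · rintro _ ⟨u, hu, rfl⟩
    exact holomorphicAt_coe_iff.2 (hh u hu)

end JointBranch

/-! ### Differentiation, integration and composition -/

theorem isSGerm_derivGerm {a : Sphere} {φ : RegularGermAt a} (hφ : IsSGerm ⟨a, φ⟩) :
    IsSGerm ⟨a, derivGerm φ⟩ := by
  obtain ⟨_, F, hF, rfl⟩ := φ
  exact hφ.mono <| singularSet_subset_of_eventuallyEq_op (ι := Unit) (F := fun _ => F)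
    (hF := fun _ => hF) hφ (fun _ => subset_rfl) (Op := fun F => sphereDeriv (F ()))
    (fun F G z h => sphereDeriv_congr (h ())) (fun G b hG _ => (hG.holomorphicAt ()).sphereDeriv)
    hF.sphereDeriv (Eventually.of_forall fun _ _ => EventuallyEq.rfl)

theorem exists_ball_forall_primitive {g : ℂ → ℂ} {b : ℂ} (hg : AnalyticAt ℂ g b) :
    ∃ r > 0, ∀ w ∈ Metric.ball b r, ∀ l : ℂ → ℂ, AnalyticAt ℂ l w → deriv l =ᶠ[𝓝 w] g →
      ∃ h : ℂ → ℂ, l =ᶠ[𝓝 w] h ∧ ∀ u ∈ Metric.ball b r, AnalyticAt ℂ h u := by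
  obtain ⟨r, hr, hd⟩ := Metric.eventually_nhds_iff_ball.1 hg.eventually_analyticAt
  have hdiff : DifferentiableOn ℂ g (Metric.ball b r) := fun u hu =>
    (hd u hu).differentiableAt.differentiableWithinAt
  obtain ⟨p, hp⟩ := hdiff.isExactOn_ball
  have hpa : ∀ u ∈ Metric.ball b r, AnalyticAt ℂ p u := fun u hu =>
    DifferentiableOn.analyticAt (fun v hv => (hp v hv).differentiableAt.differentiableWithinAt)
      (Metric.isOpen_ball.mem_nhds hu)
  refine ⟨r, hr, fun w hw l hl hlg => ⟨fun u => p u + (l w - p w), ?_, fun u hu =>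
    (hpa u hu).add analyticAt_const⟩⟩
  obtain ⟨s, hs, hsub⟩ := Metric.eventually_nhds_iff_ball.1
    ((hl.eventually_analyticAt.and hlg).and (Metric.isOpen_ball.eventually_mem hw))
  have hd0 : ∀ u ∈ Metric.ball w s, HasDerivAt (fun v => l v - p v) 0 u := fun u hu => by
    have h := (hsub u hu).1.1.differentiableAt.hasDerivAt.sub (hp u (hsub u hu).2)
    rwa [(hsub u hu).1.2, sub_self] at h
  filter_upwards [Metric.ball_mem_nhds w hs] with u hu
  have hconst : l u - p u = l w - p w := Metric.isOpen_ball.is_const_of_deriv_eq_zero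
    (convex_ball w s).isPreconnected
    (fun v hv => (hd0 v hv).differentiableAt.differentiableWithinAt)
    (fun v hv => (hd0 v hv).deriv) hu (Metric.mem_ball_self hs)
  rw [← hconst, add_sub_cancel]

theorem isSGerm_of_derivGerm {a : Sphere} {χ : RegularGermAt a} (h : IsSGerm ⟨a, derivGerm χ⟩) :
    IsSGerm ⟨a, χ⟩ := by
  obtain ⟨_, K, hK, rfl⟩ := χ
  refine isSGerm_of_locally_solvable_coe (ι := Unit) (F := fun _ => sphereDeriv K)
    (hF := fun _ => hK.sphereDeriv) h (fun _ => subset_rfl)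
    (Op := fun F z => sphereDeriv (F none) z - F (Option.some ()) z) (fun F G z h => ?_)
    (fun F z hF => (hF _).sphereDeriv.sub (hF _)) (fun G b _ hG => ?_) hK
    (Eventually.of_forall fun z => sub_self _)
  · filter_upwards [sphereDeriv_congr (h none), h (Option.some ())] with w h₁ h₂
    rw [h₁, h₂]
  · obtain ⟨r, hr, hprim⟩ :=
      exists_ball_forall_primitive (holomorphicAt_coe_iff.1 (hG.holomorphicAt ()))
    refine ⟨_, Metric.ball_mem_nhds b hr, ?_⟩
    filter_upwards [Metric.ball_mem_nhds b hr] with w hw L hL hLG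
    exact hprim w hw _ (holomorphicAt_coe_iff.1 hL) (hLG.mono fun u hu => sub_eq_zero.1 hu)

theorem isSGerm_of_const {a : Sphere} {K : Sphere → ℂ} (hK : HolomorphicAt K a) {c : ℂ}
    (h : ∀ᶠ z in 𝓝 a, K z = c) : IsSGerm (germAt K a hK) :=
  Set.countable_empty.mono <| singularSet_subset_of_eventuallyEq_op (ι := Empty)
    (F := fun _ => K) (hF := fun _ => hK) Set.countable_empty nofun (Op := fun _ _ => c)
    (fun _ _ _ _ => EventuallyEq.rfl) (fun _ _ _ _ => HolomorphicAt.const c) hK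
    ((eventually_eventually_nhds.2 h).mono fun _ hz _ => hz)

theorem Rep.tendsto_coe {φ ψ : RegularGerm} {F : Sphere → ℂ} (hF : Rep φ F)
    (hψ : ψ.1 = (val φ : Sphere)) : Tendsto (fun z => (F z : Sphere)) (𝓝 φ.1) (𝓝 ψ.1) := by
  rw [hψ, hF.val_eq]
  exact (OnePoint.continuous_coe.tendsto _).comp hF.holomorphicAt.continuousAt

theorem holomorphicAt_rep_comp_rep {φ ψ : RegularGerm} (hψ : ψ.1 = (val φ : Sphere)) :
    HolomorphicAt (fun z => rep ψ (rep φ z)) φ.1 := by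
  refine HolomorphicAt.comp_coe ?_ (holomorphicAt_rep φ)
  rw [← (rep_spec φ).val_eq, ← hψ]
  exact holomorphicAt_rep ψ

theorem rep_comp_rep_eventuallyEq {φ ψ : RegularGerm} (hψ : ψ.1 = (val φ : Sphere))
    {F G : Sphere → ℂ} (hF : Rep φ F) (hG : Rep ψ G) :
    (fun z => rep ψ (rep φ z)) =ᶠ[𝓝 φ.1] fun z => G (F z) := by
  filter_upwards [(rep_spec φ).eventuallyEq hF,
    (hF.tendsto_coe hψ).eventually ((rep_spec ψ).eventuallyEq hG)] with u huF huG
  rw [huF, huG]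

theorem IsContinuation.exists_comp {F G : Sphere → ℂ} {z : Sphere} {hF : HolomorphicAt F z}
    {γ : unitInterval → Sphere} {Φ Ψ : unitInterval → RegularGerm}
    (hΦ : IsContinuation (germAt F z hF) γ 1 Φ) (hγ : Continuous γ) (h0 : γ 0 = z)
    {hG : HolomorphicAt G (F z : Sphere)}
    (hΨ : IsContinuation (germAt G _ hG) (fun t => (val (Φ t) : Sphere)) 1 Ψ)
    (hK : HolomorphicAt (fun w => G (F w)) z) :
    ∃ Θ, IsContinuation (germAt (fun w => G (F w)) z hK) γ 1 Θ := by
  have hΦc := hΦ.continuous hγ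
  have hΨc := hΨ.continuous (OnePoint.continuous_coe.comp (continuous_val.comp hΦc))
  have hΦb : ∀ t, (Φ t).1 = γ t := fun t => hΦ.base t unitInterval.le_one'
  have hΨb : ∀ t, (Ψ t).1 = (val (Φ t) : Sphere) := fun t => hΨ.base t unitInterval.le_one'
  have hhol : ∀ t, HolomorphicAt (fun z => rep (Ψ t) (rep (Φ t) z)) (γ t) := fun t =>
    hΦb t ▸ holomorphicAt_rep_comp_rep (hΨb t)
  have rep_comp : ∀ t F' G', Rep (Φ t) F' → Rep (Ψ t) G' →
      Rep (germAt _ (γ t) (hhol t)) fun z => G' (F' z) := fun t F' G' hF' hG' =>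
    (rep_germAt _ _ _).congr <| by
      simp only [germAt_fst, ← hΦb t]
      exact rep_comp_rep_eventuallyEq (hΨb t) hF' hG'
  refine ⟨fun t => germAt _ (γ t) (hhol t), (isContinuation_one_iff hγ).2
    ⟨Rep.ext h0 (rep_comp 0 F G ?_ ?_) (rep_germAt _ _ _), fun t => rfl,
      continuous_iff_continuousAt.2 fun t => tendsto_germ (rep_germAt _ _ _) hγ.continuousAt ?_⟩⟩
  · exact hΦ.start ▸ rep_germAt _ _ _
  · exact hΨ.start ▸ rep_germAt _ _ _
  · filter_upwards [hΦc.continuousAt.eventually (rep_spec (Φ t)).eventually,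
      hΨc.continuousAt.eventually (rep_spec (Ψ t)).eventually] with u huΦ huΨ
    exact rep_comp u _ _ huΦ huΨ

theorem countable_setOf_isJointBranch_mem {F : Sphere → ℂ} {a : Sphere} (hF : HolomorphicAt F a)
    {B : Set Sphere} (hB : B.Countable) (hconst : ∀ c, ¬ ∀ᶠ z in 𝓝 a, F z = c) :
    {z | ∃ G, IsJointBranch (fun _ : Unit => hF) G z ∧ (G () z : Sphere) ∈ B}.Countable := by
  have hBc : ((↑) ⁻¹' B : Set ℂ).Countable := hB.preimage OnePoint.coe_injective
  refine (hBc.biUnion fun c _ => countable_setOf_isJointBranch_op_eq_zero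
    (hF := fun _ : Unit => hF) (Op := fun F z => F () z - c) (fun F G z h => ?_)
    (fun F z hF => (hF ()).sub (HolomorphicAt.const c)) ?_).mono ?_
  · filter_upwards [h ()] with w hw
    rw [hw]
  · simpa only [sub_eq_zero] using hconst c
  · rintro z ⟨G, hG, hGz⟩
    exact Set.mem_biUnion (x := G () z) hGz ⟨G, hG, sub_self _⟩

theorem isSGerm_compGerm {a : Sphere} {φ : RegularGermAt a}
    {ψ : RegularGermAt ((germValue φ : ℂ) : Sphere)} (hφ : IsSGerm ⟨a, φ⟩)
    (hψ : IsSGerm ⟨_, ψ⟩) : IsSGerm ⟨a, compGerm φ ψ⟩ := by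
  obtain ⟨_, F, hF, rfl⟩ := φ
  obtain ⟨_, G, hG, rfl⟩ := ψ
  change HolomorphicAt G (F a : Sphere) at hG
  have hK : HolomorphicAt (fun z => G (F z)) a := hG.comp_coe hF
  change IsSGerm (germAt _ a hK)
  by_cases hconst : ∃ c, ∀ᶠ z in 𝓝 a, F z = c
  · obtain ⟨c, hc⟩ := hconst
    exact isSGerm_of_const hK (c := G (c : Sphere)) (hc.mono fun z hz => by rw [hz])
  set B := singularSet (germAt G (F a : Sphere) hG)
  set S := {z | ∃ G, IsJointBranch (fun _ : Unit => hF) G z ∧ (G () z : Sphere) ∈ B}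
  have hS : S.Countable := countable_setOf_isJointBranch_mem hF hψ (not_exists.1 hconst)
  refine (hφ.union hS).mono (singularSet_subset_of_eventually hK (hφ.union hS) ?_)
  have hFa : Tendsto (fun z => (F z : Sphere)) (𝓝 a) (𝓝 (F a : Sphere)) :=
    (OnePoint.continuous_coe.tendsto _).comp hF.continuousAt
  filter_upwards [eventually_exists_joint_continuation (hF := fun _ : Unit => hF)
    fun _ => Set.subset_union_left, hFa.eventually hG.eventually,
    hFa.eventually (eventually_avoiding hG subset_rfl)] with z hz hGz hav _ hKz γ hγ h0 hγA
  obtain ⟨hFz, Φ, hΦ, hΦF⟩ := hz γ hγ h0 hγA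
  have hΦb : ∀ t, (Φ () t).1 = γ t := fun t => (hΦ ()).base t unitInterval.le_one'
  have hval : ∀ t, val (Φ () t) = rep (Φ () t) (γ t) := fun t => by
    rw [(rep_spec (Φ () t)).val_eq, hΦb]
  obtain ⟨Ψ, hΨ⟩ := hav hGz (fun t => (val (Φ () t) : Sphere))
    (OnePoint.continuous_coe.comp (continuous_val.comp ((hΦ ()).continuous hγ)))
    (by simp only [(hΦ ()).start, (rep_germAt F z (hFz ())).val_eq, germAt_fst])
    fun t ht => hγA t (Or.inr ⟨_, hΦF t, by rwa [← hval]⟩)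
  exact (hΦ ()).exists_comp hγ h0 hΨ hKz

/-! ### Linear differential equations -/

section LinearSystem

variable {E : Type*} [NormedAddCommGroup E] [NormedSpace ℂ E] {M : ℂ → E →L[ℂ] E}

theorem exists_linear_system_iterates [CompleteSpace E] {b w₁ : ℂ} {δ : ℝ}
    (hM : DifferentiableOn ℂ M (Metric.ball b δ)) (y₀ : E) :
    ∃ Z : ℕ → ℂ → E, (∀ w, Z 0 w = y₀) ∧ (∀ k, Z (k + 1) w₁ = 0) ∧
      ∀ k, ∀ w ∈ Metric.ball b δ, HasDerivAt (Z (k + 1)) (M w (Z k w)) w := by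
  have exists_next : ∀ Z : {Z : ℂ → E // DifferentiableOn ℂ Z (Metric.ball b δ)},
      ∃ Z' : {Z : ℂ → E // DifferentiableOn ℂ Z (Metric.ball b δ)}, Z'.1 w₁ = 0 ∧
        ∀ w ∈ Metric.ball b δ, HasDerivAt Z'.1 (M w (Z.1 w)) w := fun Z => by
    obtain ⟨Z', hZ', hd⟩ := (hM.clm_apply Z.2).isExactOn_ball.with_val_at w₁ 0
    exact ⟨⟨Z', fun w hw => (hd w hw).differentiableAt.differentiableWithinAt⟩, hZ', hd⟩
  choose next hnext hderiv using exists_next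
  refine ⟨fun k => (next^[k] ⟨fun _ => y₀, differentiableOn_const _⟩).1, fun w => rfl,
    fun k => ?_, fun k => ?_⟩
  · simp only [Function.iterate_succ_apply', hnext]
  · simp only [Function.iterate_succ_apply']
    exact hderiv _

theorem norm_linear_system_iterate_le {b w₁ : ℂ} {δ C : ℝ} (hC : 0 ≤ C) (hδC : 4 * δ * C ≤ 1)
    (hMC : ∀ w ∈ Metric.ball b δ, ‖M w‖ ≤ C) (hw₁ : w₁ ∈ Metric.ball b δ) {y₀ : E}
    {Z : ℕ → ℂ → E} (hZ : ∀ w, Z 0 w = y₀) (hZw₁ : ∀ k, Z (k + 1) w₁ = 0)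
    (hderiv : ∀ k, ∀ w ∈ Metric.ball b δ, HasDerivAt (Z (k + 1)) (M w (Z k w)) w) (k : ℕ) :
    ∀ w ∈ Metric.ball b δ, ‖Z k w‖ ≤ ‖y₀‖ * (1 / 2) ^ k := by
  induction k with
  | zero => simp [hZ]
  | succ k ih =>
    intro w hw
    have mean_value := (convex_ball b δ).norm_image_sub_le_of_norm_hasDerivWithin_le
      (C := C * (‖y₀‖ * (1 / 2) ^ k)) (fun u hu => (hderiv k u hu).hasDerivWithinAt)
      (fun u hu => (M u).le_of_opNorm_le_of_le (hMC u hu) (ih u hu)) hw₁ hw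
    have diam : ‖w - w₁‖ ≤ 2 * δ := by
      have := dist_triangle_right w w₁ b
      rw [← dist_eq_norm]
      linarith [Metric.mem_ball.1 hw, Metric.mem_ball.1 hw₁]
    calc ‖Z (k + 1) w‖ ≤ C * (‖y₀‖ * (1 / 2) ^ k) * ‖w - w₁‖ := by simpa [hZw₁] using mean_value
      _ ≤ C * (‖y₀‖ * (1 / 2) ^ k) * (2 * δ) := by gcongr
      _ = (4 * δ * C) * (‖y₀‖ * (1 / 2) ^ (k + 1)) := by ring
      _ ≤ ‖y₀‖ * (1 / 2) ^ (k + 1) := mul_le_of_le_one_left (by positivity) hδC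

theorem exists_solution_linear_system [CompleteSpace E] {b w₁ : ℂ} {δ C : ℝ} (hC : 0 ≤ C)
    (hδC : 4 * δ * C ≤ 1) (hM : DifferentiableOn ℂ M (Metric.ball b δ))
    (hMC : ∀ w ∈ Metric.ball b δ, ‖M w‖ ≤ C) (hw₁ : w₁ ∈ Metric.ball b δ) (y₀ : E) :
    ∃ Y : ℂ → E, Y w₁ = y₀ ∧ ∀ w ∈ Metric.ball b δ, HasDerivAt Y (M w (Y w)) w := by
  obtain ⟨Z, hZ, hZw₁, hderiv⟩ := exists_linear_system_iterates (w₁ := w₁) hM y₀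
  have hbound := norm_linear_system_iterate_le hC hδC hMC hw₁ hZ hZw₁ hderiv
  have hsum : Summable fun k : ℕ => ‖y₀‖ * (1 / 2 : ℝ) ^ k := summable_geometric_two.mul_left _
  have summable_Z : ∀ w ∈ Metric.ball b δ, Summable fun k => Z k w := fun w hw =>
    Summable.of_norm_bounded hsum fun k => hbound k w hw
  refine ⟨fun w => y₀ + ∑' k, Z (k + 1) w, by simp [hZw₁], fun w hw => ?_⟩
  have hasDeriv := hasDerivAt_tsum_of_isPreconnected (hsum.mul_left C) Metric.isOpen_ball
    (convex_ball b δ).isPreconnected hderiv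
    (fun k u hu => (M u).le_of_opNorm_le_of_le (hMC u hu) (hbound k u hu)) hw₁
    ((summable_nat_add_iff 1).2 (summable_Z w₁ hw₁)) hw
  rw [← (M w).map_tsum (summable_Z w hw), (summable_Z w hw).tsum_eq_zero_add, hZ] at hasDeriv
  exact hasDeriv.const_add y₀

theorem exists_forall_solution_linear_system [CompleteSpace E] {b : ℂ}
    (hM : ∀ᶠ w in 𝓝 b, DifferentiableAt ℂ M w) : ∃ δ > 0, ∀ w₁ ∈ Metric.ball b δ, ∀ y₀ : E,
      ∃ Y : ℂ → E, Y w₁ = y₀ ∧ ∀ w ∈ Metric.ball b δ, HasDerivAt Y (M w (Y w)) w := by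
  have hC : ∀ᶠ w in 𝓝 b, ‖M w‖ < ‖M b‖ + 1 :=
    hM.self_of_nhds.continuousAt.norm.eventually_lt_const (lt_add_one _)
  obtain ⟨δ₀, hδ₀, hball⟩ := Metric.eventually_nhds_iff_ball.1 (hM.and hC)
  have hsub : Metric.ball b (min δ₀ (1 / (4 * (‖M b‖ + 1)))) ⊆ Metric.ball b δ₀ :=
    Metric.ball_subset_ball (min_le_left _ _)
  refine ⟨_, lt_min hδ₀ (by positivity), fun w₁ hw₁ y₀ =>
    exists_solution_linear_system (C := ‖M b‖ + 1) (by positivity) ?_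
      (fun w hw => (hball w (hsub hw)).1.differentiableWithinAt)
      (fun w hw => (hball w (hsub hw)).2.le) hw₁ y₀⟩
  have := min_le_right δ₀ (1 / (4 * (‖M b‖ + 1)))
  rw [le_div_iff₀ (by positivity)] at this
  linarith

/-- On a small disc the maximum of `‖y‖` is at most half of itself, by the mean value theorem. -/
theorem eventually_eq_zero_of_linear_system {w₁ : ℂ} (hM : ContinuousAt M w₁)
    {y : ℂ → E} (hy : ∀ᶠ w in 𝓝 w₁, HasDerivAt y (M w (y w)) w) (h0 : y w₁ = 0) :
    ∀ᶠ w in 𝓝 w₁, y w = 0 := by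
  obtain ⟨C, hC0, hC⟩ : ∃ C > 0, ∀ᶠ w in 𝓝 w₁, ‖M w‖ < C :=
    ⟨‖M w₁‖ + 1, by positivity, hM.norm.eventually_lt_const (lt_add_one _)⟩
  obtain ⟨δ₀, hδ₀, hb⟩ := Metric.eventually_nhds_iff_ball.1 (hC.and hy)
  obtain ⟨δ, hδ, hδδ₀, hδC⟩ : ∃ δ > 0, δ < δ₀ ∧ C * δ ≤ 1 / 2 := by
    refine ⟨min (δ₀ / 2) (1 / (2 * C)), by positivity,
      (min_le_left _ _).trans_lt (half_lt_self hδ₀), ?_⟩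
    calc C * min (δ₀ / 2) (1 / (2 * C)) ≤ C * (1 / (2 * C)) := by gcongr; exact min_le_right _ _
      _ = 1 / 2 := by field_simp
  have hsub : Metric.closedBall w₁ δ ⊆ Metric.ball w₁ δ₀ := Metric.closedBall_subset_ball hδδ₀
  obtain ⟨u, hu, hmax⟩ := (isCompact_closedBall w₁ δ).exists_isMaxOn
    ⟨w₁, Metric.mem_closedBall_self hδ.le⟩ (f := fun w => ‖y w‖) fun w hw =>
      (hb w (hsub hw)).2.continuousAt.norm.continuousWithinAt
  have mean_value := (convex_closedBall w₁ δ).norm_image_sub_le_of_norm_hasDerivWithin_le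
    (C := C * ‖y u‖) (fun v hv => (hb v (hsub hv)).2.hasDerivWithinAt)
    (fun v hv => (M v).le_of_opNorm_le_of_le (hb v (hsub hv)).1.le (hmax hv))
    (Metric.mem_closedBall_self hδ.le) hu
  have half : ‖y u‖ ≤ 1 / 2 * ‖y u‖ :=
    calc ‖y u‖ ≤ C * ‖y u‖ * ‖u - w₁‖ := by simpa [h0] using mean_value
      _ ≤ C * ‖y u‖ * δ := by gcongr; exact mem_closedBall_iff_norm.1 hu
      _ = C * δ * ‖y u‖ := by ring
      _ ≤ 1 / 2 * ‖y u‖ := by gcongr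
  filter_upwards [Metric.closedBall_mem_nhds w₁ hδ] with w hw
  exact norm_le_zero_iff.1 ((hmax hw).trans (by linarith))

end LinearSystem

/-- The companion system of the linear equation with coefficients `c`: `y j` stands for the `j`-th
derivative of a solution. -/
def companion {n : ℕ} (c : Fin n → ℂ) : (Fin n → ℂ) →L[ℂ] (Fin n → ℂ) :=
  (ContinuousLinearMap.pi fun j : Fin n =>
      if h : (j : ℕ) + 1 < n then ContinuousLinearMap.proj ⟨j + 1, h⟩ else 0) -
    ∑ i, c i • ContinuousLinearMap.pi fun j : Fin n =>
      if (j : ℕ) + 1 < n then 0 else ContinuousLinearMap.proj i.rev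

theorem companion_apply_of_lt {n : ℕ} (c y : Fin n → ℂ) {j : Fin n} (h : (j : ℕ) + 1 < n) :
    companion c y j = y ⟨j + 1, h⟩ := by
  simp [companion, h]

theorem companion_apply_of_not_lt {n : ℕ} (c y : Fin n → ℂ) {j : Fin n} (h : ¬ (j : ℕ) + 1 < n) :
    companion c y j = - ∑ i, c i * y i.rev := by
  simp [companion, h]

theorem differentiableAt_companion {n : ℕ} {f : Fin n → ℂ → ℂ} {w : ℂ}
    (hf : ∀ i, DifferentiableAt ℂ (f i) w) :
    DifferentiableAt ℂ (fun w => companion fun i => f i w) w :=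
  (DifferentiableAt.fun_sum fun i _ => (hf i).smul_const _).const_sub _

theorem hasDerivAt_iterate_deriv_of_linear_equation {n : ℕ} {c : Fin n → ℂ} {k : ℂ → ℂ} {w : ℂ}
    (hk : AnalyticAt ℂ k w)
    (h : deriv^[n] k w + ∑ i, c i * deriv^[n - (i + 1 : ℕ)] k w = 0) :
    HasDerivAt (fun w (j : Fin n) => deriv^[j] k w)
      (companion c fun j => deriv^[j] k w) w := by
  refine hasDerivAt_pi.2 fun j => ?_
  have key : companion c (fun j : Fin n => deriv^[j] k w) j = deriv^[(j : ℕ) + 1] k w := by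
    by_cases hj : (j : ℕ) + 1 < n
    · rw [companion_apply_of_lt _ _ hj]
    · rw [companion_apply_of_not_lt _ _ hj, show (j : ℕ) + 1 = n by omega, eq_comm,
        eq_neg_iff_add_eq_zero]
      simpa only [Fin.val_rev] using h
  rw [key, Function.iterate_succ_apply']
  exact (hk.iterated_deriv j).differentiableAt.hasDerivAt

theorem exists_ball_forall_linear_equation {n : ℕ} {f : Fin n → ℂ → ℂ} {b : ℂ}
    (hf : ∀ i, AnalyticAt ℂ (f i) b) : ∃ δ > 0, ∀ w₁ ∈ Metric.ball b δ, ∀ k : ℂ → ℂ,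
      AnalyticAt ℂ k w₁ →
      (∀ᶠ w in 𝓝 w₁, deriv^[n] k w + ∑ i, f i w * deriv^[n - (i + 1 : ℕ)] k w = 0) →
      ∃ g : ℂ → ℂ, k =ᶠ[𝓝 w₁] g ∧ ∀ w ∈ Metric.ball b δ, AnalyticAt ℂ g w := by
  obtain _ | n := n
  · refine ⟨1, one_pos, fun w₁ _ k _ hode => ⟨0, ?_, fun w _ => analyticAt_const⟩⟩
    filter_upwards [hode] with w hw
    simpa using hw
  obtain ⟨r, hr, hfr⟩ := Metric.eventually_nhds_iff_ball.1
    (eventually_all.2 fun i => (hf i).eventually_analyticAt)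
  have hM : ∀ w ∈ Metric.ball b r, DifferentiableAt ℂ (fun w => companion fun i => f i w) w :=
    fun w hw => differentiableAt_companion fun i => (hfr w hw i).differentiableAt
  obtain ⟨δ, hδ, hsol⟩ := exists_forall_solution_linear_system
    (eventually_of_mem (Metric.ball_mem_nhds b hr) hM)
  refine ⟨min δ r, lt_min hδ hr, fun w₁ hw₁ k hk hode => ?_⟩
  have hsub : Metric.ball b (min δ r) ⊆ Metric.ball b δ := Metric.ball_subset_ball (min_le_left _ _)
  have hw₁r : w₁ ∈ Metric.ball b r := Metric.ball_subset_ball (min_le_right _ _) hw₁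
  obtain ⟨Y, hY₁, hY⟩ := hsol w₁ (hsub hw₁) fun j => deriv^[j] k w₁
  have agree := eventually_eq_zero_of_linear_system
    (y := fun w => (fun j : Fin (n + 1) => deriv^[j] k w) - Y w) (hM w₁ hw₁r).continuousAt
    (by
      filter_upwards [hk.eventually_analyticAt, hode, Metric.isOpen_ball.mem_nhds (hsub hw₁)] with
        w hkw hw hwδ
      rw [map_sub]
      exact (hasDerivAt_iterate_deriv_of_linear_equation hkw hw).fun_sub (hY w hwδ))
    (by simp [hY₁])
  refine ⟨fun w => Y w 0, agree.mono fun w hw => congrFun (sub_eq_zero.1 hw) 0, fun w hw => ?_⟩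
  refine DifferentiableOn.analyticAt (fun u hu => ?_) (Metric.isOpen_ball.mem_nhds (hsub hw))
  exact (hasDerivAt_pi.1 (hY u hu) 0).differentiableAt.differentiableWithinAt

theorem iterate_sphereDeriv_coe (F : Sphere → ℂ) (n : ℕ) :
    (fun w : ℂ => sphereDeriv^[n] F w) = deriv^[n] fun w : ℂ => F w := by
  induction n with
  | zero => rfl
  | succ n ih =>
    simp only [Function.iterate_succ_apply', ← ih]
    rfl

theorem iterate_sphereDeriv_congr {F G : Sphere → ℂ} {a : Sphere} (h : F =ᶠ[𝓝 a] G) (n : ℕ) :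
    sphereDeriv^[n] F =ᶠ[𝓝 a] sphereDeriv^[n] G := by
  induction n with
  | zero => exact h
  | succ n ih =>
    simp only [Function.iterate_succ_apply']
    exact sphereDeriv_congr ih

theorem HolomorphicAt.iterate_sphereDeriv {F : Sphere → ℂ} {a : Sphere} (h : HolomorphicAt F a)
    (n : ℕ) : HolomorphicAt (SFun.sphereDeriv^[n] F) a := by
  induction n with
  | zero => exact h
  | succ n ih =>
    rw [Function.iterate_succ_apply']
    exact ih.sphereDeriv

theorem iterate_derivGerm_coe {a : Sphere} {χ : RegularGermAt a} {K : Sphere → ℂ}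
    (h : (χ : (𝓝 a).Germ ℂ) = K) (n : ℕ) :
    ((derivGerm^[n] χ : RegularGermAt a) : (𝓝 a).Germ ℂ) = (sphereDeriv^[n] K : Sphere → ℂ) := by
  induction n with
  | zero => exact h
  | succ n ih =>
    simp only [Function.iterate_succ_apply']
    exact congrArg germDeriv ih

/-- The left-hand side of the linear equation, with the unknown at `none` and the coefficients at
the indices `some i`. -/
def linearOp (n : ℕ) (F : Option (Fin n) → Sphere → ℂ) (z : Sphere) : ℂ :=
  sphereDeriv^[n] (F none) z +
    ∑ i : Fin n, F (Option.some i) z * sphereDeriv^[n - (i + 1 : ℕ)] (F none) z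

theorem isLocalOperator_linearOp (n : ℕ) : IsLocalOperator (linearOp n) := by
  intro F G z hFG
  filter_upwards [iterate_sphereDeriv_congr (hFG none) n, eventually_all.2 hFG,
    eventually_all.2 fun i : Fin n => iterate_sphereDeriv_congr (hFG none) (n - (i + 1 : ℕ))]
    with w hn hF hi
  simp only [linearOp, hn, hF, hi]

theorem HolomorphicAt.linearOp {n : ℕ} {F : Option (Fin n) → Sphere → ℂ} {z : Sphere}
    (hF : ∀ i, HolomorphicAt (F i) z) : HolomorphicAt (SFun.linearOp n F) z :=
  ((hF none).iterate_sphereDeriv n).add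
    (HolomorphicAt.sum fun i _ => (hF (Option.some i)).mul ((hF none).iterate_sphereDeriv _))

theorem eventually_linearOp_eq_zero {n : ℕ} {a : Sphere} {φ : Fin n → RegularGermAt a}
    {χ : RegularGermAt a} {F : Fin n → Sphere → ℂ} {K : Sphere → ℂ}
    (hF : ∀ i, (φ i : (𝓝 a).Germ ℂ) = F i) (hK : (χ : (𝓝 a).Germ ℂ) = K)
    (h : derivGerm^[n] χ + ∑ i : Fin n, φ i * derivGerm^[n - (i + 1 : ℕ)] χ = 0) :
    ∀ᶠ z in 𝓝 a, linearOp n (fun o => o.elim K F) z = 0 := by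
  have op_eq : linearOp n (fun o => o.elim K F) =
      sphereDeriv^[n] K + ∑ i : Fin n, F i * sphereDeriv^[n - (i + 1 : ℕ)] K := by
    funext z
    simp [linearOp]
  refine Filter.Germ.coe_eq.1 ?_
  change Filter.Germ.coeRingHom (𝓝 a) (linearOp n _) = 0
  rw [op_eq, map_add, map_sum]
  simp only [map_mul, Filter.Germ.coe_coeRingHom, ← hF, ← iterate_derivGerm_coe hK]
  exact_mod_cast congrArg Subtype.val h

theorem isSGerm_of_linear_equation {n : ℕ} {a : Sphere} {φ : Fin n → RegularGermAt a}
    {χ : RegularGermAt a} (hφ : ∀ i, IsSGerm ⟨a, φ i⟩)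
    (h : derivGerm^[n] χ + ∑ i : Fin n, φ i * derivGerm^[n - (i + 1 : ℕ)] χ = 0) :
    IsSGerm ⟨a, χ⟩ := by
  choose F hF hφF using fun i => (φ i).2
  obtain rfl : φ = fun i => (germAt (F i) a (hF i)).2 := funext fun i => Subtype.ext (hφF i)
  obtain ⟨_, K, hK, rfl⟩ := χ
  refine isSGerm_of_locally_solvable_coe (Set.countable_iUnion hφ)
    (Set.subset_iUnion fun i => singularSet (germAt (F i) a (hF i)))
    (isLocalOperator_linearOp n) (fun _ _ => HolomorphicAt.linearOp) (fun G b _ hG => ?_) hK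
    (eventually_linearOp_eq_zero (fun _ => rfl) rfl h)
  obtain ⟨δ, hδ, hext⟩ := exists_ball_forall_linear_equation fun i =>
    holomorphicAt_coe_iff.1 (hG.holomorphicAt i)
  refine ⟨_, Metric.ball_mem_nhds b hδ, ?_⟩
  filter_upwards [Metric.ball_mem_nhds b hδ] with w hw L hL hLG
  refine hext w hw _ (holomorphicAt_coe_iff.1 hL) (hLG.mono fun u hu => ?_)
  simp only [← iterate_sphereDeriv_coe]
  exact hu

/-! ### Algebraic equations -/

section Algebra

open Polynomial

theorem exists_map_eq_C_mul (R : Type*) {K : Type*} [CommRing R] [IsDomain R] [Field K]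
    [Algebra R K] [IsFractionRing R K] (g : K[X]) :
    ∃ b : R, b ≠ 0 ∧ ∃ q : R[X], q.map (algebraMap R K) = C (algebraMap R K b) * g := by
  obtain ⟨b, hb, h⟩ := IsLocalization.integerNormalization_spec (nonZeroDivisors R) g
  refine ⟨b, nonZeroDivisors.ne_zero hb, _, h.trans ?_⟩
  rw [← Polynomial.smul_eq_C_mul, algebraMap_smul]

/-- Clear the denominators in the radical of `p` over the field of fractions. -/
theorem exists_separable_dvd_pow {R : Type*} [CommRing R] [IsDomain R] [CharZero R] {p : R[X]}
    (hp : p ≠ 0) : ∃ (q u v : R[X]) (r s : R) (m : ℕ), q ≠ 0 ∧ r ≠ 0 ∧ s ≠ 0 ∧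
      u * q + v * derivative q = C r ∧ p ∣ C s * q ^ m := by
  classical
  let f := algebraMap R (FractionRing R)
  have hf : Function.Injective f := IsFractionRing.injective R (FractionRing R)
  have : CharZero (FractionRing R) := charZero_of_injective_algebraMap hf
  set ρ := UniqueFactorizationMonoid.radical (p.map f) with hρ
  obtain ⟨u, v, bezout⟩ : ρ.Separable :=
    PerfectField.separable_iff_squarefree.2 UniqueFactorizationMonoid.squarefree_radical
  obtain ⟨m, t, ht⟩ := UniqueFactorizationMonoid.exists_dvd_radical_self_pow
    ((Polynomial.map_ne_zero_iff hf).2 hp)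
  rw [← hρ] at ht
  obtain ⟨b, hb, q, hq : q.map f = C (f b) * ρ⟩ := exists_map_eq_C_mul R ρ
  obtain ⟨c, hc, u', hu' : u'.map f = C (f c) * u⟩ := exists_map_eq_C_mul R u
  obtain ⟨d, hd, v', hv' : v'.map f = C (f d) * v⟩ := exists_map_eq_C_mul R v
  obtain ⟨s, hs, t', ht' : t'.map f = C (f s) * t⟩ := exists_map_eq_C_mul R t
  refine ⟨q, C d * u', C c * v', b * c * d, s, m, ?_, mul_ne_zero (mul_ne_zero hb hc) hd, hs,
    Polynomial.map_injective f hf ?_, C (b ^ m) * t', Polynomial.map_injective f hf ?_⟩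
  · rintro rfl
    rw [Polynomial.map_zero, eq_comm, mul_eq_zero, C_eq_zero, map_eq_zero_iff _ hf] at hq
    exact hq.elim hb UniqueFactorizationMonoid.radical_ne_zero
  · simp only [Polynomial.map_add, Polynomial.map_mul, Polynomial.map_C, ← derivative_map, hq, hu',
      hv', map_mul, derivative_C_mul]
    linear_combination (C (f b) * C (f c) * C (f d)) * bezout
  · simp only [Polynomial.map_mul, Polynomial.map_pow, Polynomial.map_C, hq, ht', map_pow, mul_pow,
      ht]
    ring

theorem separable_of_bezout_eq_C {K : Type*} [Field K] {q u v : K[X]} {r : K} (hr : r ≠ 0)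
    (h : u * q + v * derivative q = C r) : q.Separable := by
  refine ⟨C r⁻¹ * u, C r⁻¹ * v, ?_⟩
  rw [mul_assoc, mul_assoc, ← mul_add, h, ← C_mul, inv_mul_cancel₀ hr, C_1]

theorem isDomain_regularGermAt (a : Sphere) : IsDomain (RegularGermAt a) := by
  have : Nontrivial (RegularGermAt a) :=
    ((Filter.Germ.valueRingHom (x := a) (E := ℂ)).comp
      (RegularGermAt a).subtype).domain_nontrivial
  have : NoZeroDivisors (RegularGermAt a) := by
    refine ⟨fun {φ ψ} h => ?_⟩
    obtain ⟨_, F, hF, rfl⟩ := φ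
    obtain ⟨_, G, hG, rfl⟩ := ψ
    have hFG : ∀ᶠ z in 𝓝 a, F z * G z = 0 := Filter.Germ.coe_eq.1 (congrArg Subtype.val h)
    rcases hF.eventually_eq_zero_or with hF0 | hF0
    · exact Or.inl (Subtype.ext (Filter.Germ.coe_eq.2 hF0))
    rcases hG.eventually_eq_zero_or with hG0 | hG0
    · exact Or.inr (Subtype.ext (Filter.Germ.coe_eq.2 hG0))
    obtain ⟨z, hFz, hGz, hz⟩ :=
      (hF0.and (hG0.and (hFG.filter_mono nhdsWithin_le_nhds))).exists
    exact absurd hz (mul_ne_zero hFz hGz)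
  exact NoZeroDivisors.to_isDomain _

theorem charZero_regularGermAt (a : Sphere) : CharZero (RegularGermAt a) :=
  ((Filter.Germ.valueRingHom (x := a) (E := ℂ)).comp (RegularGermAt a).subtype).charZero

theorem eventually_ne_zero_of_ne_zero {a : Sphere} {φ : RegularGermAt a} (hφ : φ ≠ 0)
    {F : Sphere → ℂ} (hF : (φ : (𝓝 a).Germ ℂ) = F) : ∀ᶠ z in 𝓝[≠] a, F z ≠ 0 := by
  obtain ⟨_, G, hG, rfl⟩ := φ
  exact (hG.congr (Filter.Germ.coe_eq.1 hF)).eventually_eq_zero_or.resolve_left fun h =>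
    hφ (Subtype.ext (hF.trans (Filter.Germ.coe_eq.2 h)))

theorem exists_analyticAt_implicit {P : ℂ × ℂ → ℂ} {b c d : ℂ} (hP : AnalyticAt ℂ P (b, c))
    (hd : HasDerivAt (fun y => P (b, y)) d c) (hd0 : d ≠ 0) :
    ∃ ρ : ℂ → ℂ, AnalyticAt ℂ ρ b ∧ ρ b = c ∧ ∀ᶠ w in 𝓝 b, P (w, ρ w) = P (b, c) := by
  have hcd : ContDiffAt ℂ ⊤ P (b, c) := hP.contDiffAt
  have partial_eq : (fderiv ℂ P (b, c) ∘L .inr ℂ ℂ ℂ) 1 = d :=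
    (HasFDerivAt.comp (f := fun y : ℂ => (b, y)) c hP.differentiableAt.hasFDerivAt
      (hasFDerivAt_prodMk_right b c)).hasDerivAt.unique hd
  have hinv : (fderiv ℂ P (b, c) ∘L .inr ℂ ℂ ℂ).IsInvertible := by
    refine ⟨ContinuousLinearEquiv.unitsEquivAut ℂ (Units.mk0 d hd0), ?_⟩
    ext
    simp [partial_eq]
  exact ⟨hcd.implicitFunction (by simp) hinv,
    (hcd.contDiffAt_implicitFunction (by simp) hinv).analyticAt,
    hcd.implicitFunction_apply_self (by simp) hinv,
    hcd.eventually_apply_implicitFunction (by simp) hinv⟩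

/-- The polynomial at the parameter `z`, for a polynomial whose coefficients depend on `z`. -/
def specialize (z : Sphere) : (Sphere → ℂ)[X] →+* ℂ[X] :=
  Polynomial.mapRingHom (Pi.evalRingHom (fun _ => ℂ) z)

theorem coeff_specialize (z : Sphere) (P : (Sphere → ℂ)[X]) (i : ℕ) :
    (specialize z P).coeff i = P.coeff i z := by
  simp [specialize]

theorem eval_specialize (z : Sphere) (P : (Sphere → ℂ)[X]) (y : ℂ) :
    (specialize z P).eval y = ∑ i ∈ Finset.range (P.natDegree + 1), P.coeff i z * y ^ i := by
  have hdeg : (specialize z P).natDegree < P.natDegree + 1 :=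
    Nat.lt_succ_of_le natDegree_map_le
  simp only [eval_eq_sum_range' hdeg, coeff_specialize]

theorem specialize_C (z : Sphere) (F : Sphere → ℂ) : specialize z (C F) = C (F z) := by
  simp [specialize]

theorem natDegree_specialize {z : Sphere} {P : (Sphere → ℂ)[X]} (h : P.leadingCoeff z ≠ 0) :
    (specialize z P).natDegree = P.natDegree :=
  natDegree_map_of_leadingCoeff_ne_zero _ h

theorem specialize_derivative (z : Sphere) (P : (Sphere → ℂ)[X]) :
    specialize z (derivative P) = derivative (specialize z P) :=
  (derivative_map P _).symm

theorem eventually_specialize_eq {a : Sphere} {P Q : (Sphere → ℂ)[X]}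
    (h : P.map (Filter.Germ.coeRingHom (𝓝 a)) = Q.map (Filter.Germ.coeRingHom (𝓝 a))) :
    ∀ᶠ z in 𝓝 a, specialize z P = specialize z Q := by
  have coeff_eq : ∀ i, P.coeff i =ᶠ[𝓝 a] Q.coeff i := fun i =>
    Filter.Germ.coe_eq.1 <| by
      simpa only [coeff_map, Filter.Germ.coe_coeRingHom] using congrArg (fun p => p.coeff i) h
  filter_upwards [(Finset.eventually_all (Finset.range (max P.natDegree Q.natDegree + 1))).2
    fun i _ => coeff_eq i] with z hz
  ext i
  rw [coeff_specialize, coeff_specialize]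
  by_cases hi : i < max P.natDegree Q.natDegree + 1
  · exact hz i (Finset.mem_range.2 hi)
  · rw [coeff_eq_zero_of_natDegree_lt (by lia), coeff_eq_zero_of_natDegree_lt (by lia)]

theorem eventually_forall_holomorphicAt_coeff {a : Sphere} {P : (Sphere → ℂ)[X]}
    (hP : ∀ i, HolomorphicAt (P.coeff i) a) :
    ∀ᶠ z in 𝓝 a, ∀ i, HolomorphicAt (P.coeff i) z := by
  filter_upwards [(Finset.eventually_all P.support).2 fun i _ => (hP i).eventually] with z hz i
  by_cases hi : i ∈ P.support
  · exact hz i hi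
  · rw [notMem_support_iff.1 hi]
    exact HolomorphicAt.const 0

theorem exists_map_coeRingHom_eq {a : Sphere} (M : (RegularGermAt a)[X]) :
    ∃ P : (Sphere → ℂ)[X],
      P.map (Filter.Germ.coeRingHom (𝓝 a)) = M.map (RegularGermAt a).subtype ∧
      P.natDegree = M.natDegree ∧ ∀ i, HolomorphicAt (P.coeff i) a := by
  choose F hF hMF using fun i => (M.coeff i).2
  let P : (Sphere → ℂ)[X] := ∑ i ∈ Finset.range (M.natDegree + 1), C (F i) * X ^ i
  have map_eq : P.map (Filter.Germ.coeRingHom (𝓝 a)) = M.map (RegularGermAt a).subtype := by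
    conv_rhs => rw [M.as_sum_range_C_mul_X_pow]
    simp only [P, Polynomial.map_sum, Polynomial.map_mul, Polynomial.map_pow, Polynomial.map_C,
      Polynomial.map_X, Filter.Germ.coe_coeRingHom, Subring.coe_subtype, hMF]
  refine ⟨P, map_eq, le_antisymm ?_ ?_, fun i => ?_⟩
  · exact natDegree_sum_le_of_forall_le _ _ fun i hi =>
      (natDegree_C_mul_X_pow_le _ _).trans (Finset.mem_range_succ_iff.1 hi)
  · rw [← natDegree_map_eq_of_injective (RegularGermAt a).subtype_injective M, ← map_eq]
    exact natDegree_map_le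
  · simp only [P, finsetSum_coeff, coeff_C_mul_X_pow]
    by_cases hi : i ∈ Finset.range (M.natDegree + 1)
    · simpa only [Finset.sum_ite_eq, hi, if_true] using hF i
    · simp only [Finset.sum_ite_eq, hi, if_false]
      exact HolomorphicAt.const 0

theorem exists_holomorphicAt_root {Q : (Sphere → ℂ)[X]} {b : Sphere}
    (hQ : ∀ i, HolomorphicAt (Q.coeff i) b) {c : ℂ} (hc : (specialize b Q).IsRoot c)
    (hc' : (derivative (specialize b Q)).eval c ≠ 0) :
    ∃ ρ : Sphere → ℂ, HolomorphicAt ρ b ∧ ρ b = c ∧ ∀ᶠ z in 𝓝 b, (specialize z Q).IsRoot (ρ z) := by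
  have hP : AnalyticAt ℂ (fun w : ℂ × ℂ => (specialize (chart b w.1) Q).eval w.2) (0, c) := by
    simp only [eval_specialize]
    refine Finset.analyticAt_fun_sum _ fun i _ => AnalyticAt.fun_mul ?_ (analyticAt_snd.fun_pow i)
    have hcoeff : AnalyticAt ℂ (fun u => Q.coeff i (chart b u)) (0, c).1 :=
      holomorphicAt_iff_chart.1 (hQ i)
    exact AnalyticAt.fun_comp (f := Prod.fst) hcoeff analyticAt_fst
  obtain ⟨f, hf, hf0, hroot⟩ := exists_analyticAt_implicit hP
    (by simpa only [chart_zero] using (specialize b Q).hasDerivAt c) hc'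
  obtain ⟨ρ, hρ⟩ := exists_comp_chart b f
  refine ⟨ρ, holomorphicAt_iff_chart.2 (by simpa only [hρ] using hf), ?_, ?_⟩
  · rw [← hf0, ← hρ, chart_zero]
  · refine eventually_nhds_iff_chart.2 (hroot.mono fun w hw => ?_)
    rw [hρ, IsRoot.def, hw, chart_zero]
    exact hc

/-- Near `b` the roots of the polynomial `P` depending on a parameter are the values of finitely
many holomorphic functions; these need not be roots themselves. -/
def HasHolomorphicRoots (P : (Sphere → ℂ)[X]) (b : Sphere) : Prop :=
  ∃ s : Finset (Sphere → ℂ), (∀ ρ ∈ s, HolomorphicAt ρ b) ∧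
    ∀ᶠ z in 𝓝 b, ∀ y, (specialize z P).IsRoot y → ∃ ρ ∈ s, y = ρ z

theorem HasHolomorphicRoots.of_isRoot_imp {P Q : (Sphere → ℂ)[X]} {b : Sphere}
    (hQ : HasHolomorphicRoots Q b)
    (h : ∀ᶠ z in 𝓝 b, ∀ y, (specialize z P).IsRoot y → (specialize z Q).IsRoot y) :
    HasHolomorphicRoots P b := by
  obtain ⟨s, hs, hroots⟩ := hQ
  exact ⟨s, hs, (hroots.and h).mono fun z hz y hy => hz.1 y (hz.2 y hy)⟩

theorem exists_eq_of_isRoot_of_injOn {ι : Type*} {q : ℂ[X]} (hq : q ≠ 0) {s : Finset ι} {ρ : ι → ℂ}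
    (hρ : ∀ i ∈ s, q.IsRoot (ρ i)) (hinj : Set.InjOn ρ s) (hcard : q.natDegree ≤ s.card) {y : ℂ}
    (hy : q.IsRoot y) : ∃ i ∈ s, y = ρ i := by
  classical
  have hsub : s.image ρ ⊆ q.roots.toFinset := Finset.image_subset_iff.2 fun i hi => by
    rw [Multiset.mem_toFinset, mem_roots hq]
    exact hρ i hi
  have himage : s.image ρ = q.roots.toFinset := by
    refine Finset.eq_of_subset_of_card_le hsub ?_
    rw [Finset.card_image_of_injOn hinj]
    exact (Multiset.toFinset_card_le _).trans ((card_roots' q).trans hcard)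
  have hymem : y ∈ s.image ρ := by rwa [himage, Multiset.mem_toFinset, mem_roots hq]
  obtain ⟨i, hi, rfl⟩ := Finset.mem_image.1 hymem
  exact ⟨i, hi, rfl⟩

/-- The simple roots at `b` extend to holomorphic families of roots, and a polynomial of the same
degree has no further roots. -/
theorem hasHolomorphicRoots_of_separable {Q : (Sphere → ℂ)[X]} {b : Sphere}
    (hQ : ∀ i, HolomorphicAt (Q.coeff i) b) (hlead : Q.leadingCoeff b ≠ 0)
    (hsep : (specialize b Q).Separable) : HasHolomorphicRoots Q b := by
  classical
  have hlead' : ∀ᶠ z in 𝓝 b, Q.leadingCoeff z ≠ 0 :=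
    (hQ Q.natDegree).continuousAt.eventually_ne hlead
  have extend_root : ∀ c ∈ (specialize b Q).roots.toFinset, ∃ ρ : Sphere → ℂ, HolomorphicAt ρ b ∧
      ρ b = c ∧ ∀ᶠ z in 𝓝 b, (specialize z Q).IsRoot (ρ z) := fun c hc => by
    have hroot : (specialize b Q).IsRoot c := (mem_roots'.1 (Multiset.mem_toFinset.1 hc)).2
    exact exists_holomorphicAt_root hQ hroot (hsep.eval₂_derivative_ne_zero (RingHom.id ℂ) hroot)
  choose! ρ hρ hρb hρroot using extend_root
  set s := (specialize b Q).roots.toFinset with hs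
  have hcard : s.card = Q.natDegree := by
    rw [hs, Multiset.toFinset_card_of_nodup (nodup_roots hsep),
      IsAlgClosed.card_roots_eq_natDegree, natDegree_specialize hlead]
  have hne : ∀ᶠ z in 𝓝 b, ∀ c ∈ s, ∀ c' ∈ s, ρ c z = ρ c' z → c = c' := by
    refine (Finset.eventually_all s).2 fun c hc => (Finset.eventually_all s).2 fun c' hc' => ?_
    by_cases h : c = c'
    · exact Eventually.of_forall fun _ _ => h
    · have hb : ρ c b ≠ ρ c' b := by rwa [hρb c hc, hρb c' hc']
      exact ((hρ c hc).continuousAt.ne_iff_eventually_ne (hρ c' hc').continuousAt).1 hb |>.mono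
        fun z hz hz' => absurd hz' hz
  refine ⟨s.image ρ, Finset.forall_mem_image.2 hρ, ?_⟩
  filter_upwards [hlead', hne, (Finset.eventually_all s).2 hρroot] with z hz hinj hroot y hy
  have hQz : specialize z Q ≠ 0 := fun h => hz (by rw [leadingCoeff, ← coeff_specialize, h]; rfl)
  obtain ⟨c, hc, rfl⟩ := exists_eq_of_isRoot_of_injOn hQz hroot
    (fun c hc c' hc' => hinj c hc c' hc') ((natDegree_specialize hz).trans hcard.symm).le hy
  exact ⟨ρ c, Finset.mem_image_of_mem ρ hc, rfl⟩

/-- `p` has the same roots as a polynomial whose Bezout relation with its derivative survives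
specialization off a discrete set. -/
theorem eventually_hasHolomorphicRoots {a : Sphere} {P : (Sphere → ℂ)[X]}
    {p : (RegularGermAt a)[X]} (hp : p ≠ 0)
    (hP : P.map (Filter.Germ.coeRingHom (𝓝 a)) = p.map (RegularGermAt a).subtype) :
    ∀ᶠ z in 𝓝[≠] a, HasHolomorphicRoots P z := by
  have := isDomain_regularGermAt a
  have := charZero_regularGermAt a
  obtain ⟨q, u, v, r, s, m, hq, hr, hs, bezout, t, hpt⟩ := exists_separable_dvd_pow hp
  obtain ⟨Q, hQq, hdeg, hQ⟩ := exists_map_coeRingHom_eq q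
  obtain ⟨U, hU, -⟩ := exists_map_coeRingHom_eq u
  obtain ⟨V, hV, -⟩ := exists_map_coeRingHom_eq v
  obtain ⟨T, hT, -⟩ := exists_map_coeRingHom_eq t
  obtain ⟨R, -, hR⟩ := r.2
  obtain ⟨S, -, hS⟩ := s.2
  have hlead : ∀ᶠ z in 𝓝[≠] a, Q.leadingCoeff z ≠ 0 := by
    refine eventually_ne_zero_of_ne_zero (leadingCoeff_ne_zero.2 hq) ?_
    rw [leadingCoeff, leadingCoeff, hdeg]
    simpa using congrArg (fun p => p.coeff q.natDegree) hQq.symm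
  have bezout_near : ∀ᶠ z in 𝓝 a,
      specialize z (U * Q + V * derivative Q) = specialize z (C R) := by
    refine eventually_specialize_eq ?_
    simpa [hQq, hU, hV, hR, ← derivative_map] using
      congrArg (Polynomial.map (RegularGermAt a).subtype) bezout
  have dvd_near : ∀ᶠ z in 𝓝 a, specialize z (C S * Q ^ m) = specialize z (P * T) := by
    refine eventually_specialize_eq ?_
    simpa [hQq, hP, hT, hS] using congrArg (Polynomial.map (RegularGermAt a).subtype) hpt
  filter_upwards [hlead, eventually_ne_zero_of_ne_zero hr hR,
    nhdsWithin_le_nhds (eventually_forall_holomorphicAt_coeff hQ), nhdsWithin_le_nhds bezout_near,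
    eventually_nhdsNE_eventually_nhds_iff.2
      ((eventually_ne_zero_of_ne_zero hs hS).and (nhdsWithin_le_nhds dvd_near))]
    with z hlead hRz hQz bezout hnear
  rw [map_add, map_mul, map_mul, specialize_derivative, specialize_C] at bezout
  refine (hasHolomorphicRoots_of_separable hQz hlead
    (separable_of_bezout_eq_C hRz bezout)).of_isRoot_imp ?_
  filter_upwards [hnear] with w ⟨hSw, hw⟩ y hy
  have hroot := congrArg (eval y) hw
  rw [map_mul, map_mul, map_pow, specialize_C, eval_mul, eval_mul, eval_pow, eval_C, hy.eq_zero,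
    zero_mul] at hroot
  exact eq_zero_of_pow_eq_zero ((mul_eq_zero.1 hroot).resolve_left hSw)

/-- The monic polynomial `X ^ n + g 0 * X ^ (n - 1) + ⋯ + g (n - 1)`. -/
def monicPolynomial {R : Type*} [CommRing R] {n : ℕ} (g : Fin n → R) : R[X] :=
  X ^ n + ∑ i : Fin n, C (g i) * X ^ (n - (i + 1 : ℕ))

theorem monicPolynomial_ne_zero {R : Type*} [CommRing R] [Nontrivial R] {n : ℕ} (g : Fin n → R) :
    monicPolynomial g ≠ 0 := by
  refine (monic_X_pow_add ((degree_sum_le _ _).trans_lt ?_)).ne_zero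
  refine (Finset.sup_lt_iff (WithBot.bot_lt_coe n)).2 fun i _ => ?_
  refine (degree_C_mul_X_pow_le _ _).trans_lt ?_
  exact Nat.cast_lt.2 (by lia)

theorem map_monicPolynomial {R S : Type*} [CommRing R] [CommRing S] {n : ℕ} (f : R →+* S)
    (g : Fin n → R) : (monicPolynomial g).map f = monicPolynomial fun i => f (g i) := by
  simp [monicPolynomial, Polynomial.map_sum]

theorem eval_monicPolynomial {R : Type*} [CommRing R] {n : ℕ} (g : Fin n → R) (y : R) :
    (monicPolynomial g).eval y = y ^ n + ∑ i : Fin n, g i * y ^ (n - (i + 1 : ℕ)) := by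
  simp [monicPolynomial, eval_finsetSum]

theorem isLocalProperty_not_hasHolomorphicRoots (n : ℕ) :
    IsLocalProperty fun (G : Fin n → Sphere → ℂ) z =>
      ¬ HasHolomorphicRoots (monicPolynomial G) z := by
  refine fun F G z hFG hF hG => hF (hG.of_isRoot_imp ?_)
  have map_eq : (monicPolynomial F).map (Filter.Germ.coeRingHom (𝓝 z)) =
      (monicPolynomial G).map (Filter.Germ.coeRingHom (𝓝 z)) := by
    rw [map_monicPolynomial, map_monicPolynomial]
    exact congrArg monicPolynomial (funext fun i => Filter.Germ.coe_eq.2 (hFG i))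
  filter_upwards [eventually_specialize_eq map_eq] with w hw y hy
  rwa [← hw]

theorem eventually_hasHolomorphicRoots_monicPolynomial {n : ℕ} {G : Fin n → Sphere → ℂ}
    {b : Sphere} (hG : ∀ i, HolomorphicAt (G i) b) :
    ∀ᶠ z in 𝓝[≠] b, HasHolomorphicRoots (monicPolynomial G) z := by
  have := isDomain_regularGermAt b
  let g : Fin n → RegularGermAt b := fun i => (germAt (G i) b (hG i)).2
  refine eventually_hasHolomorphicRoots (monicPolynomial_ne_zero g) ?_
  rw [map_monicPolynomial, map_monicPolynomial]
  rfl

/-- The left-hand side of `f ^ n + f₁ f ^ (n - 1) + ⋯ + fₙ = 0`; the unknown `f` is `F none`. -/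
def algebraicOp (n : ℕ) (F : Option (Fin n) → Sphere → ℂ) : Sphere → ℂ :=
  (monicPolynomial fun i => F (Option.some i)).eval (F none)

theorem algebraicOp_apply {n : ℕ} (F : Option (Fin n) → Sphere → ℂ) (z : Sphere) :
    algebraicOp n F z =
      (specialize z (monicPolynomial fun i => F (Option.some i))).eval (F none z) := by
  simp [algebraicOp, specialize, map_monicPolynomial, eval_monicPolynomial]

theorem isLocalOperator_algebraicOp (n : ℕ) : IsLocalOperator (algebraicOp n) := by
  intro F G z hFG
  filter_upwards [eventually_all.2 hFG] with w hw
  simp [algebraicOp, eval_monicPolynomial, hw]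

theorem HolomorphicAt.algebraicOp {n : ℕ} {F : Option (Fin n) → Sphere → ℂ} {z : Sphere}
    (hF : ∀ i, HolomorphicAt (F i) z) : HolomorphicAt (SFun.algebraicOp n F) z := by
  rw [SFun.algebraicOp, eval_monicPolynomial]
  have h := ((hF none).pow n).add (HolomorphicAt.sum fun i (_ : i ∈ Finset.univ) =>
    (hF (Option.some i)).mul ((hF none).pow (n - (i + 1 : ℕ))))
  refine h.congr (Eventually.of_forall fun w => ?_)
  simp

theorem eventually_algebraicOp_eq_zero {n : ℕ} {a : Sphere} {φ : Fin n → RegularGermAt a}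
    {χ : RegularGermAt a} {F : Fin n → Sphere → ℂ} {K : Sphere → ℂ}
    (hF : ∀ i, (φ i : (𝓝 a).Germ ℂ) = F i) (hK : (χ : (𝓝 a).Germ ℂ) = K)
    (h : χ ^ n + ∑ i : Fin n, φ i * χ ^ (n - (i + 1 : ℕ)) = 0) :
    ∀ᶠ z in 𝓝 a, algebraicOp n (fun o => o.elim K F) z = 0 := by
  refine Filter.Germ.coe_eq.1 ?_
  change Filter.Germ.coeRingHom (𝓝 a) (algebraicOp n _) = 0
  rw [algebraicOp, eval_monicPolynomial, map_add, map_sum]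
  simp only [map_mul, map_pow, Filter.Germ.coe_coeRingHom, Option.elim, ← hF, ← hK]
  exact_mod_cast congrArg Subtype.val h

theorem exists_eventuallyEq_of_eventually_mem {s : Finset (Sphere → ℂ)} {w : Sphere}
    {L : Sphere → ℂ} (hs : ∀ ρ ∈ s, HolomorphicAt ρ w) (hL : HolomorphicAt L w)
    (h : ∀ᶠ u in 𝓝 w, ∃ ρ ∈ s, L u = ρ u) : ∃ ρ ∈ s, L =ᶠ[𝓝 w] ρ := by
  by_contra! hcon
  have hne : ∀ᶠ u in 𝓝[≠] w, ∀ ρ ∈ s, L u - ρ u ≠ 0 :=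
    (Finset.eventually_all s).2 fun ρ hρ => ((hL.sub (hs ρ hρ)).eventually_eq_zero_or).resolve_left
      fun h0 => hcon ρ hρ (h0.mono fun u hu => sub_eq_zero.1 hu)
  obtain ⟨u, hu, ρ, hρ, hLρ⟩ := (hne.and (nhdsWithin_le_nhds h)).exists
  exact hu ρ hρ (sub_eq_zero.2 hLρ)

/-- Off a countable set the roots are locally branches of finitely many holomorphic functions. -/
theorem isSGerm_of_algebraic_equation {n : ℕ} {a : Sphere} {φ : Fin n → RegularGermAt a}
    {χ : RegularGermAt a} (hφ : ∀ i, IsSGerm ⟨a, φ i⟩)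
    (h : χ ^ n + ∑ i : Fin n, φ i * χ ^ (n - (i + 1 : ℕ)) = 0) : IsSGerm ⟨a, χ⟩ := by
  choose F hF hφF using fun i => (φ i).2
  obtain rfl : φ = fun i => (germAt (F i) a (hF i)).2 := funext fun i => Subtype.ext (hφF i)
  obtain ⟨_, K, hK, rfl⟩ := χ
  have hB : {z | ∃ G, IsJointBranch hF G z ∧
      ¬ HasHolomorphicRoots (monicPolynomial G) z}.Countable :=
    countable_setOf_isJointBranch (isLocalProperty_not_hasHolomorphicRoots n) fun G z hG =>
      (eventually_hasHolomorphicRoots_monicPolynomial hG.holomorphicAt).mono fun _ => not_not.2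
  refine isSGerm_of_locally_solvable ((Set.countable_iUnion hφ).union hB)
    (fun i => (Set.subset_iUnion (fun i => singularSet (germAt (F i) a (hF i))) i).trans
      Set.subset_union_left)
    (isLocalOperator_algebraicOp n) (fun _ _ => HolomorphicAt.algebraicOp) (fun G b hb hG => ?_) hK
    (eventually_algebraicOp_eq_zero (fun _ => rfl) rfl h)
  obtain ⟨s, hs, hroots⟩ : HasHolomorphicRoots (monicPolynomial G) b :=
    not_not.1 fun hG' => hb (Or.inr ⟨G, hG, hG'⟩)
  have hV := (Finset.eventually_all s).2 fun ρ hρ => (hs ρ hρ).eventually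
  refine ⟨_, hV, ?_⟩
  filter_upwards [hV, hroots.eventually_nhds] with w hw hrootsw L hL hLG
  obtain ⟨ρ, hρ, hLρ⟩ := exists_eventuallyEq_of_eventually_mem hw hL <| by
    filter_upwards [hrootsw, hLG] with u hu hLu
    rw [algebraicOp_apply] at hLu
    exact hu _ hLu
  exact ⟨ρ, hLρ, fun u hu => hu ρ hρ⟩

end Algebra

/-! ### Superposition operators and circle averages depending on parameters -/

section Superposition

variable {K X : Type*} [TopologicalSpace K] [CompactSpace K] [NormedAddCommGroup X]
  [NormedSpace ℂ X]

/-- The power series of the superposition operator `u ↦ H ∘ u` on continuous functions, where `p`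
is a power series of `H`. -/
def superpositionSeries (K : Type*) [TopologicalSpace K] [CompactSpace K]
    (p : FormalMultilinearSeries ℂ X ℂ) : FormalMultilinearSeries ℂ C(K, X) C(K, ℂ) := fun k =>
  MultilinearMap.mkContinuous
    { toFun := fun u => ⟨fun s => p k fun i => u i s, by fun_prop⟩
      map_update_add' := fun u i x y => by
        ext s
        simp [Function.apply_update (fun _ (w : C(K, X)) => w s)]
      map_update_smul' := fun u i c x => by
        ext s
        simp [Function.apply_update (fun _ (w : C(K, X)) => w s)] } ‖p k‖ fun u =>
    (ContinuousMap.norm_le _ (by positivity)).2 fun s =>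
      ((p k).le_opNorm _).trans <| by
        gcongr with i _
        exact (u i).norm_coe_le_norm s

theorem radius_le_superpositionSeries (p : FormalMultilinearSeries ℂ X ℂ) :
    p.radius ≤ (superpositionSeries K p).radius :=
  FormalMultilinearSeries.radius_le_of_le fun _ =>
    MultilinearMap.mkContinuous_norm_le _ (norm_nonneg _) _

theorem exists_analyticAt_superposition (K : Type*) [TopologicalSpace K] [CompactSpace K]
    {H : X → ℂ} {p : FormalMultilinearSeries ℂ X ℂ} {c : X} {R : ℝ}
    (hH : HasFPowerSeriesOnBall H p c (ENNReal.ofReal R)) :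
    ∃ S : C(K, X) → C(K, ℂ), ∀ u : C(K, X), (∀ s, u s ∈ Metric.ball c R) →
      AnalyticAt ℂ S u ∧ ∀ s, S u s = H (u s) := by
  have hrad := hH.r_le.trans (radius_le_superpositionSeries (K := K) p)
  have hseries := (superpositionSeries K p).hasFPowerSeriesOnBall (hH.r_pos.trans_le hrad)
  refine ⟨fun u => (superpositionSeries K p).sum (u - ContinuousMap.const K c), fun u hu => ?_⟩
  have hu_mem : u - ContinuousMap.const K c ∈
      Metric.eball 0 (superpositionSeries K p).radius := by
    refine Metric.eball_subset_eball hrad ?_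
    rw [Metric.eball_ofReal, mem_ball_zero_iff,
      ContinuousMap.norm_lt_iff _ (ENNReal.ofReal_pos.1 hH.r_pos)]
    exact fun s => mem_ball_iff_norm.1 (hu s)
  refine ⟨(hseries.analyticAt_of_mem hu_mem).comp_of_eq
    (analyticAt_id.sub analyticAt_const) rfl, fun s => ?_⟩
  have hasSum_sum := (hseries.hasSum hu_mem).mapL (ContinuousMap.evalCLM ℂ s)
  have hasSum_H := hH.hasSum (y := u s - c) <| by
    rw [Metric.eball_ofReal, mem_ball_zero_iff]
    exact mem_ball_iff_norm.1 (hu s)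
  rw [zero_add] at hasSum_sum
  rw [add_sub_cancel] at hasSum_H
  exact hasSum_sum.unique hasSum_H

theorem exists_analyticAt_superposition_div (K : Type*) [TopologicalSpace K] [CompactSpace K]
    {G H : X → ℂ} {p q : FormalMultilinearSeries ℂ X ℂ} {c : X} {R : ℝ}
    (hG : HasFPowerSeriesOnBall G p c (ENNReal.ofReal R))
    (hH : HasFPowerSeriesOnBall H q c (ENNReal.ofReal R)) :
    ∃ S : C(K, X) → C(K, ℂ), ∀ u : C(K, X), (∀ s, u s ∈ Metric.ball c R ∧ H (u s) ≠ 0) →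
      AnalyticAt ℂ S u ∧ ∀ s, S u s = G (u s) / H (u s) := by
  obtain ⟨SG, hSG⟩ := exists_analyticAt_superposition K hG
  obtain ⟨SH, hSH⟩ := exists_analyticAt_superposition K hH
  refine ⟨fun u => SG u * Ring.inverse (SH u), fun u hu => ?_⟩
  obtain ⟨hSGu, eq_G⟩ := hSG u fun s => (hu s).1
  obtain ⟨hSHu, eq_H⟩ := hSH u fun s => (hu s).1
  obtain ⟨U, hU⟩ : IsUnit (SH u) :=
    (ContinuousMap.isUnit_iff_forall_ne_zero _).2 fun s => by rw [eq_H]; exact (hu s).2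
  refine ⟨hSGu.mul ((hU ▸ analyticAt_inverse U).comp_of_eq hSHu rfl), fun s => ?_⟩
  have inverse_mul := DFunLike.congr_fun (Ring.mul_inverse_cancel _ ⟨U, hU⟩) s
  rw [ContinuousMap.mul_apply, eq_H, ContinuousMap.one_apply] at inverse_mul
  rw [ContinuousMap.mul_apply, eq_G, div_eq_mul_inv, eq_inv_of_mul_eq_one_right inverse_mul]

open MeasureTheory in
theorem exists_intervalIntegralCLM {a b : ℝ} (hab : a ≤ b) :
    ∃ L : C(Set.Icc a b, ℂ) →L[ℂ] ℂ, ∀ (φ : C(Set.Icc a b, ℂ)) (g : ℝ → ℂ),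
      (∀ θ, φ θ = g θ) → L φ = ∫ θ in a..b, g θ := by
  let μ : Measure (Set.Icc a b) := volume.comap Subtype.val
  have : IsFiniteMeasure μ := by
    refine ⟨?_⟩
    rw [(MeasurableEmbedding.subtype_coe measurableSet_Icc).comap_apply]
    exact (measure_mono (Set.image_subset_iff.2 fun x _ => x.2)).trans_lt
      (measure_Icc_lt_top (a := a) (b := b))
  refine ⟨(L1.integralCLM' ℂ).comp (ContinuousMap.toLp 1 μ ℂ), fun φ g hφ => ?_⟩
  rw [ContinuousLinearMap.comp_apply, ← L1.integral_eq', L1.integral_eq_integral,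
    integral_congr_ae (ContinuousMap.coeFn_toLp μ φ),
    intervalIntegral.integral_of_le hab, ← integral_Icc_eq_integral_Ioc,
    ← integral_subtype_comap measurableSet_Icc]
  exact integral_congr_ae (Eventually.of_forall hφ)

/-- The circle with centre `y` and radius `r` in the complex direction `v`, as a function of the
angle; continuous functions of the angle form a Banach space in which it depends analytically
on `y`. -/
def translatedCircle (r : ℝ) (v y : X) : C(Set.Icc (0 : ℝ) (2 * Real.pi), X) :=
  ⟨fun θ => y + circleMap 0 r θ • v, by fun_prop⟩

theorem analyticAt_translatedCircle (r : ℝ) (v y : X) :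
    AnalyticAt ℂ (translatedCircle r v) y :=
  ((ContinuousLinearMap.const ℂ (Set.Icc (0 : ℝ) (2 * Real.pi))).analyticAt y).add
    (analyticAt_const (v := translatedCircle r v 0)) |>.congr <| Eventually.of_forall fun y => by
      ext θ
      simp [translatedCircle]

theorem isOpen_setOf_mem_ball_and_ne_zero {H : X → ℂ} {p : FormalMultilinearSeries ℂ X ℂ} {c : X}
    {R : ℝ} (hH : HasFPowerSeriesOnBall H p c (ENNReal.ofReal R)) :
    IsOpen {x | x ∈ Metric.ball c R ∧ H x ≠ 0} := by
  simp only [← Metric.eball_ofReal]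
  exact hH.continuousOn.isOpen_inter_preimage Metric.isOpen_eball isOpen_ne

theorem analyticAt_circleAverage_div {G H : X → ℂ} {p q : FormalMultilinearSeries ℂ X ℂ} {c : X}
    {R r : ℝ} (hG : HasFPowerSeriesOnBall G p c (ENNReal.ofReal R))
    (hH : HasFPowerSeriesOnBall H q c (ENNReal.ofReal R)) {v y₀ : X}
    (hy₀ : ∀ s ∈ Metric.sphere (0 : ℂ) |r|, y₀ + s • v ∈ Metric.ball c R ∧ H (y₀ + s • v) ≠ 0) :
    AnalyticAt ℂ (fun y => Real.circleAverage (fun s => G (y + s • v) / H (y + s • v)) 0 r) y₀ := by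
  obtain ⟨L, hL⟩ := exists_intervalIntegralCLM Real.two_pi_pos.le
  obtain ⟨S, hS⟩ := exists_analyticAt_superposition_div (Set.Icc (0 : ℝ) (2 * Real.pi)) hG hH
  have hcircle := analyticAt_translatedCircle r v y₀
  set U : Set X := {x | x ∈ Metric.ball c R ∧ H x ≠ 0}
  have isOpen_mapsTo := ContinuousMap.isOpen_setOfPred_mapsTo
    (isCompact_univ (X := Set.Icc (0 : ℝ) (2 * Real.pi)))
    (isOpen_setOf_mem_ball_and_ne_zero hH)
  have mapsTo : ∀ᶠ y in 𝓝 y₀, Set.MapsTo (translatedCircle r v y) Set.univ U :=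
    hcircle.continuousAt.eventually <| isOpen_mapsTo.mem_nhds fun θ _ =>
      hy₀ _ (circleMap_mem_sphere' 0 r θ)
  have analytic_average : AnalyticAt ℂ (fun y => (((2 * Real.pi)⁻¹ : ℝ) : ℂ) *
      L (S (translatedCircle r v y))) y₀ :=
    analyticAt_const.mul ((L.analyticAt _).comp_of_eq
      ((hS _ fun θ => mapsTo.self_of_nhds (Set.mem_univ θ)).1.comp_of_eq hcircle rfl) rfl)
  refine analytic_average.congr (mapsTo.mono fun y hy => ?_)
  beta_reduce
  rw [Real.circleAverage_def, Complex.real_smul, hL _ (fun θ => G (y + circleMap 0 r θ • v) /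
    H (y + circleMap 0 r θ • v)) fun θ => (hS _ fun θ => hy (Set.mem_univ θ)).2 θ]

end Superposition

/-! ### The domain of a meromorphic function of several variables -/

section AnalyticNormed

variable {X : Type*} [NormedAddCommGroup X] [NormedSpace ℂ X]

theorem eventually_not_eventually_eq_zero {H : X → ℂ} {p : X} (hH : AnalyticAt ℂ H p)
    (h : ¬ ∀ᶠ x in 𝓝 p, H x = 0) : ∀ᶠ x in 𝓝 p, ¬ ∀ᶠ y in 𝓝 x, H y = 0 := by
  obtain ⟨r, hr, hball⟩ := Metric.eventually_nhds_iff_ball.1 hH.eventually_analyticAt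
  filter_upwards [Metric.ball_mem_nhds p hr] with x hx hx0
  exact h <| mem_of_superset (Metric.ball_mem_nhds p hr) <|
    AnalyticOnNhd.eqOn_zero_of_preconnected_of_eventuallyEq_zero hball
      (convex_ball p r).isPreconnected hx hx0

theorem frequently_ne_zero_and {H₁ H₂ : X → ℂ} {p : X} (h₁ : AnalyticAt ℂ H₁ p)
    (h₂ : AnalyticAt ℂ H₂ p) (hne₁ : ¬ ∀ᶠ x in 𝓝 p, H₁ x = 0) (hne₂ : ¬ ∀ᶠ x in 𝓝 p, H₂ x = 0) :
    ∃ᶠ x in 𝓝 p, H₁ x ≠ 0 ∧ H₂ x ≠ 0 := by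
  intro hzero
  refine hne₁ ?_
  filter_upwards [eventually_not_eventually_eq_zero h₂ hne₂, h₁.eventually_analyticAt,
    eventually_eventually_nhds.2 hzero] with x hx₂ hx₁ hx
  by_contra hne
  refine hx₂ ?_
  filter_upwards [hx₁.continuousAt.eventually_ne hne, hx] with y hy₁ hy
  exact not_not.1 fun hy₂ => hy ⟨hy₁, hy₂⟩

theorem differentiableAt_comp_line {H : X → ℂ} {y v : X} {s : ℂ}
    (hH : AnalyticAt ℂ H (y + s • v)) : DifferentiableAt ℂ (fun t : ℂ => H (y + t • v)) s :=
  hH.differentiableAt.fun_comp' s (by fun_prop)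

theorem eventually_forall_add_smul_mem {S : Set ℂ} (hS : IsCompact S) {U : Set X} (hU : IsOpen U)
    {v y₀ : X} (h : ∀ s ∈ S, y₀ + s • v ∈ U) : ∀ᶠ y in 𝓝 y₀, ∀ s ∈ S, y + s • v ∈ U :=
  hS.eventually_forall_of_forall_eventually fun s hs =>
    have hcont : ContinuousAt (fun z : X × ℂ => z.1 + z.2 • v) (y₀, s) := by fun_prop
    hcont.eventually (hU.mem_nhds (h s hs))

end AnalyticNormed

theorem eq_of_frequently {X : Type*} [TopologicalSpace X] {f g : X → ℂ} {p : X}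
    (hf : ContinuousAt f p) (hg : ContinuousAt g p) (h : ∃ᶠ x in 𝓝 p, f x = g x) : f p = g p := by
  by_contra hne
  exact h <| ((hf.sub hg).eventually_ne (sub_ne_zero.2 hne)).mono fun _ => sub_ne_zero.1

section Meromorphic

variable {n : ℕ} {F G H : (Fin n → ℂ) → ℂ} {p : Fin n → ℂ} {c d : ℂ}

theorem HasMeromorphicValue.mul_eq (h : HasMeromorphicValue F p c) (hG : AnalyticAt ℂ G p)
    (hH : AnalyticAt ℂ H p) (hne : ¬ ∀ᶠ x in 𝓝 p, H x = 0)
    (hF : ∀ᶠ x in 𝓝 p, H x ≠ 0 → F x = G x / H x) : c * H p = G p := by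
  obtain ⟨G₀, H₀, hG₀, hH₀, hne₀, hF₀, rfl⟩ := h
  refine eq_of_frequently (f := fun x => G₀ x * H x) (hG₀.continuousAt.mul hH.continuousAt)
    hG.continuousAt ?_
  refine ((frequently_ne_zero_and hH₀ hH hne₀ hne).and_eventually (hF₀.and hF)).mono ?_
  rintro x ⟨⟨hx₀, hx⟩, eq_G₀, eq_div⟩
  rw [← eq_G₀ hx₀, eq_div hx, div_mul_cancel₀ _ hx]

theorem HasMeromorphicValue.unique (hc : HasMeromorphicValue F p c)
    (hd : HasMeromorphicValue F p d) : c = d := by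
  obtain ⟨G₁, H₁, hG₁, hH₁, hne₁, hF₁, rfl⟩ := hc
  obtain ⟨G₂, H₂, hG₂, hH₂, hne₂, hF₂, rfl⟩ := hd
  refine eq_of_frequently hG₁.continuousAt hG₂.continuousAt ?_
  refine ((frequently_ne_zero_and hH₁ hH₂ hne₁ hne₂).and_eventually (hF₁.and hF₂)).mono ?_
  rintro x ⟨⟨hx₁, hx₂⟩, eq_G₁, eq_G₂⟩
  rw [← eq_G₁ hx₁, eq_G₂ hx₂]

/-- The set of points where a meromorphic function is holomorphic. -/
def regularSet (F : (Fin n → ℂ) → ℂ) : Set (Fin n → ℂ) := {p | ∃ c, HasMeromorphicValue F p c}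

open Classical in
/-- The value of a meromorphic function at a point where it is holomorphic; the junk value is `0`
elsewhere. -/
def meromorphicValue (F : (Fin n → ℂ) → ℂ) (p : Fin n → ℂ) : ℂ :=
  if h : ∃ c, HasMeromorphicValue F p c then h.choose else 0

theorem hasMeromorphicValue_meromorphicValue (h : p ∈ regularSet F) :
    HasMeromorphicValue F p (meromorphicValue F p) := by
  have hc : ∃ c, HasMeromorphicValue F p c := h
  rw [meromorphicValue, dif_pos hc]
  exact hc.choose_spec

theorem HasMeromorphicValue.meromorphicValue_eq (h : HasMeromorphicValue F p c) :
    meromorphicValue F p = c :=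
  (hasMeromorphicValue_meromorphicValue ⟨c, h⟩).unique h

theorem HasMeromorphicValue.exists_analyticAt (h : HasMeromorphicValue F p c) :
    ∃ G, AnalyticAt ℂ G p ∧ ∀ᶠ x in 𝓝 p, HasMeromorphicValue F x (G x) := by
  obtain ⟨G, H, hG, hH, hne, hF, rfl⟩ := h
  refine ⟨G, hG, ?_⟩
  filter_upwards [hG.eventually_analyticAt, hH.eventually_analyticAt,
    eventually_not_eventually_eq_zero hH hne, eventually_eventually_nhds.2 hF]
    with x hGx hHx hnex hFx
  exact ⟨G, H, hGx, hHx, hnex, hFx, rfl⟩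

theorem isOpen_regularSet : IsOpen (regularSet F) := by
  refine isOpen_iff_mem_nhds.2 fun p ⟨c, h⟩ => ?_
  obtain ⟨G, -, hG⟩ := h.exists_analyticAt
  exact hG.mono fun x hx => ⟨_, hx⟩

theorem analyticAt_meromorphicValue (h : p ∈ regularSet F) :
    AnalyticAt ℂ (meromorphicValue F) p := by
  obtain ⟨c, h⟩ := h
  obtain ⟨G, hG, hFG⟩ := h.exists_analyticAt
  exact hG.congr (hFG.mono fun x hx => hx.meromorphicValue_eq.symm)

theorem hasMeromorphicValue_div (hG : AnalyticAt ℂ G p) (hH : AnalyticAt ℂ H p)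
    (hF : ∀ᶠ x in 𝓝 p, H x ≠ 0 → F x = G x / H x) (h : H p ≠ 0) :
    HasMeromorphicValue F p (G p / H p) :=
  ⟨fun x => G x / H x, H, hG.div hH h, hH, fun hzero => h hzero.self_of_nhds, hF, rfl⟩

end Meromorphic

/-! ### A criterion of holomorphy -/

section Quotient

theorem eventually_ofReal_le {r : ENNReal} (hr : 0 < r) :
    ∀ᶠ R in 𝓝[>] (0 : ℝ), ENNReal.ofReal R ≤ r :=
  nhdsWithin_le_nhds <| (ENNReal.continuous_ofReal.tendsto 0).eventually_le_const <| by
    rwa [ENNReal.ofReal_zero]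

variable {n : ℕ} {F G H : (Fin n → ℂ) → ℂ} {c x v y y₀ : Fin n → ℂ} {r R : ℝ}

/-- On the ball of centre `c` and radius `R` the functions `G` and `H` are sums of power series,
and the meromorphic function represented by `F` is their quotient. -/
structure IsQuotientOnBall (F G H : (Fin n → ℂ) → ℂ) (c : Fin n → ℂ) (R : ℝ) : Prop where
  exists_num : ∃ p : FormalMultilinearSeries ℂ (Fin n → ℂ) ℂ,
    HasFPowerSeriesOnBall G p c (ENNReal.ofReal R)
  exists_den : ∃ p : FormalMultilinearSeries ℂ (Fin n → ℂ) ℂ,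
    HasFPowerSeriesOnBall H p c (ENNReal.ofReal R)
  eq_div : ∀ x ∈ Metric.ball c R, H x ≠ 0 → F x = G x / H x

theorem exists_isQuotientOnBall (hG : AnalyticAt ℂ G c) (hH : AnalyticAt ℂ H c)
    (hF : ∀ᶠ x in 𝓝 c, H x ≠ 0 → F x = G x / H x) : ∃ R > 0, IsQuotientOnBall F G H c R := by
  obtain ⟨p, r₁, hG⟩ := hG
  obtain ⟨q, r₂, hH⟩ := hH
  have hball : ∀ᶠ R in 𝓝[>] (0 : ℝ), Metric.closedBall c R ⊆ {x | H x ≠ 0 → F x = G x / H x} :=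
    nhdsWithin_le_nhds (eventually_closedBall_subset hF)
  obtain ⟨R, hR₁, hR₂, hRF, hR⟩ := ((eventually_ofReal_le hG.r_pos).and
    ((eventually_ofReal_le hH.r_pos).and (hball.and self_mem_nhdsWithin))).exists
  exact ⟨R, hR, ⟨p, hG.mono (ENNReal.ofReal_pos.2 hR) hR₁⟩,
    ⟨q, hH.mono (ENNReal.ofReal_pos.2 hR) hR₂⟩,
    fun x hx => hRF (Metric.ball_subset_closedBall hx)⟩

namespace IsQuotientOnBall

theorem analyticAt_num (h : IsQuotientOnBall F G H c R) (hx : x ∈ Metric.ball c R) :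
    AnalyticAt ℂ G x := by
  obtain ⟨p, hp⟩ := h.exists_num
  exact hp.analyticAt_of_mem (by rwa [Metric.eball_ofReal])

theorem analyticAt_den (h : IsQuotientOnBall F G H c R) (hx : x ∈ Metric.ball c R) :
    AnalyticAt ℂ H x := by
  obtain ⟨p, hp⟩ := h.exists_den
  exact hp.analyticAt_of_mem (by rwa [Metric.eball_ofReal])

theorem eventually_eq_div (h : IsQuotientOnBall F G H c R) (hx : x ∈ Metric.ball c R) :
    ∀ᶠ y in 𝓝 x, H y ≠ 0 → F y = G y / H y :=
  mem_of_superset (Metric.isOpen_ball.mem_nhds hx) h.eq_div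

theorem not_eventually_den_eq_zero (h : IsQuotientOnBall F G H c R) (hx : x ∈ Metric.ball c R)
    (hxH : H x ≠ 0) (hy : y ∈ Metric.ball c R) : ¬ ∀ᶠ z in 𝓝 y, H z = 0 := fun hzero =>
  hxH <| AnalyticOnNhd.eqOn_zero_of_preconnected_of_eventuallyEq_zero
    (fun _ => h.analyticAt_den) (convex_ball c R).isPreconnected hy hzero hx

theorem hasMeromorphicValue (h : IsQuotientOnBall F G H c R) (hx : x ∈ Metric.ball c R)
    (hxH : H x ≠ 0) : HasMeromorphicValue F x (G x / H x) :=
  hasMeromorphicValue_div (h.analyticAt_num hx) (h.analyticAt_den hx) (h.eventually_eq_div hx) hxH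

theorem circleAverage_div_eq_meromorphicValue (h : IsQuotientOnBall F G H c R) (hr : 0 < r)
    (hdisc : ∀ s ∈ Metric.closedBall (0 : ℂ) r, y + s • v ∈ regularSet F)
    (hcircle : ∀ s ∈ Metric.sphere (0 : ℂ) r,
      y + s • v ∈ Metric.ball c R ∧ H (y + s • v) ≠ 0) :
    Real.circleAverage (fun s => G (y + s • v) / H (y + s • v)) 0 r = meromorphicValue F y := by
  have diffContOnCl : DiffContOnCl ℂ (fun s : ℂ => meromorphicValue F (y + s • v))
      (Metric.ball 0 |r|) := by
    refine DifferentiableOn.diffContOnCl fun s hs => ?_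
    rw [abs_of_pos hr, closure_ball _ hr.ne'] at hs
    exact (differentiableAt_comp_line
      (analyticAt_meromorphicValue (hdisc s hs))).differentiableWithinAt
  calc Real.circleAverage (fun s => G (y + s • v) / H (y + s • v)) 0 r
      = Real.circleAverage (fun s => meromorphicValue F (y + s • v)) 0 r := by
        refine Real.circleAverage_congr_sphere fun s hs => ?_
        rw [abs_of_pos hr] at hs
        exact (h.hasMeromorphicValue (hcircle s hs).1 (hcircle s hs).2).meromorphicValue_eq.symm
    _ = meromorphicValue F y := by rw [diffContOnCl.circleAverage, zero_smul, add_zero]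

/-- By the mean value property the circle averages of `G / H`, which are analytic at `y₀`, coincide
with the given meromorphic function near a point arbitrarily close to `y₀`. -/
theorem mem_regularSet_of_circle (h : IsQuotientOnBall F G H y₀ R) (hr : 0 < r)
    (hcircle : ∀ s ∈ Metric.sphere (0 : ℂ) r,
      y₀ + s • v ∈ Metric.ball y₀ R ∧ H (y₀ + s • v) ≠ 0)
    (hdisc : ∃ᶠ y in 𝓝 y₀, ∀ s ∈ Metric.closedBall (0 : ℂ) r, y + s • v ∈ regularSet F) :
    y₀ ∈ regularSet F := by
  obtain ⟨p, hp⟩ := h.exists_num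
  obtain ⟨q, hq⟩ := h.exists_den
  have hy₀ : y₀ ∈ Metric.ball y₀ R := Metric.mem_ball_self (ENNReal.ofReal_pos.1 hq.r_pos)
  have den_ne {y} (hy : y ∈ Metric.ball y₀ R) : ¬ ∀ᶠ z in 𝓝 y, H z = 0 := by
    obtain ⟨hball, hne⟩ := hcircle r (by simp [hr.le])
    exact h.not_eventually_den_eq_zero hball hne hy
  set Q : (Fin n → ℂ) → ℂ := fun y =>
    Real.circleAverage (fun s => G (y + s • v) / H (y + s • v)) 0 r with hQ_def
  have hQ : AnalyticAt ℂ Q y₀ := analyticAt_circleAverage_div hp hq (by rwa [abs_of_pos hr])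
  have near_circle := eventually_forall_add_smul_mem (isCompact_sphere (0 : ℂ) r)
    (isOpen_setOf_mem_ball_and_ne_zero hq) hcircle
  have hQ_mul : ∃ᶠ y₁ in 𝓝 y₀, ∀ᶠ y in 𝓝 y₁, Q y * H y - G y = 0 := by
    refine (hdisc.and_eventually
      ((Metric.isOpen_ball.eventually_mem hy₀).and near_circle).eventually_nhds).mono ?_
    rintro y₁ ⟨hy₁, near_y₁⟩
    filter_upwards [eventually_forall_add_smul_mem (isCompact_closedBall 0 r) isOpen_regularSet hy₁,
      near_y₁] with y hydisc ⟨hy, hycircle⟩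
    have hyreg : y ∈ regularSet F := by simpa using hydisc 0 (by simp [hr.le])
    simp only [hQ_def]
    rw [h.circleAverage_div_eq_meromorphicValue hr hydisc hycircle, sub_eq_zero]
    exact (hasMeromorphicValue_meromorphicValue hyreg).mul_eq (h.analyticAt_num hy)
      (h.analyticAt_den hy) (den_ne hy) (h.eventually_eq_div hy)
  have hQ_eq : ∀ᶠ y in 𝓝 y₀, Q y * H y - G y = 0 := by
    by_contra hne
    exact hQ_mul (eventually_not_eventually_eq_zero
      ((hQ.mul (h.analyticAt_den hy₀)).sub (h.analyticAt_num hy₀)) hne)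
  refine ⟨Q y₀, Q, H, hQ, h.analyticAt_den hy₀, den_ne hy₀, ?_, rfl⟩
  filter_upwards [hQ_eq, h.eventually_eq_div hy₀] with y hyQ hyF hne
  rw [hyF hne, ← sub_eq_zero.1 hyQ, mul_div_cancel_right₀ _ hne]

end IsQuotientOnBall

end Quotient

/-! ### Regular points of a meromorphic function on an analytic curve -/

theorem pos_of_iterated_deriv_pos {d : ℕ} {φ : ℕ → ℝ → ℝ}
    (hφ : ∀ j < d, ∀ t ∈ Set.Icc (0 : ℝ) 1, HasDerivAt (φ j) (φ (j + 1) t) t)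
    (hzero : ∀ j < d, φ j 0 = 0) (hpos : ∀ t ∈ Set.Ioc (0 : ℝ) 1, 0 < φ d t) :
    ∀ t ∈ Set.Ioc (0 : ℝ) 1, 0 < φ 0 t := by
  induction d generalizing φ with
  | zero => exact hpos
  | succ d ih =>
    have deriv_pos := ih (φ := fun j => φ (j + 1)) (fun j hj => hφ (j + 1) (by lia))
      (fun j hj => hzero (j + 1) (by lia)) hpos
    have strictMonoOn : StrictMonoOn (φ 0) (Set.Icc 0 1) := by
      refine strictMonoOn_of_deriv_pos (convex_Icc 0 1)
        (fun t ht => (hφ 0 (by lia) t ht).continuousAt.continuousWithinAt) fun t ht => ?_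
      rw [interior_Icc] at ht
      rw [(hφ 0 (by lia) t (Set.Ioo_subset_Icc_self ht)).deriv]
      exact deriv_pos t (Set.Ioo_subset_Ioc_self ht)
    intro t ht
    rw [← hzero 0 (by lia)]
    exact strictMonoOn (by simp) (Set.Ioc_subset_Icc_self ht) ht.1

section DirectionalDerivative

variable {X : Type*} [NormedAddCommGroup X] [NormedSpace ℂ X] {H : X → ℂ} {v x y y₀ : X} {d : ℕ}

theorem analyticAt_iteratedFDeriv (hH : AnalyticAt ℂ H x) (j : ℕ) :
    AnalyticAt ℂ (iteratedFDeriv ℂ j H) x :=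
  AnalyticOnNhd.iteratedFDeriv (s := {x}) (by rintro _ rfl; exact hH) j x rfl

theorem analyticAt_iteratedFDeriv_apply (hH : AnalyticAt ℂ H x) (v : X) (j : ℕ) :
    AnalyticAt ℂ (fun y => iteratedFDeriv ℂ j H y fun _ => v) x :=
  ((ContinuousMultilinearMap.apply ℂ (fun _ : Fin j => X) ℂ fun _ => v).analyticAt _).comp_of_eq
    (analyticAt_iteratedFDeriv hH j) rfl

theorem hasDerivAt_iteratedFDeriv_apply_line {s : ℂ} {t : ℝ}
    (hH : AnalyticAt ℂ H (y + (t * s) • v)) (j : ℕ) :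
    HasDerivAt (fun t : ℝ => iteratedFDeriv ℂ j H (y + (t * s) • v) fun _ => v)
      (s * iteratedFDeriv ℂ (j + 1) H (y + (t * s) • v) fun _ => v) t := by
  have line : HasDerivAt (fun t : ℝ => y + (t * s) • v) (s • v) t := by
    simpa using (((Complex.ofRealCLM.hasDerivAt (x := t)).mul_const s).smul_const v).const_add y
  have apply_line := ((ContinuousMultilinearMap.apply ℂ (fun _ : Fin j => X) ℂ
    fun _ => v).hasFDerivAt.comp _ (analyticAt_iteratedFDeriv hH j).differentiableAt.hasFDerivAt
      |>.restrictScalars ℝ).comp_hasDerivAt t line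
  refine apply_line.congr_deriv ?_
  change (fderiv ℂ (iteratedFDeriv ℂ j H) (y + (t * s) • v) (s • v)) (fun _ => v) = _
  rw [_root_.map_smul]
  rfl

theorem exists_iteratedFDeriv_apply_ne_zero (hH : AnalyticAt ℂ H x)
    (hne : ¬ ∀ᶠ y in 𝓝 x, H y = 0) : ∃ v j, iteratedFDeriv ℂ j H x (fun _ => v) ≠ 0 := by
  by_contra! hzero
  obtain ⟨p, r, hp⟩ := hH
  refine hne ?_
  filter_upwards [Metric.eball_mem_nhds x hp.r_pos] with y hy
  have taylor := hp.hasSum_iteratedFDeriv (y := y - x) (by simpa [edist_eq_enorm_sub] using hy)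
  simp only [hzero, smul_zero, add_sub_cancel] at taylor
  exact taylor.unique hasSum_zero

theorem eventually_forall_mem_closedBall_add_smul_mem {U : Set X} (hU : U ∈ 𝓝 y₀) (v : X) :
    ∀ᶠ r in 𝓝[>] (0 : ℝ), ∀ᶠ y in 𝓝 y₀, ∀ s ∈ Metric.closedBall (0 : ℂ) r, y + s • v ∈ U := by
  have hcont : Tendsto (fun z : X × ℂ => z.1 + z.2 • v) (𝓝 y₀ ×ˢ 𝓝 0) (𝓝 y₀) := by
    rw [← nhds_prod_eq]
    exact Continuous.tendsto' (by fun_prop) _ _ (by simp)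
  obtain ⟨V, hV, W, hW, hVW⟩ := eventually_prod_iff.1 (hcont.eventually hU)
  filter_upwards [nhdsWithin_le_nhds (eventually_closedBall_subset hW)] with r hr
  filter_upwards [hV] with y hy s hs
  exact hVW hy (hr hs)

/-- Near `y₀` the derivative of order `d` in the direction `v` stays in a half-plane, and so do
the values along rays, which are obtained from it by integration. -/
theorem eventually_forall_ne_zero_of_iteratedFDeriv (hH : AnalyticAt ℂ H y₀)
    (hd : iteratedFDeriv ℂ d H y₀ (fun _ => v) ≠ 0) :
    ∀ᶠ r in 𝓝[>] (0 : ℝ), ∀ᶠ y in 𝓝 y₀, (∀ j < d, iteratedFDeriv ℂ j H y (fun _ => v) = 0) →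
      ∀ s ∈ Metric.closedBall (0 : ℂ) r, s ≠ 0 → H (y + s • v) ≠ 0 := by
  set c := iteratedFDeriv ℂ d H y₀ fun _ => v
  have half_plane : ∀ᶠ x in 𝓝 y₀, AnalyticAt ℂ H x ∧
      0 < (star c * iteratedFDeriv ℂ d H x fun _ => v).re := by
    refine hH.eventually_analyticAt.and ?_
    have hcont : ContinuousAt (fun x => (star c * iteratedFDeriv ℂ d H x fun _ => v).re) y₀ :=
      Complex.continuous_re.continuousAt.comp
        (continuousAt_const.mul (analyticAt_iteratedFDeriv_apply hH v d).continuousAt)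
    refine hcont.eventually_const_lt ?_
    change 0 < (star c * c).re
    rw [← starRingEnd_apply, Complex.conj_mul', ← Complex.ofReal_pow, Complex.ofReal_re]
    positivity
  filter_upwards [eventually_forall_mem_closedBall_add_smul_mem half_plane v] with r hr
  filter_upwards [hr] with y hy hzero s hs hs0 hHs
  have on_ray {t : ℝ} (ht : t ∈ Set.Icc (0 : ℝ) 1) := hy (t * s) <| by
    rw [mem_closedBall_zero_iff, norm_mul, Complex.norm_real, Real.norm_of_nonneg ht.1]
    exact (mul_le_of_le_one_left (norm_nonneg s) ht.2).trans (mem_closedBall_zero_iff.1 hs)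
  have value_pos := pos_of_iterated_deriv_pos (d := d) (φ := fun j t =>
    (star (c * s ^ d) * (s ^ j * iteratedFDeriv ℂ j H (y + (t * s) • v) fun _ => v)).re)
    (fun j _ t ht => ?_) (fun j hj => ?_) (fun t ht => ?_) 1 (by simp)
  · simp [hHs] at value_pos
  · refine (Complex.reCLM.hasFDerivAt.comp_hasDerivAt t
      (((hasDerivAt_iteratedFDeriv_apply_line (on_ray ht).1 j).const_mul (s ^ j)).const_mul
        (star (c * s ^ d)))).congr_deriv ?_
    rw [Complex.reCLM_apply, pow_succ, mul_assoc (s ^ j)]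
  · simp [hzero j hj]
  · have hpos := (on_ray (Set.Ioc_subset_Icc_self ht)).2
    have hs_sq : star (s ^ d) * s ^ d = (‖s ^ d‖ ^ 2 : ℝ) := by
      rw [← starRingEnd_apply, Complex.conj_mul', Complex.ofReal_pow]
    rw [star_mul, mul_mul_mul_comm, hs_sq, Complex.re_ofReal_mul]
    exact mul_pos (pow_pos (norm_pos_iff.2 (pow_ne_zero d hs0)) 2) hpos

end DirectionalDerivative

theorem exists_eventually_nhdsNE_forall_eq_zero_and_ne_zero {g : ℕ → ℂ → ℂ} {z₀ : ℂ}
    (hg : ∀ j, AnalyticAt ℂ (g j) z₀) {j : ℕ} (hj : g j z₀ ≠ 0) :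
    ∃ d, ∀ᶠ z in 𝓝[≠] z₀, (∀ j < d, g j z = 0) ∧ g d z ≠ 0 := by
  classical
  have hex : ∃ d, ¬ ∀ᶠ z in 𝓝 z₀, g d z = 0 := ⟨j, fun h => hj h.self_of_nhds⟩
  refine ⟨Nat.find hex, Filter.Eventually.and ?_ ?_⟩
  · refine (eventually_all_finite (Set.finite_lt_nat _)).2 fun i hi => ?_
    exact nhdsWithin_le_nhds (not_not.1 (Nat.find_min hex hi))
  · exact ((hg _).eventually_eq_zero_or_eventually_ne_zero).resolve_left (Nat.find_spec hex)

theorem mem_regularSet_of_frequently {n d : ℕ} {F G H : (Fin n → ℂ) → ℂ} {v y₀ : Fin n → ℂ}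
    (hG : AnalyticAt ℂ G y₀) (hH : AnalyticAt ℂ H y₀)
    (hF : ∀ᶠ x in 𝓝 y₀, H x ≠ 0 → F x = G x / H x)
    (hd : iteratedFDeriv ℂ d H y₀ (fun _ => v) ≠ 0)
    (hfreq : ∃ᶠ y in 𝓝 y₀, (∀ j < d, iteratedFDeriv ℂ j H y (fun _ => v) = 0) ∧
      y ∈ regularSet F) : y₀ ∈ regularSet F := by
  obtain ⟨R, hR, hquot⟩ := exists_isQuotientOnBall hG hH hF
  have hzero : ∀ j < d, iteratedFDeriv ℂ j H y₀ (fun _ => v) = 0 := fun j hj =>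
    eq_of_frequently (analyticAt_iteratedFDeriv_apply hH v j).continuousAt continuousAt_const
      (hfreq.mono fun y hy => hy.1 j hj)
  obtain ⟨r, hball, hne, hr⟩ :=
    ((eventually_forall_mem_closedBall_add_smul_mem (Metric.ball_mem_nhds y₀ hR) v).and
      ((eventually_forall_ne_zero_of_iteratedFDeriv hH hd).and self_mem_nhdsWithin)).exists
  refine hquot.mem_regularSet_of_circle (v := v) hr (fun s hs => ?_) ?_
  · have hs' := Metric.sphere_subset_closedBall hs
    exact ⟨hball.self_of_nhds s hs',
      hne.self_of_nhds hzero s hs' (Metric.ne_of_mem_sphere hs (ne_of_gt hr))⟩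
  · refine (hfreq.and_eventually (hball.and hne)).mono ?_
    rintro y ⟨⟨hyzero, hyreg⟩, hyball, hyne⟩ s hs
    rcases eq_or_ne s 0 with rfl | hs0
    · simpa using hyreg
    · exact ⟨_, hquot.hasMeromorphicValue (hyball s hs) (hyne hyzero s hs hs0)⟩

theorem eventually_nhdsNE_or_of_eventually {P : ℂ → Prop} {z₀ : ℂ}
    (h : ∀ᶠ z₁ in 𝓝[≠] z₀, (∀ᶠ z in 𝓝 z₁, P z) ∨ ∀ᶠ z in 𝓝 z₁, ¬P z) :
    (∀ᶠ z in 𝓝[≠] z₀, P z) ∨ ∀ᶠ z in 𝓝[≠] z₀, ¬P z := by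
  obtain ⟨δ, hδ, hball⟩ := Metric.mem_nhdsWithin_iff.1 h
  have hconn : IsPreconnected (Metric.ball z₀ δ \ {z₀}) :=
    (isPathConnected_ball_diff_countable (Set.countable_singleton z₀) z₀
      hδ).isConnected.isPreconnected
  have hmem : ∀ᶠ z in 𝓝[≠] z₀, z ∈ Metric.ball z₀ δ \ {z₀} :=
    sdiff_mem_nhdsWithin_compl (Metric.ball_mem_nhds z₀ hδ) _
  obtain ⟨w, hw⟩ := hmem.exists
  have hiff : ∀ z ∈ Metric.ball z₀ δ \ {z₀}, P w ↔ P z := fun z hz => by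
    refine hconn.induction₂ (fun z₁ z₂ => P z₁ ↔ P z₂) (fun z₁ hz₁ => nhdsWithin_le_nhds ?_)
      (fun _ _ _ _ _ _ => Iff.trans) (fun _ _ _ _ => Iff.symm) hw hz
    rcases hball hz₁ with hP | hP
    · exact hP.mono fun _ => iff_of_true hP.self_of_nhds
    · exact hP.mono fun _ => iff_of_false hP.self_of_nhds
  by_cases hPw : P w
  · exact Or.inl (hmem.mono fun z hz => (hiff z hz).1 hPw)
  · exact Or.inr (hmem.mono fun z hz hPz => hPw ((hiff z hz).2 hPz))

theorem eventually_mem_regularSet_or {n : ℕ} {F : (Fin n → ℂ) → ℂ} (hF : IsMeromorphic F)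
    {f : ℂ → Fin n → ℂ} {z₀ : ℂ} (hf : AnalyticAt ℂ f z₀) :
    (∀ᶠ z in 𝓝[≠] z₀, f z ∈ regularSet F) ∨ ∀ᶠ z in 𝓝[≠] z₀, f z ∉ regularSet F := by
  obtain ⟨G, H, hG, hH, hne, hFGH⟩ := hF (f z₀)
  obtain ⟨v, j, hj⟩ := exists_iteratedFDeriv_apply_ne_zero hH hne
  obtain ⟨d, hd⟩ := exists_eventually_nhdsNE_forall_eq_zero_and_ne_zero
    (fun j => (analyticAt_iteratedFDeriv_apply hH v j).comp hf) hj
  refine eventually_nhdsNE_or_of_eventually ?_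
  filter_upwards [eventually_nhdsNE_eventually_nhds_iff.2 hd, nhdsWithin_le_nhds
    (hf.eventually_analyticAt.and (hf.continuousAt.eventually (hG.eventually_analyticAt.and
      (hH.eventually_analyticAt.and hFGH.eventually_nhds))))] with z₁ hd₁ ⟨hf₁, hG₁, hH₁, hF₁⟩
  by_cases hreg : f z₁ ∈ regularSet F
  · exact Or.inl (hf₁.continuousAt.eventually (isOpen_regularSet.mem_nhds hreg))
  · refine Or.inr (not_frequently.1 fun hfreq => hreg ?_)
    refine mem_regularSet_of_frequently hG₁ hH₁ hF₁ hd₁.self_of_nhds.2 ?_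
    exact hf₁.continuousAt.tendsto.frequently
      ((hfreq.and_eventually hd₁).mono fun z hz => ⟨hz.2.1, hz.1⟩)

/-! ### Meromorphic operations -/

theorem eventually_eventually_nhdsNE {X : Type*} [TopologicalSpace X] [T1Space X] {z : X}
    {Q : X → Prop} (h : ∀ᶠ w in 𝓝[≠] z, Q w) : ∀ᶠ w in 𝓝 z, ∀ᶠ u in 𝓝[≠] w, Q u := by
  filter_upwards [eventually_eventually_nhds.2 (eventually_nhdsWithin_iff.1 h)] with w hw
  by_cases hwz : w = z
  · rwa [hwz]
  · filter_upwards [nhdsWithin_le_nhds hw, nhdsWithin_le_nhds (eventually_ne_nhds hwz)]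
      with u hu hne
    exact hu hne

theorem eventually_mem_regularSet_or_of_holomorphicAt {n : ℕ} {F : (Fin n → ℂ) → ℂ}
    (hF : IsMeromorphic F) {f : Fin n → Sphere → ℂ} {z : Sphere}
    (hf : ∀ i, HolomorphicAt (f i) z) :
    (∀ᶠ w in 𝓝 z, ∀ᶠ u in 𝓝[≠] w, (fun i => f i u) ∈ regularSet F) ∨
      ∀ᶠ w in 𝓝 z, ¬ ∀ᶠ u in 𝓝[≠] w, (fun i => f i u) ∈ regularSet F := by
  have hchart : AnalyticAt ℂ (fun w i => f i (chart z w)) 0 :=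
    analyticAt_pi_iff.2 fun i => holomorphicAt_iff_chart.1 (hf i)
  rcases eventually_mem_regularSet_or hF hchart with h | h
  · exact Or.inl (eventually_eventually_nhdsNE (eventually_nhdsNE_iff_chart.2 h))
  · have h' : ∀ᶠ w in 𝓝[≠] z, (fun i => f i w) ∉ regularSet F := eventually_nhdsNE_iff_chart.2 h
    refine Or.inr ((eventually_eventually_nhdsNE h').mono ?_)
    intro w hw hcon
    obtain ⟨u, hreg, hnot⟩ := (hw.and hcon).exists
    exact hreg hnot

theorem isSGerm_of_isMeromorphicImage {n : ℕ} {F : (Fin n → ℂ) → ℂ} (hF : IsMeromorphic F)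
    {a : Sphere} {φ : Fin n → RegularGermAt a} {χ : RegularGermAt a}
    (hφ : ∀ i, IsSGerm ⟨a, φ i⟩) (h : IsMeromorphicImage F φ χ) : IsSGerm ⟨a, χ⟩ := by
  obtain ⟨f, k, hφf, hχk, hval⟩ := h
  have hf (i) : HolomorphicAt (f i) a := Rep.holomorphicAt (ψ := ⟨a, φ i⟩) (hφf i)
  have hk : HolomorphicAt k a := Rep.holomorphicAt (ψ := ⟨a, χ⟩) hχk
  obtain rfl : φ = fun i => (germAt (f i) a (hf i)).2 := funext fun i => Subtype.ext (hφf i)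
  obtain rfl : χ = (germAt k a hk).2 := Subtype.ext hχk
  have hreg {g z} (hg : IsJointBranch hf g z) :
      ∀ᶠ w in 𝓝[≠] z, (fun i => g i w) ∈ regularSet F := by
    refine hg.permanence (P := fun g z => ∀ᶠ w in 𝓝[≠] z, (fun i => g i w) ∈ regularSet F) ?_
      (fun g z => eventually_mem_regularSet_or_of_holomorphicAt hF)
      (hval.mono fun w hw => ⟨_, hw⟩)
    intro g g' z hgg h
    filter_upwards [nhdsWithin_le_nhds (eventually_all.2 hgg), h] with w hw hwreg
    simpa only [hw] using hwreg
  set B : Set Sphere := {z | ∃ g, IsJointBranch hf g z ∧ (fun i => g i z) ∉ regularSet F}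
  have hB : B.Countable := by
    refine countable_setOf_isJointBranch
      (P := fun g z => (fun i => g i z) ∉ regularSet F) (fun g g' z hgg h => ?_)
      (fun g z hg => (hreg hg).mono fun w => not_not_intro)
    simpa only [fun i => (hgg i).self_of_nhds] using h
  have hA := ((Set.countable_iUnion hφ).union hB).insert a
  refine hA.mono <| singularSet_subset_of_eventuallyEq_op (hF := hf) hA (fun i => ?_)
    (Op := fun g w => meromorphicValue F fun i => g i w) ?_ (fun g b hg hb => ?_) hk ?_
  · exact (Set.subset_iUnion (fun i => singularSet (germAt (f i) a (hf i))) i).trans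
      (Set.subset_union_left.trans (Set.subset_insert _ _))
  · intro g g' w hgg
    filter_upwards [eventually_all.2 hgg] with u hu
    simp only [hu]
  · refine HolomorphicAt.comp_analyticAt (analyticAt_meromorphicValue ?_) hg.holomorphicAt
    exact not_not.1 fun hn => hb (Or.inr (Or.inr ⟨g, hg, hn⟩))
  · filter_upwards [eventually_eventually_nhds.2 (eventually_nhdsWithin_iff.1 hval)] with z hz hzA
    filter_upwards [hz, eventually_ne_nhds fun hza : z = a => hzA (Or.inl hza)] with w hw hwa
    exact (hw hwa).meromorphicValue_eq.symm

end SFun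

end

theorem theorem3 :
    (∀ f h : MultivaluedFunction, IsSFunction f → IsDerivativeOf h f → IsSFunction h) ∧
    (∀ f h : MultivaluedFunction, IsSFunction f → IsIntegralOf h f → IsSFunction h) ∧
    (∀ g f h : MultivaluedFunction, IsSFunction g → IsSFunction f →
      IsCompositionOf h g f → IsSFunction h) ∧
    (∀ (n : ℕ) (F : (Fin n → ℂ) → ℂ) (f : Fin n → MultivaluedFunction) (h : MultivaluedFunction),
      IsMeromorphic F → (∀ i, IsSFunction (f i)) →
      IsMeromorphicOperationOf h F f → IsSFunction h) ∧
    (∀ (n : ℕ) (f : Fin n → MultivaluedFunction) (h : MultivaluedFunction),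
      (∀ i, IsSFunction (f i)) → IsAlgebraicSolutionOf h f → IsSFunction h) ∧
    (∀ (n : ℕ) (f : Fin n → MultivaluedFunction) (h : MultivaluedFunction),
      (∀ i, IsSFunction (f i)) → IsLinearODESolutionOf h f → IsSFunction h) := by
  refine ⟨?_, ?_, ?_, ?_, ?_, ?_⟩
  · rintro f _ hf ⟨a, φ, hφ, rfl⟩
    exact isSFunction_generatedBy (isSGerm_derivGerm (hf _ hφ))
  · rintro f _ hf ⟨a, _, χ, hφ, rfl, rfl⟩
    exact isSFunction_generatedBy (isSGerm_of_derivGerm (hf _ hφ))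
  · rintro g f _ hg hf ⟨a, φ, ψ, hφ, hψ, rfl⟩
    exact isSFunction_generatedBy (isSGerm_compGerm (hf _ hφ) (hg _ hψ))
  · rintro n F f _ hF hf ⟨a, φ, χ, hφ, hχ, rfl⟩
    exact isSFunction_generatedBy
      (isSGerm_of_isMeromorphicImage hF (fun i => hf i _ (hφ i)) hχ)
  · rintro n f _ hf ⟨a, φ, χ, hφ, hχ, rfl⟩
    exact isSFunction_generatedBy (isSGerm_of_algebraic_equation (fun i => hf i _ (hφ i)) hχ)
  · rintro n f _ hf ⟨a, φ, χ, hφ, hχ, rfl⟩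
    exact isSFunction_generatedBy (isSGerm_of_linear_equation (fun i => hf i _ (hφ i)) hχ)
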